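/- **Proposition 4.4.** An index is a finite (possibly empty) tuple $\boldsymbol k=(k_1,\dots,k_r)$ of positive integers; it is admissible if it is empty or $k_r\ge 2$. For $\boldsymbol k$ admissible let $\zeta(\boldsymbol k)=\sum_{0<n_1<\cdots<n_r} n_1^{-k_1}\cdots n_r^{-k_r}$ (with $\zeta(\varnothing)=1$), and let $\mathcal Z\subset\mathbb R$ be the $\mathbb Q$-subalgebra generated by all these multiple zeta values. Put $\mathrm{wt}(\boldsymbol k)=k_1+\cdots+k_r$, $\boldsymbol k_{[i]}=(k_1,\dots,k_i)$, $\boldsymbol k^{[i]}=(k_{i+1},\dots,k_r)$, and write $\overline{\boldsymbol k}$ for the reversed tuple. Let $\mathfrak H^1=\mathbb Q+y\,\mathbb Q\langle x,y\rangle$, with $\mathbb Q$-basis $z_{\boldsymbol k}=z_{k_1}\cdots z_{k_r}$, where $z_k=yx^{k-1}$. For $\bullet\in\{*,\mathrm{sh}\}$ (harmonic and shuffle product on $\mathfrak H^1$), let $Z^\bullet:\mathfrak H^1\to\mathbb R[T]$ be the unique $\mathbb Q$-linear map that is a ring homomorphism for the product $\bullet$, sends $z_{\boldsymbol k}$ to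 $\zeta(\boldsymbol k)$ for admissible $\boldsymbol k$, and sends $y$ to $T$; the regularized multiple zeta value $\zeta^\bullet(\boldsymbol k)$ is the value of $Z^\bullet(z_{\boldsymbol k})$ at $T=0$. Define $$\zeta^\bullet_{\widehat{\mathcal S}}(\boldsymbol k)=\sum_{i=0}^r(-1)^{\mathrm{wt}(\boldsymbol k^{[i]})}\zeta^\bullet(\boldsymbol k_{[i]})\sum_{\boldsymbol l=(l_{i+1},\dots,l_r)\in\mathbb Z_{\ge0}^{r-i}}\Bigl(\prod_{j=i+1}^r\binom{k_j+l_j-1}{l_j}\Bigr)\zeta^\bullet\bigl(\overline{\boldsymbol k^{[i]}+\boldsymbol l}\bigr)\,t^{\mathrm{wt}(\boldsymbol l)}\in\mathbb R[[t]],$$ and let $Z^\bullet_{\widehat{\mathcal S}}:\mathfrak H^1\to\mathbb R[[t]]$ be the $\mathbb Q$-linear map with $z_{\boldsymbol k}\mapsto\zeta^\bullet_{\widehat{\mathcal S}}(\boldsymbol k)$. Equip $\mathbb R[[t]]$ with the $t$-adic topology and set $$\mathcal Z^\bullet_{\widehat{\mathcal S}}=\Bigl\{\sum_{i=1}^\infty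 a_i\,\zeta^\bullet_{\widehat{\mathcal S}}(\boldsymbol k_i)\,t^{n_i}\ \Big|\ a_i\in\mathbb Q,\ \boldsymbol k_i\text{ an index},\ n_i\in\mathbb Z_{\ge0},\ n_i\to\infty\Bigr\}.$$ Then, for each $\bullet\in\{*,\mathrm{sh}\}$, $$\mathcal Z^\bullet_{\widehat{\mathcal S}}=\Bigl\{\sum_{n=0}^\infty Z^\bullet_{\widehat{\mathcal S}}(w_n)\,t^n\ \Big|\ w_n\in\mathfrak H^1\Bigr\}\qquad\text{and}\qquad \mathcal Z^\bullet_{\widehat{\mathcal S}}=\mathcal Z[[t]].$$ Moreover the $t$-adic closure in $\mathbb R[[t]]$ of the $\mathbb Q$-span of all $\zeta^\bullet_{\widehat{\mathcal S}}(\boldsymbol k)\,t^n$ ($\boldsymbol k$ an index, $n\ge0$) equals $\mathcal Z[[t]]$. -/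

import Mathlib

namespace TAdicSMZV

open Filter PowerSeries

noncomputable section

/-- An index `(k₁, …, k_r)`: a finite, possibly empty, tuple of positive integers. -/
abbrev Index := List ℕ+

/-- The weight `k₁ + ⋯ + k_r`. -/
def wt (k : Index) : ℕ := (k.map fun a => (a : ℕ)).sum

/-- The number of entries equal to `1` at the end of an index. -/
def trailingOnes (k : Index) : ℕ := (k.reverse.takeWhile fun a => decide (a = 1)).length

/-- An index is admissible if it is empty or its last entry is at least `2`. -/
def Admissible (k : Index) : Prop := ∀ a ∈ k.getLast?, 2 ≤ a

/-- The multiple zeta value `ζ(k) = ∑_{0 < n₁ < ⋯ < n_r} 1 / (n₁^{k₁} ⋯ n_r^{k_r})`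
(only used for admissible `k`, where the series converges; it is `1` for the empty index). -/
def mzv (k : Index) : ℝ :=
  ∑' n : {n : Fin k.length → ℕ+ // StrictMono n},
    ∏ j, (((n.1 j : ℕ) : ℝ) ^ ((k.get j : ℕ+) : ℕ))⁻¹

/-- `𝒵`, the `ℚ`-subalgebra of `ℝ` generated by all multiple zeta values. -/
def mzvAlgebra : Subalgebra ℚ ℝ := Algebra.adjoin ℚ {a | ∃ k, Admissible k ∧ mzv k = a}

/-! ### Harmonic and shuffle products

`𝔥¹ = ℚ + y ℚ⟨x, y⟩` has the basis `z_k = z_{k₁} ⋯ z_{k_r}` with `z_a = y x^{a-1}`. The product of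
two basis elements is a sum of basis elements, recorded here as the list of its summands (with
repetition). The recursions peel off the *last* letters of the two words, so they are run on
reversed lists. -/

/-- `𝔥¹`, with the basis element `z_k` given by `Finsupp.single k 1`. -/
abbrev H1 := Index →₀ ℚ

/-- The harmonic product, on reversed words in the letters `z_a`:
`w₁z_a * w₂z_b = (w₁ * w₂z_b) z_a + (w₁z_a * w₂) z_b + (w₁ * w₂) z_{a+b}`. -/
def harmonicRev : List ℕ+ → List ℕ+ → List (List ℕ+)
  | [], l => [l]
  | a :: k, [] => [a :: k]
  | a :: k, b :: l =>
      (harmonicRev k (b :: l)).map (a :: ·) ++ (harmonicRev (a :: k) l).map (b :: ·) ++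
        (harmonicRev k l).map ((a + b) :: ·)
  termination_by k l => k.length + l.length

/-- The two letters of `ℚ⟨x, y⟩`. -/
inductive Letter
  | x
  | y

/-- The shuffle product, on reversed words in `x` and `y`:
`w₁u₁ ш w₂u₂ = (w₁ ш w₂u₂) u₁ + (w₁u₁ ш w₂) u₂`. -/
def shuffleRev : List Letter → List Letter → List (List Letter)
  | [], w => [w]
  | u :: v, [] => [u :: v]
  | u₁ :: w₁, u₂ :: w₂ =>
      (shuffleRev w₁ (u₂ :: w₂)).map (u₁ :: ·) ++ (shuffleRev (u₁ :: w₁) w₂).map (u₂ :: ·)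
  termination_by v w => v.length + w.length

/-- The reversed word `x^{k_r-1} y ⋯ x^{k₁-1} y` of `z_k = y x^{k₁-1} ⋯ y x^{k_r-1}`, from the
reversed index `(k_r, …, k₁)`. -/
def wordRev : List ℕ+ → List Letter
  | [] => []
  | a :: k => List.replicate ((a : ℕ) - 1) Letter.x ++ Letter.y :: wordRev k

/-- The inverse of `wordRev`, on reversed words of elements of `𝔥¹` (those that are empty or end
in `y`). -/
def indexRev : List Letter → List ℕ+
  | [] => []
  | Letter.y :: w => 1 :: indexRev w
  | Letter.x :: w =>
      match indexRev w with
      | [] => []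
      | a :: k => (a + 1) :: k

/-- The two products, `∗` (harmonic) and `ш` (shuffle), on `𝔥¹`. -/
inductive Bullet
  | harmonic
  | shuffle

/-- The list of the indices `h`, with repetition, for which `z_k • z_l = ∑ z_h`. -/
def Bullet.mul : Bullet → Index → Index → List Index
  | .harmonic, k, l => (harmonicRev k.reverse l.reverse).map List.reverse
  | .shuffle, k, l =>
      (shuffleRev (wordRev k.reverse) (wordRev l.reverse)).map fun w => (indexRev w).reverse

/-! ### Regularized multiple zeta values -/

theorem trailingOnes_dropLast_lt {k : Index} (h : trailingOnes k ≠ 0) :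
    trailingOnes k.dropLast < trailingOnes k := by
  induction k using List.reverseRecOn with
  | nil => simp [trailingOnes] at h
  | append_singleton l a _ =>
    by_cases ha : a = 1
    · simp [trailingOnes, ha]
    · simp [trailingOnes, ha] at h

/-- The regularized multiple zeta value `ζ^•(k; T) ∈ ℝ[T]`: the image of `z_k` under the algebra
homomorphism `Z^• : 𝔥¹_• → ℝ[T]` that extends `z_k ↦ ζ(k)` (`k` admissible) and has `Z^•(y) = T`.
If `k = (k', 1)` has `s ≥ 1` trailing ones, then `z_1 • z_{k'}` is the sum of `s z_k` and of terms
`z_h` with fewer than `s` trailing ones, so that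
`s ζ^•(k; T) = T ζ^•(k'; T) - ∑_h ζ^•(h; T)`. This is the recursion below. -/
def regMZV (b : Bullet) (k : Index) : Polynomial ℝ :=
  if _h : trailingOnes k = 0 then Polynomial.C (mzv k)
  else
    Polynomial.C (trailingOnes k : ℝ)⁻¹ *
      (Polynomial.X * regMZV b k.dropLast -
        (((b.mul [1] k.dropLast).filter fun h => trailingOnes h < trailingOnes k).attach.map
          fun h => regMZV b h.1).sum)
  termination_by trailingOnes k
  decreasing_by
  · exact trailingOnes_dropLast_lt _h
  · simpa using (List.mem_filter.1 h.2).2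

/-! The next lemmas show that `ζ^•(·; T)` as just defined is the only possible regularization. -/

/-- The number of leading ones. -/
def leadingOnes (l : List ℕ+) : ℕ := (l.takeWhile fun a => decide (a = 1)).length

theorem harmonicRev_one_sum {M : Type*} [AddCommGroup M] (l : List ℕ+) (f : List ℕ+ → M) :
    ((harmonicRev [1] l).map f).sum = (leadingOnes l + 1) • f (1 :: l) +
      (((harmonicRev [1] l).filter fun h => leadingOnes h < leadingOnes l + 1).map f).sum := by
  induction l generalizing f with
  | nil => simp [harmonicRev, leadingOnes]
  | cons a l ih =>
    have h2 : (1 : ℕ+) + a ≠ 1 := by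
      intro h
      have := congrArg PNat.val h
      have := a.pos
      simp at *
    by_cases ha : a = 1
    · subst ha
      have := ih (fun h => f (1 :: h))
      have e : ∀ k : List ℕ+, leadingOnes (1 :: k) = leadingOnes k + 1 := by
        intro k; simp [leadingOnes]
      have e' : ∀ k : List ℕ+, leadingOnes ((1 + 1) :: k) = 0 := by
        intro k; simp [leadingOnes, h2]
      simp [harmonicRev, List.filter_map, Function.comp_def, e, e'] at this ⊢
      rw [this]
      simp only [add_smul, one_smul]
      abel
    · have e : ∀ k : List ℕ+, leadingOnes (a :: k) = 0 := by
        intro k; simp [leadingOnes, ha]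
      have e1 : ∀ k : List ℕ+, leadingOnes (1 :: k) = leadingOnes k + 1 := by
        intro k; simp [leadingOnes]
      have e' : ∀ k : List ℕ+, leadingOnes ((1 + a) :: k) = 0 := by
        intro k; simp [leadingOnes, h2]
      simp [harmonicRev, List.filter_map, Function.comp_def, e, e', e1]

theorem shuffleRev_y_sum {M : Type*} [AddCommGroup M] (w : List Letter) (f : List Letter → M) :
    ((shuffleRev [.y] w).map f).sum = (leadingOnes (indexRev w) + 1) • f (.y :: w) +
      (((shuffleRev [.y] w).filter fun h =>
        leadingOnes (indexRev h) < leadingOnes (indexRev w) + 1).map f).sum := by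
  have e : ∀ v, leadingOnes (indexRev (.y :: v)) = leadingOnes (indexRev v) + 1 := by
    intro v; simp [leadingOnes, indexRev]
  have e' : ∀ v, leadingOnes (indexRev (.x :: v)) = 0 := by
    intro v
    rw [indexRev]
    cases indexRev v with
    | nil => simp [leadingOnes]
    | cons a k =>
      have h2 : a + 1 ≠ (1 : ℕ+) := by
        intro h
        have := congrArg PNat.val h
        have := a.pos
        simp at *
      simp [leadingOnes, h2]
  induction w generalizing f with
  | nil =>
    have h : leadingOnes (indexRev [.y]) = 1 := by simp [leadingOnes, indexRev]
    have h' : leadingOnes (indexRev []) = 0 := by simp [leadingOnes, indexRev]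
    simp [shuffleRev, h, h']
  | cons u w ih =>
    cases u with
    | x => simp [shuffleRev, List.filter_map, Function.comp_def, e, e']
    | y =>
      have := ih (fun h => f (.y :: h))
      simp [shuffleRev, List.filter_map, Function.comp_def, e] at this ⊢
      rw [this]
      simp only [add_smul, one_smul]
      abel

theorem indexRev_wordRev (k : List ℕ+) : indexRev (wordRev k) = k := by
  induction k with
  | nil => rfl
  | cons a k ih =>
    have : ∀ n : ℕ, indexRev (List.replicate n Letter.x ++ Letter.y :: wordRev k) =
        n.succPNat :: k := by
      intro n
      induction n with
      | zero => simp [indexRev, ih]; rfl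
      | succ n ihn => simp [List.replicate_succ, indexRev, ihn]; rfl
    rw [wordRev, this]
    congr 1
    exact PNat.natPred_add_one a |> fun h => PNat.eq (by simpa [PNat.natPred] using h)

/-- `z_1 • z_{k'} = s z_k + (terms with fewer than s trailing ones)` if `k = (k', 1)` has `s ≥ 1`
trailing ones. -/
theorem mul_one_sum {M : Type*} [AddCommGroup M] (b : Bullet) (k : Index)
    (hk : trailingOnes k ≠ 0) (f : Index → M) :
    ((b.mul [1] k.dropLast).map f).sum = trailingOnes k • f k +
      (((b.mul [1] k.dropLast).filter fun h => trailingOnes h < trailingOnes k).map f).sum := by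
  have key : ∀ h : Index, trailingOnes h = leadingOnes h.reverse := fun h => rfl
  induction k using List.reverseRecOn with
  | nil => simp [trailingOnes] at hk
  | append_singleton l a _ =>
    obtain rfl : a = 1 := by
      by_contra ha
      simp [trailingOnes, ha] at hk
    have e : leadingOnes (1 :: l.reverse) = leadingOnes l.reverse + 1 := by simp [leadingOnes]
    cases b with
    | harmonic =>
      have := harmonicRev_one_sum l.reverse (fun h => f h.reverse)
      simpa [Bullet.mul, key, List.filter_map, Function.comp_def, e] using this
    | shuffle =>
      have := shuffleRev_y_sum (wordRev l.reverse) (fun h => f (indexRev h).reverse)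
      have hw : wordRev [1] = [Letter.y] := by simp [wordRev]
      have hi : indexRev (Letter.y :: wordRev l.reverse) = 1 :: l.reverse := by
        simp [indexRev, indexRev_wordRev]
      simpa [Bullet.mul, key, List.filter_map, Function.comp_def, e, hw, hi,
        indexRev_wordRev] using this

/-- Any family multiplicative for `•` that extends `z_k ↦ ζ(k)` (`k` admissible) and has value `T`
at `y = z_1` is `ζ^•(·; T)`. -/
theorem regMZV_unique (b : Bullet) (P : Index → Polynomial ℝ)
    (h_adm : ∀ k, Admissible k → P k = Polynomial.C (mzv k)) (h_one : P [1] = Polynomial.X)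
    (h_mul : ∀ k l, P k * P l = ((b.mul k l).map P).sum) : P = regMZV b := by
  have main : ∀ s k, trailingOnes k = s → P k = regMZV b k := by
    intro s
    induction s using Nat.strong_induction_on with
    | _ s ih =>
      intro k hs
      rw [regMZV]
      split_ifs with h
      · apply h_adm
        intro a ha
        by_contra hlt
        have ha1 : a = 1 := by
          have : a < 1 + 1 := not_le.1 hlt
          exact le_antisymm (PNat.lt_add_one_iff.1 this) (one_le (a := a))
        obtain ⟨l, rfl⟩ := List.getLast?_eq_some_iff.1 ha
        simp [trailingOnes, ha1] at h
      · have h1 := mul_one_sum b k h P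
        rw [← h_mul, h_one, ih _ (hs ▸ trailingOnes_dropLast_lt h) _ rfl] at h1
        have h2 : (((b.mul [1] k.dropLast).filter fun h =>
            trailingOnes h < trailingOnes k).attach.map fun h => regMZV b h.1).sum =
            (((b.mul [1] k.dropLast).filter fun h =>
              trailingOnes h < trailingOnes k).map P).sum := by
          refine congrArg List.sum ((List.map_congr_left ?_).trans (List.attach_map_val (f := P)))
          intro h _
          have := (List.mem_filter.1 h.2).2
          exact (ih _ (hs ▸ (by simpa using this)) _ rfl).symm
        rw [h2, h1, add_sub_cancel_right, nsmul_eq_mul, ← mul_assoc,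
          ← Polynomial.C_eq_natCast, ← Polynomial.C_mul,
          inv_mul_cancel₀ (Nat.cast_ne_zero.2 h), Polynomial.C_1, one_mul]
  funext k
  exact main _ k rfl

/-- `ζ^•(k) = ζ^•(k; 0)`. -/
def regMZV₀ (b : Bullet) (k : Index) : ℝ := (regMZV b k).eval 0

/-! ### `t`-adic symmetric multiple zeta values -/

/-- The tuple `k + l`, for an index `k` and a tuple `l` of non-negative integers. -/
def addTuple (k : Index) (l : Fin k.length → ℕ) : Index :=
  List.ofFn fun j => (⟨(k.get j : ℕ) + l j, Nat.add_pos_left (k.get j).pos _⟩ : ℕ+)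

/-- The product of binomial coefficients `∏_j binom(k_j + l_j - 1, l_j)`. -/
def binom (k : Index) (l : Fin k.length → ℕ) : ℕ :=
  ∏ j, ((k.get j : ℕ) + l j - 1).choose (l j)

/-- `ζ^•_Ŝ(k) = ∑_{i=0}^r (-1)^{wt(k^{[i]})} ζ^•(k_{[i]})
∑_{l ∈ ℤ_{≥0}^{r-i}} b(k^{[i]}; l) ζ^•(reverse of k^{[i]} + l) t^{wt(l)}`,
with `k_{[i]} = (k₁, …, k_i)`, `k^{[i]} = (k_{i+1}, …, k_r)`. The inner sum in the coefficient of
`t^n` is over the tuples `l` of weight `n`. -/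
def smzv (b : Bullet) (k : Index) : PowerSeries ℝ :=
  PowerSeries.mk fun n =>
    ∑ i ∈ Finset.range (k.length + 1),
      (-1) ^ wt (k.drop i) * regMZV₀ b (k.take i) *
        ∑ l ∈ Finset.piAntidiag (Finset.univ : Finset (Fin (k.drop i).length)) n,
          (binom (k.drop i) l : ℝ) * regMZV₀ b (addTuple (k.drop i) l).reverse

/-- The `ℚ`-linear map `Z^•_Ŝ : 𝔥¹ → ℝ⟦t⟧` with `z_k ↦ ζ^•_Ŝ(k)`. -/
def smzvMap (b : Bullet) : H1 →ₗ[ℚ] PowerSeries ℝ := Finsupp.linearCombination ℚ (smzv b)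

/-- The `t`-adic topology on `ℝ⟦t⟧`. -/
@[reducible] def tAdicTopology : TopologicalSpace (PowerSeries ℝ) :=
  (Ideal.span {(X : PowerSeries ℝ)}).adicTopology

/-- `f = ∑_{i=0}^∞ u_i` in the `t`-adic topology. -/
def IsTAdicSum (u : ℕ → PowerSeries ℝ) (f : PowerSeries ℝ) : Prop :=
  Tendsto (fun N => ∑ i ∈ Finset.range N, u i) atTop (@nhds _ tAdicTopology f)

/-- The set of all `∑_i a_i ζ^•_Ŝ(k_i) t^{n_i}` with `a_i ∈ ℚ`, `k_i` indices, `n_i → ∞`. -/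
def smzvSpace (b : Bullet) : Set (PowerSeries ℝ) :=
  {f | ∃ (a : ℕ → ℚ) (k : ℕ → Index) (n : ℕ → ℕ), Tendsto n atTop atTop ∧
    IsTAdicSum (fun i => a i • (smzv b (k i) * (X : PowerSeries ℝ) ^ n i)) f}

/-- The set of all `∑_n Z^•_Ŝ(w_n) t^n` with `w_n ∈ 𝔥¹`. -/
def smzvSpace' (b : Bullet) : Set (PowerSeries ℝ) :=
  {f | ∃ w : ℕ → H1, IsTAdicSum (fun n => smzvMap b (w n) * (X : PowerSeries ℝ) ^ n) f}

/-- The `ℚ`-span of the `ζ^•_Ŝ(k) t^n`, `k` an index, `n ≥ 0`. -/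
def smzvSpan (b : Bullet) : Submodule ℚ (PowerSeries ℝ) :=
  Submodule.span ℚ {f | ∃ (k : Index) (n : ℕ), f = smzv b k * (X : PowerSeries ℝ) ^ n}

/-- `𝒵⟦t⟧` as a subset of `ℝ⟦t⟧`. -/
def mzvPowerSeries : Set (PowerSeries ℝ) := {f | ∀ n, PowerSeries.coeff n f ∈ mzvAlgebra}

end

end TAdicSMZV

/-!
The coefficients of `ζ^•_Ŝ(k)` are rational combinations of products of regularized values, and
these lie in `𝒵`; so `𝒵⟦t⟧` contains the three other sets. Conversely, a power series over `𝒵` can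
be expanded by splitting off one `Z^•_Ŝ(w_n) t^n` after the other (`subset_smzvSpace'`), as soon
as each element of `𝒵` is the constant term of some `Z^•_Ŝ(w)`. These constant terms are the
symmetric multiple zeta values
`ζ^•_S(k) = ∑ (-1)^{wt(k^{[i]})} ζ^•(k_{[i]}) ζ^•(reverse of k^{[i]})`. Hence everything rests on
the theorem of Yasuda that they span `𝒵` over `ℚ` (`exists_coeff_smzvMap_eq`).

*Relations.* Three facts on regularized values are needed. `ζ^*(·; T)` is multiplicative for the
harmonic product (`regMZV_harmonic_mul`), since its value at `T = 1 + ⋯ + 1/(N-1)` differs from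
the truncated sum by a sequence that is `o((log N)^{-J})` for all `J`, and no nonzero polynomial
in `T` is that small. `ζ^ш` is multiplicative for the shuffle product (`regWord_shuffle_mul`); for
admissible indices this is the product formula for multiple polylogarithms, proved for formal
power series with the operator `X d/dX`. Finally
`ζ^*(k, {1}^s) = ∑_{i+j=s} ζ^ш(k, {1}^i) ζ^*({1}^j)` if `k` is admissible (`regWord_harmonic_eq`).
For this, the generating series over `s` of the partial sums attached to `(k, {1}^s)` is divided
by `∏_{n<N} (1 + u/n)`; the quotient converges, and in the limit the shuffle product with `y`
becomes the differential equation that determines `∑_s ζ^ш(k, {1}^s) u^s`.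

*The harmonic case.* Let `P_n` be the span of the `ζ^*_S(k)` of weight `n`. As `ζ^*_S` is
multiplicative for the harmonic product, `P_i P_j ⊆ P_{i+j}`. Suppose that the regularized values
of weight less than `n` lie in the respective `P_m`. In weight `n` and modulo `P_n`, then, `ζ^*`
and `ζ^ш` vanish on products and agree except at `(1, …, 1)`, and
`ζ^*(k) + (-1)^n ζ^*(reverse of k) = 0`, which is what remains of `ζ^*_S(k)`. Such a function is
zero (`eq_zero_of_double_shuffle`): extended to all words in `x` and `y` and written in terms of
exponent sequences, `x^{a₀} y x^{a₁} y ⋯ y x^{a_r}`, it is invariant under rotation, by the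
antipode of the shuffle algebra, and annihilated by an infinitesimal translation, by the choice of
the extension: it maps all `x ш w` to `0`. The antipode of the harmonic algebra relates the values
in neighbouring depths, and the rotations in both depths then make it constant.

*The shuffle case.* By the comparison of the two regularizations, `ζ^*_S = ζ^ш_S` modulo
`ζ(2)`-multiples of regularized values (`symRev_sub_mem`). Products of `ζ(2)` with `ζ^ш_S(k)` are
again combinations of values of `ζ^ш_S` (`harmonicSum_singleton_symRev`), so induction on the
weight reduces the shuffle case to the harmonic one.

As in the definitions, indices and words are mostly given by reversed lists.
-/

namespace TAdicSMZV

open Filter PowerSeries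

noncomputable section

/-! ### Shuffles of words -/

section Shuffle

variable {M : Type*} [AddCommGroup M]

/-- The value at `u ш v` of the additive extension of `F`, a function on words. -/
def shuffleSum (F : List Letter → M) (u v : List Letter) : M := ((shuffleRev u v).map F).sum

@[simp] theorem shuffleSum_nil_left (F : List Letter → M) (v : List Letter) :
    shuffleSum F [] v = F v := by simp [shuffleSum, shuffleRev]

@[simp] theorem shuffleSum_nil_right (F : List Letter → M) (v : List Letter) :
    shuffleSum F v [] = F v := by cases v <;> simp [shuffleSum, shuffleRev]

theorem shuffleSum_cons_cons (F : List Letter → M) (a b : Letter) (u v : List Letter) :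
    shuffleSum F (a :: u) (b :: v) =
      shuffleSum (fun h => F (a :: h)) u (b :: v) +
        shuffleSum (fun h => F (b :: h)) (a :: u) v := by
  simp [shuffleSum, shuffleRev, Function.comp_def]

theorem shuffleSum_add (F G : List Letter → M) (u v : List Letter) :
    shuffleSum (fun h => F h + G h) u v = shuffleSum F u v + shuffleSum G u v := by
  simp [shuffleSum, List.sum_map_add]

theorem shuffleSum_zero (u v : List Letter) : shuffleSum (fun _ => (0 : M)) u v = 0 := by
  simp [shuffleSum]

theorem shuffleSum_comm (F : List Letter → M) (u v : List Letter) :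
    shuffleSum F u v = shuffleSum F v u := by
  induction u generalizing v F with
  | nil => simp
  | cons a u ihu =>
    induction v generalizing F with
    | nil => simp
    | cons b v ihv =>
      rw [shuffleSum_cons_cons, shuffleSum_cons_cons, ihu, ihv, add_comm]

theorem shuffleSum_assoc (F : List Letter → M) (u v t : List Letter) :
    shuffleSum (fun w => shuffleSum F w t) u v = shuffleSum (fun w => shuffleSum F u w) v t := by
  induction u generalizing v t F with
  | nil => simp
  | cons a u ihu =>
    induction v generalizing t F with
    | nil => simp
    | cons b v ihv =>
      induction t generalizing F with
      | nil => simp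
      | cons c t iht =>
        have h := iht (fun h => F (c :: h))
        rw [shuffleSum_cons_cons] at h
        rw [shuffleSum_cons_cons, shuffleSum_cons_cons]
        simp only [shuffleSum_cons_cons F, shuffleSum_add]
        rw [ihu, ihv, ← h, shuffleSum_cons_cons]
        abel

/-- The identity behind the antipode of the shuffle algebra:
`∑_{w = ab} (-1)^{|a|} (reverse of a) ш b = 0`. The partial sum displayed here is what remains
of the telescoping when a part `p` of the word has already been reversed. -/
theorem shuffleSum_antipode_aux (F : List Letter → M) (p l : List Letter) :
    ∑ i ∈ Finset.range (l.length + 1),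
        (-1 : ℤ) ^ i • shuffleSum F ((l.take i).reverse ++ p) (l.drop i) =
      match p with
      | [] => if l = [] then F [] else 0
      | a :: p => shuffleSum (fun h => F (a :: h)) p l := by
  induction l generalizing p with
  | nil => cases p <;> simp
  | cons b l ih =>
    rw [List.length_cons, Finset.sum_range_succ']
    have := ih (b :: p)
    simp only at this
    simp only [List.take_succ_cons, List.reverse_cons, List.append_assoc, List.singleton_append,
      List.drop_succ_cons, pow_succ, mul_neg, mul_one, neg_smul, Finset.sum_neg_distrib, this]
    cases p with
    | nil => simp
    | cons a p => simp [shuffleSum_cons_cons]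

/-- A function on words that vanishes on proper shuffle products is, up to sign, invariant under
reversal. -/
theorem reverse_of_shuffleSum_eq_zero (F : List Letter → M)
    (hF : ∀ u v, u ≠ [] → v ≠ [] → shuffleSum F u v = 0) (w : List Letter) (hw : w ≠ []) :
    F w + (-1 : ℤ) ^ w.length • F w.reverse = 0 := by
  have h := shuffleSum_antipode_aux F [] w
  simp only [hw, if_false, List.append_nil] at h
  obtain ⟨m, hm⟩ : ∃ m, w.length = m + 1 :=
    Nat.exists_eq_succ_of_ne_zero (by simpa using hw)
  rw [hm, Finset.sum_range_succ, Finset.sum_range_succ', Finset.sum_eq_zero] at h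
  · have e : List.take (m + 1) w = w := List.take_of_length_le hm.le
    have e' : List.drop (m + 1) w = [] := List.drop_of_length_le hm.le
    simpa [e, e', hm] using h
  · intro i hi
    have hi := Finset.mem_range.1 hi
    rw [hF, smul_zero]
    · intro h0
      have := congrArg List.length h0
      rw [List.length_reverse, List.length_take, List.length_nil] at this
      omega
    · intro h0
      have := congrArg List.length h0
      rw [List.length_drop, List.length_nil] at this
      omega

/-- The reversed words of elements of `𝔥¹`: they are empty or end in `y`. -/
def IsH1Word (w : List Letter) : Prop := ∀ a ∈ w.getLast?, a = Letter.y

theorem isH1Word_nil : IsH1Word [] := by simp [IsH1Word]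

theorem isH1Word_append (u : List Letter) {v : List Letter} (hv : IsH1Word v) (h : v ≠ []) :
    IsH1Word (u ++ v) := by
  intro a ha
  rw [List.getLast?_append_of_ne_nil _ h] at ha
  exact hv a ha

theorem isH1Word_cons {a : Letter} {v : List Letter} (hv : v ≠ []) :
    IsH1Word (a :: v) ↔ IsH1Word v := by
  rw [IsH1Word, IsH1Word, List.getLast?_cons_of_ne_nil hv]

theorem isH1Word_y_cons {v : List Letter} : IsH1Word (Letter.y :: v) ↔ IsH1Word v := by
  cases v with
  | nil => simp [IsH1Word]
  | cons b v => exact isH1Word_cons (by simp)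

theorem isH1Word_of_cons {a : Letter} {v : List Letter} (h : IsH1Word (a :: v)) : IsH1Word v := by
  cases v with
  | nil => exact isH1Word_nil
  | cons b v => exact (isH1Word_cons (by simp)).1 h

theorem isH1Word_wordRev (k : List ℕ+) : IsH1Word (wordRev k) := by
  induction k with
  | nil => exact isH1Word_nil
  | cons a k ih =>
    rw [wordRev]
    exact isH1Word_append _ (isH1Word_y_cons.2 ih) (by simp)

theorem wordRev_indexRev {w : List Letter} (hw : IsH1Word w) : wordRev (indexRev w) = w := by
  induction w with
  | nil => rfl
  | cons a w ih =>
    have ih := ih (isH1Word_of_cons hw)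
    cases a with
    | y => simp [indexRev, wordRev, ih]
    | x =>
      rw [indexRev]
      cases h : indexRev w with
      | nil =>
        rw [h, wordRev] at ih
        subst ih
        simp [IsH1Word] at hw
      | cons b k =>
        rw [h, wordRev] at ih
        simp only [wordRev]
        rw [← ih]
        have : ((b + 1 : ℕ+) : ℕ) - 1 = (b : ℕ) - 1 + 1 := by
          have := b.pos
          rw [PNat.add_coe, PNat.one_coe]; omega
        rw [this, List.replicate_succ]
        rfl

theorem mem_shuffleRev_ne_nil {u v h : List Letter} (hh : h ∈ shuffleRev u v)
    (huv : u ≠ [] ∨ v ≠ []) : h ≠ [] := by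
  rintro rfl
  cases u with
  | nil => simp [shuffleRev] at hh; simp [hh] at huv
  | cons a u => cases v <;> simp [shuffleRev] at hh

theorem isH1Word_of_mem_shuffleRev {u v h : List Letter} (hu : IsH1Word u) (hv : IsH1Word v)
    (hh : h ∈ shuffleRev u v) : IsH1Word h := by
  induction u generalizing v h with
  | nil => simp [shuffleRev] at hh; exact hh ▸ hv
  | cons a u ihu =>
    induction v generalizing h with
    | nil => simp [shuffleRev] at hh; exact hh ▸ hu
    | cons b v ihv =>
      simp only [shuffleRev, List.mem_append, List.mem_map] at hh
      rcases hh with ⟨t, ht, rfl⟩ | ⟨t, ht, rfl⟩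
      · exact (isH1Word_cons (mem_shuffleRev_ne_nil ht (by simp))).2
          (ihu (isH1Word_of_cons hu) hv ht)
      · exact (isH1Word_cons (mem_shuffleRev_ne_nil ht (by simp))).2
          (ihv (isH1Word_of_cons hv) ht)

theorem shuffleSum_congr {F G : List Letter → M} {u v : List Letter}
    (h : ∀ w ∈ shuffleRev u v, F w = G w) : shuffleSum F u v = shuffleSum G u v := by
  unfold shuffleSum
  rw [List.map_congr_left h]

theorem sum_map_eq_zero {α : Type*} {l : List α} {f : α → M} (h : ∀ a ∈ l, f a = 0) :
    (l.map f).sum = 0 := by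
  rw [List.map_congr_left h]; simp

end Shuffle

/-! ### Extension of functions from `𝔥¹` to all words -/

section Extension

variable {M : Type*} [AddCommGroup M] [Module ℚ M]

/-- The words arising from `v` by inserting `x` in front of one of its letters. -/
def insertX : List Letter → List (List Letter)
  | [] => []
  | c :: v => (Letter.x :: c :: v) :: (insertX v).map (c :: ·)

theorem isH1Word_of_mem_insertX {v h : List Letter} (hv : IsH1Word v) (hh : h ∈ insertX v) :
    IsH1Word h := by
  induction v generalizing h with
  | nil => simp [insertX] at hh
  | cons c v ih =>
    simp only [insertX, List.mem_cons, List.mem_map] at hh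
    rcases hh with rfl | ⟨t, ht, rfl⟩
    · exact (isH1Word_cons (by simp)).2 hv
    · refine (isH1Word_cons ?_).2 (ih (isH1Word_of_cons hv) ht)
      rintro rfl
      cases v <;> simp [insertX] at ht

theorem shuffleSum_x (F : List Letter → M) (v : List Letter) (a : ℕ) :
    shuffleSum F [Letter.x] (v ++ List.replicate a Letter.x) =
      (a + 1 : ℚ) • F (v ++ List.replicate (a + 1) Letter.x) +
        ((insertX v).map fun h => F (h ++ List.replicate a Letter.x)).sum := by
  induction v generalizing F with
  | nil =>
    simp only [List.nil_append, insertX, List.map_nil, List.sum_nil, add_zero]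
    induction a generalizing F with
    | zero => simp
    | succ a ih =>
      rw [List.replicate_succ, shuffleSum_cons_cons, ih]
      simp only [shuffleSum_nil_left, ← List.replicate_succ]
      push_cast
      module
  | cons c v ih =>
    rw [List.cons_append, shuffleSum_cons_cons, ih]
    simp [insertX, Function.comp_def]
    abel

/-- The value at `v x^a` (as a reversed word) of the extension of `f` that vanishes on all shuffle
products with `x`. -/
def extendAux (f : List Letter → M) : ℕ → List Letter → M
  | 0, v => f v
  | a + 1, v => -((a + 1 : ℚ)⁻¹ • ((insertX v).map (extendAux f a)).sum)

/-- The extension of a function on words of `𝔥¹` to all words that vanishes on all shuffle products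
with `x`. In terms of reversed words, `v x^a` is reduced to words with fewer `x` at the end. -/
def extendWord (f : List Letter → M) (w : List Letter) : M :=
  extendAux f (w.reverse.takeWhile fun a => a matches .x).length
    (w.reverse.dropWhile fun a => a matches .x).reverse

theorem extendWord_append (f : List Letter → M) {v : List Letter} (hv : IsH1Word v) (a : ℕ) :
    extendWord f (v ++ List.replicate a Letter.x) = extendAux f a v := by
  have h1 : ∀ l : List Letter, (∀ c ∈ l.head?, c = Letter.y) →
      ((List.replicate a Letter.x ++ l).takeWhile fun a => a matches .x).length = a ∧
      ((List.replicate a Letter.x ++ l).dropWhile fun a => a matches .x) = l := by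
    intro l hl
    induction a with
    | zero =>
      cases l with
      | nil => simp
      | cons c l => simp at hl; simp [hl]
    | succ a ih => simpa [List.replicate_succ] using ih
  obtain ⟨h2, h3⟩ := h1 v.reverse (by simpa [IsH1Word] using hv)
  rw [extendWord, List.reverse_append, List.reverse_replicate, h2, h3, List.reverse_reverse]

theorem exists_eq_append_replicate (w : List Letter) :
    ∃ (v : List Letter) (a : ℕ), IsH1Word v ∧ w = v ++ List.replicate a Letter.x := by
  induction w using List.reverseRecOn with
  | nil => exact ⟨[], 0, isH1Word_nil, rfl⟩
  | append_singleton w c ih =>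
    cases c with
    | y => exact ⟨w ++ [.y], 0, by simp [IsH1Word], by simp⟩
    | x =>
      obtain ⟨v, a, hv, rfl⟩ := ih
      exact ⟨v, a + 1, hv, by simp [List.replicate_succ']⟩

theorem extendWord_of_isH1Word (f : List Letter → M) {v : List Letter} (hv : IsH1Word v) :
    extendWord f v = f v := by
  simpa [extendAux] using extendWord_append f hv 0

theorem shuffleSum_x_extendWord (f : List Letter → M) (w : List Letter) :
    shuffleSum (extendWord f) [Letter.x] w = 0 := by
  obtain ⟨v, a, hv, rfl⟩ := exists_eq_append_replicate w
  rw [shuffleSum_x, extendWord_append _ hv, extendAux, smul_neg, smul_smul,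
    mul_inv_cancel₀ (by positivity), one_smul, neg_add_eq_zero]
  refine congrArg List.sum (List.map_congr_left fun h hh => ?_)
  rw [extendWord_append _ (isH1Word_of_mem_insertX hv hh)]

/-- If `f` vanishes on the shuffle products of nonempty words of `𝔥¹`, then its extension vanishes
on the shuffle products of arbitrary nonempty words. -/
theorem shuffleSum_extendWord (f : List Letter → M)
    (hf : ∀ u v, u ≠ [] → v ≠ [] → IsH1Word u → IsH1Word v → shuffleSum f u v = 0)
    (u v : List Letter) (hu : u ≠ []) (hv : v ≠ []) : shuffleSum (extendWord f) u v = 0 := by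
  -- trailing `x`s of the first factor can be removed, by associativity
  have key : ∀ v, v ≠ [] → (∀ u, u ≠ [] → IsH1Word u → shuffleSum (extendWord f) u v = 0) →
      ∀ a u, u ++ List.replicate a Letter.x ≠ [] → IsH1Word u →
        shuffleSum (extendWord f) (u ++ List.replicate a Letter.x) v = 0 := by
    intro v hv h a
    induction a with
    | zero => intro u hu hu'; simpa using h u (by simpa using hu) hu'
    | succ a ih =>
      intro u _ hu'
      have h1 := shuffleSum_assoc (extendWord f) [Letter.x] (u ++ List.replicate a Letter.x) v
      rw [shuffleSum_x] at h1
      simp only [shuffleSum_x_extendWord, shuffleSum_zero] at h1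
      rw [sum_map_eq_zero, add_zero] at h1
      · exact (smul_eq_zero.1 h1).resolve_left (by positivity)
      · intro h hh
        refine ih h ?_ (isH1Word_of_mem_insertX hu' hh)
        intro h0
        obtain ⟨rfl, _⟩ := List.append_eq_nil_iff.1 h0
        cases u <;> simp [insertX] at hh
  obtain ⟨u, a, hu', rfl⟩ := exists_eq_append_replicate u
  refine key v hv (fun u hu hu' => ?_) a u hu hu'
  obtain ⟨v, b, hv', rfl⟩ := exists_eq_append_replicate v
  rw [shuffleSum_comm]
  refine key u hu (fun v hv hv' => ?_) b v hv hv'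
  rw [shuffleSum_comm, ← hf u v hu hv hu' hv']
  exact shuffleSum_congr fun w hw =>
    extendWord_of_isH1Word f (isH1Word_of_mem_shuffleRev hu' hv' hw)

end Extension

/-! ### Functions of exponent sequences -/

section Exponents

variable {M : Type*} [AddCommGroup M]

/-- The word `x^{a₀} y x^{a₁} y ⋯ y x^{a_r}`. -/
def blockWord : List ℕ → List Letter
  | [] => []
  | [a] => List.replicate a Letter.x
  | a :: b :: l => List.replicate a Letter.x ++ Letter.y :: blockWord (b :: l)

/-- The sum of `f` over the sequences arising from `b` by replacing two neighbours `b_i, b_{i+1}`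
by `b_i + b_{i+1} + 1`. -/
def mergeSum (f : List ℕ → M) : List ℕ → M
  | [] => 0
  | [_] => 0
  | a :: b :: l => f ((a + b + 1) :: l) + mergeSum (fun l => f (a :: l)) (b :: l)

theorem mergeSum_congr {f g : List ℕ → M} {l : List ℕ}
    (h : ∀ l', l'.length + 1 = l.length → l'.sum = l.sum + 1 → f l' = g l') :
    mergeSum f l = mergeSum g l := by
  induction l generalizing f g with
  | nil => rfl
  | cons a l ih =>
    cases l with
    | nil => rfl
    | cons b l =>
      rw [mergeSum, mergeSum, h _ (by simp) (by simp; omega), ih]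
      intro l' h1 h2
      exact h _ (by simpa using h1) (by simp at h2 ⊢; omega)

theorem mergeSum_add (f g : List ℕ → M) (l : List ℕ) :
    mergeSum (fun l => f l + g l) l = mergeSum f l + mergeSum g l := by
  induction l generalizing f g with
  | nil => simp [mergeSum]
  | cons a l ih =>
    cases l with
    | nil => simp [mergeSum]
    | cons b l => rw [mergeSum, ih, mergeSum, mergeSum]; abel

theorem mergeSum_append_pair (f : List ℕ → M) (l : List ℕ) (a b : ℕ) :
    mergeSum f (l ++ [a, b]) =
      mergeSum (fun l => f (l ++ [b])) (l ++ [a]) + f (l ++ [a + b + 1]) := by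
  induction l generalizing f with
  | nil => simp [mergeSum]
  | cons c l ih =>
    cases l with
    | nil => simp [mergeSum]
    | cons d l =>
      simp only [List.cons_append, mergeSum] at ih ⊢
      rw [ih]
      simp [add_assoc]

variable [Module ℚ M]

/-- The operator dual to the shuffle product with `x`: `∑_i (a_i + 1) f(a + e_i)`. In terms of
generating functions it is the infinitesimal translation of all variables. -/
def insertSum (f : List ℕ → M) : List ℕ → M
  | [] => 0
  | a :: l => (a + 1 : ℚ) • f ((a + 1) :: l) + insertSum (fun l => f (a :: l)) l

theorem insertSum_congr {f g : List ℕ → M} {l : List ℕ}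
    (h : ∀ l', l'.length = l.length → l'.sum = l.sum + 1 → f l' = g l') :
    insertSum f l = insertSum g l := by
  induction l generalizing f g with
  | nil => rfl
  | cons a l ih =>
    rw [insertSum, insertSum, h ((a + 1) :: l) (by simp) (by simp; omega), ih]
    intro l' h1 h2
    exact h _ (by simp [h1]) (by simp [h2]; omega)

theorem insertSum_append_singleton (f : List ℕ → M) (l : List ℕ) (a : ℕ) :
    insertSum f (l ++ [a]) =
      insertSum (fun l => f (l ++ [a])) l + (a + 1 : ℚ) • f (l ++ [a + 1]) := by
  induction l generalizing f with
  | nil => simp [insertSum]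
  | cons b l ih =>
    rw [List.cons_append, insertSum, ih, insertSum]
    simp [add_assoc]

theorem insertSum_add (f g : List ℕ → M) (l : List ℕ) :
    insertSum (fun l => f l + g l) l = insertSum f l + insertSum g l := by
  induction l generalizing f g with
  | nil => simp [insertSum]
  | cons a l ih => rw [insertSum, ih, insertSum, insertSum, smul_add]; abel

theorem insertSum_neg (f : List ℕ → M) (l : List ℕ) :
    insertSum (fun l => -f l) l = -insertSum f l := by
  induction l generalizing f with
  | nil => simp [insertSum]
  | cons a l ih => rw [insertSum, ih, insertSum, smul_neg, neg_add]

theorem shuffleSum_x_replicate (F : List Letter → M) (a : ℕ) (t : List Letter) :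
    shuffleSum F [Letter.x] (List.replicate a Letter.x ++ Letter.y :: t) =
      (a + 1 : ℚ) • F (List.replicate (a + 1) Letter.x ++ Letter.y :: t) +
        shuffleSum (fun h => F (List.replicate a Letter.x ++ Letter.y :: h)) [Letter.x] t := by
  induction a generalizing F with
  | zero => simp [shuffleSum_cons_cons]
  | succ a ih =>
    rw [List.replicate_succ, List.cons_append, shuffleSum_cons_cons, ih]
    simp only [shuffleSum_nil_left, List.replicate_succ, List.cons_append]
    push_cast
    module

theorem shuffleSum_x_blockWord (F : List Letter → M) (l : List ℕ) (hl : l ≠ []) :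
    shuffleSum F [Letter.x] (blockWord l) = insertSum (fun l => F (blockWord l)) l := by
  induction l generalizing F with
  | nil => simp at hl
  | cons a l ih =>
    cases l with
    | nil =>
      have := shuffleSum_x F [] a
      simp only [List.nil_append, insertX, List.map_nil, List.sum_nil, add_zero] at this
      simp [blockWord, insertSum, this]
    | cons b l =>
      rw [blockWord, shuffleSum_x_replicate, ih _ (by simp), insertSum]
      rfl

/-- A function annihilated by `insertSum` is determined by its values at the sequences beginning
with `0`. -/
theorem eq_of_insertSum_eq_zero {f g : List ℕ → M} (hf : ∀ l, l ≠ [] → insertSum f l = 0)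
    (hg : ∀ l, l ≠ [] → insertSum g l = 0) (n t : ℕ)
    (h : ∀ l, l.length = n → l.sum = t → f (0 :: l) = g (0 :: l)) (a : ℕ) (l : List ℕ)
    (hl : l.length = n) (ht : a + l.sum = t) : f (a :: l) = g (a :: l) := by
  induction a generalizing l with
  | zero => exact h l hl (by omega)
  | succ a ih =>
    have h1 := hf (a :: l) (by simp)
    have h2 := hg (a :: l) (by simp)
    rw [insertSum] at h1 h2
    rw [insertSum_congr (g := fun l => g (a :: l)) fun l' hl' hs =>
      ih l' (hl'.trans hl) (by omega)] at h1
    have h3 := add_right_cancel (h1.trans h2.symm)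
    exact smul_right_injective M (r := (a + 1 : ℚ)) (by positivity) h3

/-- Cyclic invariance for sequences beginning with `0` implies full cyclic invariance. -/
theorem rotate_of_insertSum_eq_zero {f : List ℕ → M} (hf : ∀ l, l ≠ [] → insertSum f l = 0)
    (h0 : ∀ l, f (0 :: l) = f (l ++ [0])) (a : ℕ) (l : List ℕ) : f (a :: l) = f (l ++ [a]) := by
  induction a generalizing l with
  | zero => exact h0 l
  | succ a ih =>
    have h1 := hf (a :: l) (by simp)
    have h2 := hf (l ++ [a]) (by simp)
    rw [insertSum] at h1
    rw [insertSum_append_singleton, add_comm] at h2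
    rw [insertSum_congr (g := fun l => f (l ++ [a])) fun l' _ _ => ih l'] at h1
    have h3 := add_right_cancel (h1.trans h2.symm)
    exact smul_right_injective M (r := (a + 1 : ℚ)) (by positivity) h3

theorem mergeSum_smul (c : ℚ) (f : List ℕ → M) (l : List ℕ) :
    mergeSum (fun l => c • f l) l = c • mergeSum f l := by
  induction l generalizing f with
  | nil => simp [mergeSum]
  | cons a l ih =>
    cases l with
    | nil => simp [mergeSum]
    | cons b l => rw [mergeSum, ih, mergeSum, smul_add]

theorem insertSum_mergeSum (f : List ℕ → M) (l : List ℕ) :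
    insertSum (mergeSum f) l = mergeSum (insertSum f) l := by
  induction l generalizing f with
  | nil => simp [insertSum, mergeSum]
  | cons a l ih =>
    cases l with
    | nil => simp [insertSum, mergeSum]
    | cons b l =>
      have h := ih (fun l => f (a :: l))
      rw [insertSum] at h
      simp only [insertSum, mergeSum, insertSum_add, mergeSum_add, mergeSum_smul, ← h]
      push_cast
      have e1 : a + 1 + b + 1 = a + b + 1 + 1 := by ring
      have e2 : a + (b + 1) + 1 = a + b + 1 + 1 := by ring
      rw [e1, e2]
      module

/-- If a function on sequences is invariant under rotation, annihilated by `insertSum` and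
invariant under the moves `(α, β, p + q + 1) ↔ (α + β + 1, p, q)`, then it vanishes at sequences
which are neither too short nor zero: it has the same value at all sequences of the same length
and sum, and this value is annihilated by a nonzero integer. -/
theorem eq_zero_of_move {G : List ℕ → M} (r m : ℕ) (hm : m ≠ 0)
    (hrot : ∀ a l, G (a :: l) = G (l ++ [a])) (hins : ∀ l, l ≠ [] → insertSum G l = 0)
    (hmove : ∀ α β p q l, l.length = r → α + β + p + q + 1 + l.sum = m →
      G (α :: β :: (p + q + 1) :: l) = G ((α + β + 1) :: p :: q :: l))
    (l : List ℕ) (hl : l.length = r + 3) (hs : l.sum = m) : G l = 0 := by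
  -- the second and third entry can be moved to the first
  have step1 : ∀ d X p q l, p + q = d → 1 ≤ X → l.length = r → X + p + q + l.sum = m →
      G (X :: p :: q :: l) = G ((X + p + q) :: 0 :: 0 :: l) := by
    intro d
    induction d with
    | zero =>
      intro X p q l hd _ _ _
      obtain ⟨rfl, rfl⟩ : p = 0 ∧ q = 0 := by omega
      rfl
    | succ d ih =>
      intro X p q l hd hX hl hs
      obtain ⟨X, rfl⟩ := Nat.exists_eq_add_of_le' hX
      have h1 := hmove X 0 p q l hl (by omega)
      have h2 := hmove X 0 0 (p + q) l hl (by omega)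
      have h3 := hmove (X + 1) 0 0 d l hl (by omega)
      have h4 := ih (X + 1 + 1) 0 d l (by omega) (by omega) hl (by omega)
      simp only [add_zero, zero_add] at h1 h2 h3 h4
      rw [← h1, h2, hd, h3, h4]
      congr 2
      omega
  -- leading zeros can be moved to the end
  have step2 : ∀ s l, 1 ≤ s → l.length = r → s + l.sum = m →
      G (s :: 0 :: 0 :: l) = G (s :: (l ++ [0, 0])) := by
    intro s l hs hl hsum
    obtain ⟨s, rfl⟩ := Nat.exists_eq_add_of_le' hs
    have h1 := hmove 0 0 0 s l hl (by omega)
    have h2 := step1 s 1 0 s l (by omega) le_rfl hl (by omega)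
    simp only [add_zero, zero_add] at h1 h2
    rw [add_comm 1 s] at h2
    rw [← h2, ← h1, hrot, List.cons_append, hrot]
    simp
  -- hence all entries can be collected in the first one, if this is nonzero
  have step3 : ∀ n l X j, l.length = n → 1 ≤ X → n + j = r + 2 → X + l.sum = m →
      G (X :: (l ++ List.replicate j 0)) = G (m :: List.replicate (r + 2) 0) := by
    intro n
    induction n using Nat.strong_induction_on with
    | _ n ih =>
      intro l X j hn hX hj hs
      match l with
      | [] =>
        obtain rfl : j = r + 2 := by simp at hn; omega
        obtain rfl : X = m := by simpa using hs
        rfl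
      | [p] =>
        obtain rfl : j = r + 1 := by simp at hn; omega
        simp only [List.cons_append, List.nil_append, List.replicate_succ, List.sum_cons,
          List.sum_nil, add_zero] at hs ⊢
        rw [step1 p X p 0 _ (by simp) hX (by simp) (by simpa using hs)]
        simp [hs]
      | p :: q :: l =>
        simp only [List.length_cons, List.sum_cons] at hn hs
        rw [List.cons_append, List.cons_append, step1 _ X p q _ rfl hX (by simp; omega)
          (by simp; omega), step2 _ _ (by omega) (by simp; omega) (by simp; omega),
          List.append_assoc, show [0, 0] = List.replicate 2 0 from rfl, ← List.replicate_add]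
        exact ih l.length (by omega) l _ _ rfl (by omega) (by omega) (by omega)
  have hrot' : ∀ u v, G (u ++ v) = G (v ++ u) := by
    intro u
    induction u with
    | nil => simp
    | cons a u ih => intro v; rw [List.cons_append, hrot, List.append_assoc, ih]; simp
  have step4 : ∀ l, l.length = r + 3 → l.sum = m → G l = G (m :: List.replicate (r + 2) 0) := by
    intro l hl hs
    obtain ⟨X, hX, hX0⟩ : ∃ X ∈ l, X ≠ 0 := by
      by_contra! h
      exact hm (hs ▸ List.sum_eq_zero h)
    obtain ⟨u, v, rfl⟩ := List.append_of_mem hX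
    rw [hrot']
    simp only [List.length_append, List.length_cons, List.sum_append, List.sum_cons] at hl hs
    have := step3 _ (v ++ u) X 0 rfl (Nat.one_le_iff_ne_zero.2 hX0) (by simp; omega)
      (by simp; omega)
    simpa using this
  have hconst : ∀ (c : M) k, insertSum (fun _ => c) (List.replicate k 0) = (k : ℚ) • c := by
    intro c k
    induction k with
    | zero => simp [insertSum]
    | succ k ih =>
      rw [List.replicate_succ, insertSum, ih]
      push_cast
      module
  obtain ⟨m, rfl⟩ := Nat.exists_eq_succ_of_ne_zero hm
  have h := hins (m :: List.replicate (r + 2) 0) (by simp)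
  rw [insertSum, insertSum_congr (g := fun _ => G ((m + 1) :: List.replicate (r + 2) 0)), hconst,
    ← add_smul] at h
  · rw [step4 l hl hs]
    exact (smul_eq_zero.1 h).resolve_left (by positivity)
  · intro l' h1 h2
    exact step4 _ (by simpa using h1) (by simp at h2 ⊢; omega)

end Exponents

/-! ### Harmonic products of indices -/

section Harmonic

variable {M : Type*} [AddCommGroup M]

/-- The value at `u * v` (harmonic product) of the additive extension of `F`. -/
def harmonicSum (F : List ℕ+ → M) (u v : List ℕ+) : M := ((harmonicRev u v).map F).sum

@[simp] theorem harmonicSum_nil_left (F : List ℕ+ → M) (v : List ℕ+) :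
    harmonicSum F [] v = F v := by simp [harmonicSum, harmonicRev]

@[simp] theorem harmonicSum_nil_right (F : List ℕ+ → M) (v : List ℕ+) :
    harmonicSum F v [] = F v := by cases v <;> simp [harmonicSum, harmonicRev]

theorem harmonicSum_cons_cons (F : List ℕ+ → M) (a b : ℕ+) (u v : List ℕ+) :
    harmonicSum F (a :: u) (b :: v) =
      harmonicSum (fun h => F (a :: h)) u (b :: v) + harmonicSum (fun h => F (b :: h)) (a :: u) v +
        harmonicSum (fun h => F ((a + b) :: h)) u v := by
  simp [harmonicSum, harmonicRev, Function.comp_def, add_assoc]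

theorem harmonicSum_add (F G : List ℕ+ → M) (u v : List ℕ+) :
    harmonicSum (fun h => F h + G h) u v = harmonicSum F u v + harmonicSum G u v := by
  simp [harmonicSum, List.sum_map_add]

theorem harmonicSum_mul_left {A : Type*} [CommRing A] (c : A) (F : List ℕ+ → A) (u v : List ℕ+) :
    harmonicSum (fun h => c * F h) u v = c * harmonicSum F u v := by
  simp [harmonicSum, List.sum_map_mul_left]

/-- The sum of `f` over the coarsenings of `a :: l`, the indices arising from it by replacing
consecutive entries by their sum. -/
def coarseSum (f : List ℕ+ → M) : ℕ+ → List ℕ+ → M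
  | a, [] => f [a]
  | a, b :: l => coarseSum (fun h => f (a :: h)) b l + coarseSum f (a + b) l

theorem coarseSum_congr {f g : List ℕ+ → M} (a : ℕ+) (l : List ℕ+)
    (h : ∀ c c', f (c :: c') = g (c :: c')) : coarseSum f a l = coarseSum g a l := by
  induction l generalizing f g a with
  | nil => exact h _ _
  | cons b l ih =>
    rw [coarseSum, coarseSum, ih (a + b) h,
      ih (g := fun h => g (a :: h)) b fun c c' => h a (c :: c')]

theorem coarseSum_add (f g : List ℕ+ → M) (a : ℕ+) (l : List ℕ+) :
    coarseSum (fun h => f h + g h) a l = coarseSum f a l + coarseSum g a l := by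
  induction l generalizing f g a with
  | nil => rfl
  | cons b l ih => rw [coarseSum, coarseSum, coarseSum, ih, ih]; abel

theorem coarseSum_add_head (f : List ℕ+ → M) (d a : ℕ+) (l : List ℕ+) :
    coarseSum f (a + d) l =
      coarseSum (fun h => match h with | [] => 0 | c :: h => f ((c + d) :: h)) a l := by
  induction l generalizing f a with
  | nil => rfl
  | cons b l ih =>
    rw [coarseSum, coarseSum, ← ih, add_right_comm]

theorem coarseSum_eq_zero {f : List ℕ+ → M} (a : ℕ+) (l : List ℕ+)
    (h : ∀ c, c.length ≤ l.length + 1 → f c = 0) : coarseSum f a l = 0 := by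
  induction l generalizing f a with
  | nil => exact h _ (by simp)
  | cons b l ih =>
    rw [coarseSum, ih, ih, add_zero]
    · intro c hc; exact h c (by simp; omega)
    · intro c hc; exact h _ (by simpa using hc)

theorem coarseSum_eq_of_length_lt {f : List ℕ+ → M} (a : ℕ+) (l : List ℕ+)
    (h : ∀ c, c.length ≤ l.length → f c = 0) : coarseSum f a l = f (a :: l) := by
  induction l generalizing f a with
  | nil => rfl
  | cons b l ih =>
    rw [coarseSum, ih, coarseSum_eq_zero, add_zero]
    · intro c hc; exact h c (by simpa using hc)
    · intro c hc; exact h _ (by simpa using hc)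

/-- The sum of `f` over the indices arising from a given one by adding two neighbours. -/
def adjacentSum (f : List ℕ+ → M) : List ℕ+ → M
  | [] => 0
  | [_] => 0
  | a :: b :: l => f ((a + b) :: l) + adjacentSum (fun l => f (a :: l)) (b :: l)

theorem coarseSum_eq_of_length_lt' {f : List ℕ+ → M} (a : ℕ+) (l : List ℕ+)
    (h : ∀ c, c.length < l.length → f c = 0) :
    coarseSum f a l = f (a :: l) + adjacentSum f (a :: l) := by
  induction l generalizing f a with
  | nil => simp [coarseSum, adjacentSum]
  | cons b l ih =>
    rw [coarseSum, ih, coarseSum_eq_of_length_lt, adjacentSum]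
    · abel
    · intro c hc; exact h c (by simp; omega)
    · intro c hc; exact h _ (by simpa using hc)

theorem adjacentSum_map_succPNat (f : List ℕ+ → M) (l : List ℕ) :
    adjacentSum f (l.map Nat.succPNat) = mergeSum (fun l => f (l.map Nat.succPNat)) l := by
  have e : ∀ a b : ℕ, Nat.succPNat a + Nat.succPNat b = Nat.succPNat (a + b + 1) := by
    intro a b
    apply PNat.eq
    simp [Nat.succPNat_coe]
    omega
  induction l generalizing f with
  | nil => rfl
  | cons a l ih =>
    cases l with
    | nil => rfl
    | cons b l =>
      have := ih (fun l => f (Nat.succPNat a :: l))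
      simp only [List.map_cons] at this
      simp only [List.map_cons, adjacentSum, mergeSum, this, e]

/-- The identity behind the antipode of the harmonic algebra, in which reversed prefixes are
replaced by the sum of their coarsenings; compare `shuffleSum_antipode_aux`. -/
theorem harmonicSum_antipode_aux (F : List ℕ+ → M) (p l : List ℕ+) :
    ∑ i ∈ Finset.range (l.length + 1), (-1 : ℤ) ^ i •
        (match (l.take i).reverse ++ p with
          | [] => F (l.drop i)
          | a :: q => coarseSum (fun c => harmonicSum F c (l.drop i)) a q) =
      match p with
      | [] => if l = [] then F [] else 0
      | a :: p => coarseSum (fun c => match c with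
          | [] => 0
          | c :: c' => harmonicSum (fun h => F (c :: h)) c' l) a p := by
  induction l generalizing p with
  | nil =>
    cases p with
    | nil => simp
    | cons a p =>
      simp
      exact coarseSum_congr _ _ fun c c' => by simp
  | cons b l ih =>
    rw [List.length_cons, Finset.sum_range_succ']
    have := ih (b :: p)
    simp only at this
    simp only [List.take_succ_cons, List.reverse_cons, List.append_assoc, List.singleton_append,
      List.drop_succ_cons, pow_succ, mul_neg, mul_one, neg_smul, Finset.sum_neg_distrib, this]
    cases p with
    | nil => simp [coarseSum]
    | cons a p =>
      simp only [List.take_zero, List.reverse_nil, List.nil_append, List.drop_zero, pow_zero,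
        one_smul]
      rw [coarseSum, add_comm b a, coarseSum_add_head, ← coarseSum_add, neg_add_eq_sub,
        sub_eq_iff_eq_add, ← coarseSum_add]
      refine coarseSum_congr _ _ fun c c' => ?_
      simp only [harmonicSum_cons_cons F]
      abel

/-- On functions vanishing on proper products, the antipode of the harmonic algebra is the
multiplication by `-1`. -/
theorem coarseSum_reverse_of_harmonicSum_eq_zero (F : List ℕ+ → M)
    (hF : ∀ u v, u ≠ [] → v ≠ [] → harmonicSum F u v = 0) (a : ℕ+) (l : List ℕ+) :
    F (a :: l).reverse + (-1 : ℤ) ^ (l.length + 1) • coarseSum F a l = 0 := by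
  have h := harmonicSum_antipode_aux F [] (a :: l).reverse
  simp only [List.reverse_eq_nil_iff, reduceCtorEq, if_false, List.append_nil,
    List.length_reverse, List.length_cons] at h
  rw [Finset.sum_range_succ, Finset.sum_range_succ', Finset.sum_eq_zero] at h
  · have e : List.take (l.length + 1) (a :: l).reverse = (a :: l).reverse :=
      List.take_of_length_le (by simp)
    have e' : List.drop (l.length + 1) (a :: l).reverse = [] := List.drop_of_length_le (by simp)
    rw [e, e'] at h
    simpa using h
  · intro i hi
    have hi := Finset.mem_range.1 hi
    have h1 : ((a :: l).reverse.take (i + 1)).reverse ≠ [] := by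
      intro h0
      have := congrArg List.length h0
      rw [List.length_reverse, List.length_take, List.length_reverse, List.length_cons,
        List.length_nil] at this
      omega
    have h2 : (a :: l).reverse.drop (i + 1) ≠ [] := by
      intro h0
      have := congrArg List.length h0
      rw [List.length_drop, List.length_reverse, List.length_cons, List.length_nil] at this
      omega
    obtain ⟨b, q, hq⟩ := List.exists_cons_of_ne_nil h1
    rw [hq]
    simp only
    rw [coarseSum_congr (g := fun _ => 0) _ _ fun c c' => hF (c :: c') _ (by simp) h2]
    have : ∀ b q, coarseSum (fun _ => (0 : M)) b q = 0 := fun b q =>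
      coarseSum_eq_zero b q fun _ _ => rfl
    rw [this, smul_zero]

theorem harmonicSum_one_replicate {f : List ℕ+ → M} (j : ℕ)
    (h : ∀ c, c.length ≤ j → f c = 0) :
    harmonicSum f [1] (List.replicate j 1) = (j + 1) • f (List.replicate (j + 1) 1) := by
  induction j generalizing f with
  | zero => simp
  | succ j ih =>
    rw [List.replicate_succ, harmonicSum_cons_cons, ih fun c hc => h _ (by simpa using hc)]
    simp only [harmonicSum_nil_left, ← List.replicate_succ]
    rw [h ((1 + 1) :: List.replicate j 1) (by simp), add_zero, add_comm]
    simp only [add_smul, one_smul]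

end Harmonic

/-! ### Words and indices -/

theorem wt_cons (a : ℕ+) (k : List ℕ+) : wt (a :: k) = a + wt k := by simp [wt]

theorem wt_append (k l : List ℕ+) : wt (k ++ l) = wt k + wt l := by simp [wt]

theorem wt_reverse (k : List ℕ+) : wt k.reverse = wt k := by
  induction k with
  | nil => rfl
  | cons a k ih => rw [List.reverse_cons, wt_append, ih, wt_cons, wt_cons, add_comm]; rfl

theorem wordRev_append (k l : List ℕ+) : wordRev (k ++ l) = wordRev k ++ wordRev l := by
  induction k with
  | nil => rfl
  | cons a k ih => simp [wordRev, ih]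

theorem y_cons_wordRev_reverse (k : List ℕ+) :
    Letter.y :: wordRev k.reverse = (wordRev k).reverse ++ [Letter.y] := by
  induction k with
  | nil => rfl
  | cons a k ih =>
    rw [List.reverse_cons, wordRev_append, ← List.cons_append, ih]
    simp [wordRev]

theorem length_wordRev (k : List ℕ+) : (wordRev k).length = wt k := by
  induction k with
  | nil => rfl
  | cons a k ih =>
    have := a.pos
    rw [wordRev, wt_cons, List.length_append, List.length_replicate, List.length_cons, ih]
    omega

theorem exists_ne_one_of_x_mem {k : List ℕ+} (h : Letter.x ∈ wordRev k) : ∃ a ∈ k, a ≠ 1 := by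
  induction k with
  | nil => simp [wordRev] at h
  | cons a k ih =>
    by_cases ha : a = 1
    · subst ha
      simp [wordRev] at h
      simpa using ih h
    · exact ⟨a, by simp, ha⟩

theorem blockWord_zero_cons {l : List ℕ} (hl : l ≠ []) :
    blockWord (0 :: l) = Letter.y :: blockWord l := by
  cases l with
  | nil => simp at hl
  | cons b l => simp [blockWord]

theorem blockWord_append_zero {l : List ℕ} (hl : l ≠ []) :
    blockWord (l ++ [0]) = blockWord l ++ [Letter.y] := by
  induction l with
  | nil => simp at hl
  | cons a l ih =>
    cases l with
    | nil => simp [blockWord]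
    | cons b l =>
      have := ih (by simp)
      simp only [List.cons_append] at this
      simp [blockWord, this]

theorem wordRev_map_succPNat (l : List ℕ) :
    wordRev (l.map Nat.succPNat) = blockWord (l ++ [0]) := by
  induction l with
  | nil => simp [blockWord, wordRev]
  | cons a l ih =>
    rw [List.map_cons, wordRev, ih]
    cases l <;> simp [blockWord]

theorem wt_map_succPNat (l : List ℕ) : wt (l.map Nat.succPNat) = l.sum + l.length := by
  induction l with
  | nil => rfl
  | cons a l ih => rw [List.map_cons, wt_cons, ih]; simp; omega

theorem map_succPNat_natPred (k : List ℕ+) : (k.map PNat.natPred).map Nat.succPNat = k := by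
  simp [Function.comp_def]

theorem exists_ne_one_of_sum_ne_zero {l : List ℕ} (h : l.sum ≠ 0) :
    ∃ a ∈ l.map Nat.succPNat, a ≠ 1 := by
  by_contra! h'
  refine h (List.sum_eq_zero fun a ha => ?_)
  have := congrArg PNat.val (h' _ (List.mem_map_of_mem ha))
  simpa using this

/-! ### Functions satisfying the double shuffle relations modulo products -/

section Core

variable {M : Type*} [AddCommGroup M] [Module ℚ M]

theorem eq_zero_of_add_self {a : M} (h : a + a = 0) : a = 0 := by
  have : (2 : ℚ) • a = 0 := by rw [two_smul, h]
  exact (smul_eq_zero.1 this).resolve_left (by norm_num)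

/-- For a function `ψ` on indices vanishing on proper shuffle products, its extension to all words
is invariant under moving a `y` from the beginning of a word to its end, provided that `ψ` is, up to
sign, invariant under reversal of the index. -/
theorem extendWord_rotate {ψ : List ℕ+ → M}
    (hS : ∀ k, (∃ a ∈ k, a ≠ 1) → ψ k + (-1 : ℤ) ^ wt k • ψ k.reverse = 0)
    (hSh : ∀ u v, u ≠ [] → v ≠ [] → IsH1Word u → IsH1Word v →
      shuffleSum (fun w => ψ (indexRev w)) u v = 0) (t : List Letter) :
    extendWord (fun w => ψ (indexRev w)) (Letter.y :: t) =
      extendWord (fun w => ψ (indexRev w)) (t ++ [Letter.y]) := by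
  by_cases hx : Letter.x ∈ t
  · have h1 : IsH1Word (t ++ [Letter.y]) := by simp [IsH1Word]
    have h2 := wordRev_indexRev h1
    set k := indexRev (t ++ [Letter.y]) with hk
    have h3 := y_cons_wordRev_reverse k
    rw [h2, List.reverse_append, List.reverse_singleton, List.singleton_append, List.cons_append,
      List.cons.injEq] at h3
    have h4 := reverse_of_shuffleSum_eq_zero _ (shuffleSum_extendWord _ hSh) (Letter.y :: t)
      (by simp)
    have h5 := hS k (exists_ne_one_of_x_mem (by rw [h2]; simp [hx]))
    rw [List.reverse_cons, ← h3.2, extendWord_of_isH1Word _ (isH1Word_wordRev _),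
      indexRev_wordRev] at h4
    rw [extendWord_of_isH1Word _ h1, ← hk]
    have h6 : (Letter.y :: t).length = wt k := by
      rw [← length_wordRev, h2]; simp
    rw [h6] at h4
    exact add_right_cancel (h4.trans h5.symm)
  · have : t = List.replicate t.length Letter.y := by
      refine List.eq_replicate_iff.2 ⟨rfl, fun b hb => ?_⟩
      cases b with
      | y => rfl
      | x => exact absurd hb hx
    rw [this, ← List.replicate_succ, ← List.replicate_succ']

/-- A function on indices is zero if it vanishes on proper harmonic products, if it agrees, except
at `(1, …, 1)`, with a function vanishing on proper shuffle products, and if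
`φ(k) + (-1)^{wt(k)} φ(reverse of k) = 0`.

The proof is by induction on the length `r`. In weights of the parity of `r + 1`, the harmonic
antipode contradicts the symmetry. In weights of the parity of `r`, it expresses `φ` in
length `r + 1` by its values in length `r`. By `extendWord_rotate`, the functions on exponent
sequences given by `φ` are invariant under rotation in both lengths, and comparing the two
invariances gives the moves of `eq_zero_of_move`. -/
theorem eq_zero_of_double_shuffle {φ ψ : List ℕ+ → M} (h_one : φ [1] = 0)
    (hH : ∀ u v, u ≠ [] → v ≠ [] → harmonicSum φ u v = 0)
    (hS : ∀ k, φ k + (-1 : ℤ) ^ wt k • φ k.reverse = 0)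
    (hSh : ∀ u v, u ≠ [] → v ≠ [] → IsH1Word u → IsH1Word v →
      shuffleSum (fun w => ψ (indexRev w)) u v = 0)
    (hψ : ∀ k, (∃ a ∈ k, a ≠ 1) → ψ k = φ k) (k : List ℕ+) : φ k = 0 := by
  set F := extendWord fun w => ψ (indexRev w) with hFdef
  set G : List ℕ → M := fun l => F (blockWord l) with hGdef
  have hrotF : ∀ t, F (Letter.y :: t) = F (t ++ [Letter.y]) :=
    extendWord_rotate
      (fun k hk => by rw [hψ k hk, hψ k.reverse (by simpa using hk)]; exact hS k) hSh
  have hins : ∀ l, l ≠ [] → insertSum G l = 0 := fun l hl => by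
    rw [hGdef, ← shuffleSum_x_blockWord F l hl]
    exact shuffleSum_x_extendWord _ _
  have hrot : ∀ a l, G (a :: l) = G (l ++ [a]) := rotate_of_insertSum_eq_zero hins fun l => by
    rcases eq_or_ne l [] with rfl | hl
    · rfl
    · simp only [hGdef]
      rw [blockWord_zero_cons hl, blockWord_append_zero hl, hrotF]
  have hG : ∀ l : List ℕ, l.sum ≠ 0 → G (0 :: l) = φ (l.map Nat.succPNat) := fun l hl => by
    rw [hrot]
    simp only [hGdef]
    rw [← wordRev_map_succPNat, hFdef, extendWord_of_isH1Word _ (isH1Word_wordRev _),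
      indexRev_wordRev]
    exact hψ _ (exists_ne_one_of_sum_ne_zero hl)
  suffices H : ∀ r k, k.length = r → φ k = 0 from H _ k rfl
  clear k
  intro r
  induction r using Nat.strong_induction_on with
  | _ r ih =>
    intro k hk
    rcases r with _ | r
    · obtain rfl := List.length_eq_zero_iff.1 hk
      exact eq_zero_of_add_self (by simpa [wt] using hS [])
    by_cases hpar : Even (wt k + (r + 1))
    swap
    · -- the harmonic antipode and the symmetry give opposite signs
      obtain ⟨a, l, hl⟩ := List.exists_cons_of_ne_nil (l := k.reverse) (by
        intro h; rw [List.reverse_eq_nil_iff.1 h] at hk; simp at hk)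
      have hlen : l.length = r := by
        have := congrArg List.length hl
        simp at this; omega
      have h1 := coarseSum_reverse_of_harmonicSum_eq_zero φ hH a l
      rw [coarseSum_eq_of_length_lt a l fun c hc => ih c.length (by omega) c rfl, ← hl,
        List.reverse_reverse, hlen] at h1
      have h2 := hS k
      have e : (-1 : ℤ) ^ wt k = -(-1) ^ (r + 1) := by
        rw [Nat.not_even_iff_odd] at hpar
        rcases Nat.even_or_odd (r + 1) with h | h
        · rw [h.neg_one_pow, Odd.neg_one_pow ((Nat.odd_add.1 hpar).2 h)]
        · rw [h.neg_one_pow, Even.neg_one_pow (by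
            by_contra h'
            exact (Nat.not_even_iff_odd.2 h) ((Nat.odd_add.1 hpar).1 (Nat.not_even_iff_odd.1 h')))]
          simp
      rw [e, neg_smul] at h2
      refine eq_zero_of_add_self ?_
      calc φ k + φ k = (φ k + (-1 : ℤ) ^ (r + 1) • φ k.reverse) +
            (φ k + -((-1 : ℤ) ^ (r + 1) • φ k.reverse)) := by abel
        _ = 0 := by rw [h1, h2, add_zero]
    by_cases hone : ∃ a ∈ k, a ≠ 1
    swap
    · push Not at hone
      obtain rfl : k = List.replicate (r + 1) 1 := List.eq_replicate_iff.2 ⟨hk, hone⟩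
      rcases r with _ | r
      · exact h_one
      · have := hH [1] (List.replicate (r + 1) 1) (by simp) (by simp)
        rw [harmonicSum_one_replicate _ fun c hc => ih c.length (by omega) c rfl,
          ← Nat.cast_smul_eq_nsmul ℚ] at this
        exact (smul_eq_zero.1 this).resolve_left (by positivity)
    -- the interesting case: `m` is the sum of the exponents
    set bs := k.map PNat.natPred with hbs
    have hkbs : bs.map Nat.succPNat = k := map_succPNat_natPred k
    have hbl : bs.length = r + 1 := by simp [hbs, hk]
    set m := bs.sum with hm
    have hwt : wt k = m + (r + 1) := by rw [← hkbs, wt_map_succPNat, hbl]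
    have hm0 : m ≠ 0 := by
      intro h0
      obtain ⟨a, ha, ha1⟩ := hone
      refine ha1 (PNat.natPred_injective ?_)
      have := List.sum_eq_zero_iff.1 h0 (PNat.natPred a) (List.mem_map_of_mem ha)
      rw [this]; rfl
    have hmeven : Even m := by
      rw [hwt] at hpar
      have : m + (r + 1) + (r + 1) = m + 2 * (r + 1) := by ring
      rw [this, Nat.even_add] at hpar
      exact hpar.2 (even_two_mul _)
    -- `φ` in length `r + 2`
    have hnext : ∀ l : List ℕ, l.length = r + 2 → l.sum = m - 1 →
        G (0 :: l) + G (0 :: l) = -mergeSum (fun l => G (0 :: l)) l := by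
      intro l hl hs
      have hs0 : l.sum ≠ 0 := by
        intro h0
        obtain ⟨c, hc⟩ := hmeven
        omega
      obtain ⟨a, l', hal⟩ := List.exists_cons_of_ne_nil (l := l.map Nat.succPNat) (by
        intro h; rw [List.map_eq_nil_iff.1 h] at hl; simp at hl)
      have hlen : l'.length = r + 1 := by
        have := congrArg List.length hal
        simp at this; omega
      have h1 := coarseSum_reverse_of_harmonicSum_eq_zero φ hH a l'
      rw [coarseSum_eq_of_length_lt' a l' fun c hc => ih c.length (by omega) c rfl, ← hal,
        adjacentSum_map_succPNat, hlen] at h1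
      have h2 := hS (l.map Nat.succPNat)
      rw [hG l hs0, mergeSum_congr (g := fun l => φ (l.map Nat.succPNat)) fun l' _ h =>
        hG l' (by omega)]
      have e : (-1 : ℤ) ^ wt (l.map Nat.succPNat) = (-1) ^ (r + 1) := by
        rw [wt_map_succPNat, hl, hs]
        obtain ⟨c, hc⟩ := hmeven
        have : m - 1 + (r + 2) = 2 * c + (r + 1) := by omega
        rw [this, pow_add, pow_mul]; simp
      rw [e] at h2
      have hsq : ∀ b : M, (-1 : ℤ) ^ (r + 1) • ((-1 : ℤ) ^ (r + 1) • b) = b := by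
        intro b
        rw [smul_smul, ← mul_pow]; simp
      have h3 := congrArg (fun b => (-1 : ℤ) ^ (r + 1) • b) h1
      simp only [smul_add, smul_zero, pow_succ _ (r + 1), mul_neg, mul_one, neg_smul, smul_neg,
        hsq] at h3
      have h4 : (-1 : ℤ) ^ (r + 1) • φ (l.map Nat.succPNat).reverse =
          φ (l.map Nat.succPNat) + mergeSum (fun l => φ (l.map Nat.succPNat)) l := by
        rw [← sub_eq_zero, sub_eq_add_neg, ← h3]
        abel
      rw [h4] at h2
      rw [eq_neg_iff_add_eq_zero, ← h2]
      abel
    have hnext' : ∀ b l, l.length = r + 2 → b + l.sum = m - 1 →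
        G (b :: l) + G (b :: l) = -mergeSum (fun l => G (b :: l)) l := by
      refine eq_of_insertSum_eq_zero (f := fun l => G l + G l)
        (g := fun l => match l with | [] => 0 | b :: l => -mergeSum (fun l => G (b :: l)) l)
        ?_ ?_ (r + 2) (m - 1) hnext
      · intro l hl
        rw [insertSum_add, hins l hl, add_zero]
      · intro l hl
        obtain ⟨b, l, rfl⟩ := List.exists_cons_of_ne_nil hl
        rw [insertSum]
        simp only
        rw [insertSum_neg, insertSum_mergeSum, smul_neg, ← mergeSum_smul, ← neg_add, ← mergeSum_add,
          mergeSum_congr (g := fun _ => (0 : ℚ) • (0 : M)), mergeSum_smul, zero_smul, neg_zero]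
        intro l' _ _
        rw [zero_smul]
        exact hins (b :: l') (by simp)
    have hfin : G (0 :: bs) = 0 := by
      rcases r with _ | r
      · -- sequences of length two
        have hmv : ∀ p q, p + q + 1 = m → G [p, q + 1] = G [p + 1, q] := by
          intro p q hpq
          have h1 := hnext' p [q, 0] rfl (by simp; omega)
          have h2 := hnext' q [0, p] rfl (by simp; omega)
          have h3 := hrot p [q, 0]
          simp only [mergeSum, List.cons_append, List.nil_append, add_zero, zero_add] at h1 h2 h3
          rw [h3, h2] at h1
          have h4 := hrot (p + 1) [q]
          simp only [List.cons_append, List.nil_append] at h4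
          rw [h4]
          exact (neg_injective h1).symm
        have hall : ∀ q p, p + q = m → G [p, q] = G [m, 0] := by
          intro q
          induction q with
          | zero => intro p hp; rw [← hp, add_zero]
          | succ q ihq => intro p hp; rw [hmv p q (by omega), ihq _ (by omega)]
        obtain ⟨n, hn⟩ := Nat.exists_eq_succ_of_ne_zero hm0
        have h1 := hins [n, 0] (by simp)
        simp only [insertSum, add_zero, zero_add] at h1
        rw [hall 1 n (by omega), hall 0 (n + 1) (by omega), ← add_smul] at h1
        have h2 := (smul_eq_zero.1 h1).resolve_left (by positivity)
        obtain ⟨b, hb⟩ := List.length_eq_one_iff.1 hbl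
        rw [hb] at hm ⊢
        rw [hall b 0 (by simp at hm; omega), h2]
      · refine eq_zero_of_move r m hm0 hrot hins ?_ _ (by simp [hbl]) (by simp [← hm])
        intro α β p q l hl hs
        have h1 := hnext' β (p :: q :: (l ++ [α])) (by simp [hl]) (by simp; omega)
        have h2 := hnext' p (q :: l ++ [α, β]) (by simp [hl]) (by simp; omega)
        have h3 := hrot β (p :: q :: (l ++ [α]))
        rw [mergeSum_append_pair] at h2
        simp only [List.cons_append, List.append_assoc, List.nil_append] at h2 h3
        rw [mergeSum, h3, h2] at h1
        have h4 := hrot α (β :: (p + q + 1) :: l)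
        have h5 := hrot (α + β + 1) (p :: q :: l)
        have h6 : mergeSum (fun h => G (p :: (h ++ [β]))) (q :: (l ++ [α])) =
            mergeSum (fun h => G (β :: p :: h)) (q :: (l ++ [α])) :=
          mergeSum_congr fun h _ _ => (hrot β (p :: h)).symm
        rw [h6] at h1
        rw [h4, h5]
        simp only [List.cons_append]
        rw [neg_inj, add_comm] at h1
        exact (add_right_cancel h1).symm
    rw [← hkbs, ← hG bs hm0, hfin]

end Core

/-! ### Truncated multiple zeta values -/

/-- The truncated sum `∑_{0 < n₁ < ⋯ < n_r < N} ∏ n_j^{-k_j}`, for the reversed index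
`(k_r, …, k₁)`. The terms with `n_j = 0` vanish, as `0⁻¹ = 0`. -/
def truncSum : List ℕ+ → ℕ → ℝ
  | [], _ => 1
  | a :: k, N => ∑ n ∈ Finset.range N, ((n : ℝ) ^ (a : ℕ))⁻¹ * truncSum k n

theorem truncSum_succ (a : ℕ+) (k : List ℕ+) (N : ℕ) :
    truncSum (a :: k) (N + 1) = truncSum (a :: k) N + ((N : ℝ) ^ (a : ℕ))⁻¹ * truncSum k N := by
  rw [truncSum, Finset.sum_range_succ]; rfl

theorem truncSum_cons_zero (a : ℕ+) (k : List ℕ+) : truncSum (a :: k) 0 = 0 := by simp [truncSum]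

theorem truncSum_nonneg (k : List ℕ+) (N : ℕ) : 0 ≤ truncSum k N := by
  induction k generalizing N with
  | nil => simp [truncSum]
  | cons a k ih => exact Finset.sum_nonneg fun n _ => mul_nonneg (by positivity) (ih n)

theorem truncSum_mono (k : List ℕ+) : Monotone (truncSum k) := by
  cases k with
  | nil => exact fun _ _ _ => le_rfl
  | cons a k =>
    exact monotone_nat_of_le_succ fun n => by
      rw [truncSum_succ]
      exact le_add_of_nonneg_right (mul_nonneg (by positivity) (truncSum_nonneg k n))

/-- The truncated multiple zeta values satisfy the harmonic product formula. -/
theorem truncSum_mul (k l : List ℕ+) (N : ℕ) :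
    truncSum k N * truncSum l N = harmonicSum (fun h => truncSum h N) k l := by
  have hzero : ∀ u v, harmonicSum (fun _ => (0 : ℝ)) u v = 0 := by
    intro u v
    simp [harmonicSum]
  induction N generalizing k l with
  | zero =>
    cases k with
    | nil => simp [truncSum]
    | cons a k =>
      cases l with
      | nil => simp [truncSum]
      | cons b l =>
        rw [harmonicSum_cons_cons]
        simp only [truncSum_cons_zero, hzero]
        simp
  | succ N ih =>
    cases k with
    | nil => simp [truncSum]
    | cons a k =>
      cases l with
      | nil => simp [truncSum]
      | cons b l =>
        rw [harmonicSum_cons_cons]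
        simp only [truncSum_succ, harmonicSum_add, harmonicSum_mul_left, ← ih]
        have := ih (a :: k) (b :: l)
        rw [harmonicSum_cons_cons] at this
        rw [PNat.add_coe, pow_add, mul_inv]
        linear_combination this

/-- The truncated sum `∑_{0 < n < N} 1 / n`. -/
abbrev harmonicNumber (N : ℕ) : ℝ := truncSum [1] N

theorem harmonicNumber_succ (N : ℕ) : harmonicNumber (N + 1) = harmonicNumber N + (N : ℝ)⁻¹ := by
  rw [harmonicNumber, truncSum_succ]; simp [truncSum]

theorem harmonicNumber_eq_sum (N : ℕ) :
    harmonicNumber N = ∑ n ∈ Finset.range N, (n : ℝ)⁻¹ := by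
  simp [harmonicNumber, truncSum]

theorem harmonicNumber_eq_harmonic (N : ℕ) : harmonicNumber (N + 1) = (harmonic N : ℝ) := by
  induction N with
  | zero => simp [harmonicNumber, truncSum]
  | succ N ih => rw [harmonicNumber_succ, ih, harmonic_succ]; push_cast; rfl

theorem harmonicNumber_nonneg (N : ℕ) : 0 ≤ harmonicNumber N := truncSum_nonneg _ _

theorem tendsto_harmonicNumber : Tendsto harmonicNumber atTop atTop := by
  rw [← tendsto_add_atTop_iff_nat 1]
  simp only [harmonicNumber_eq_harmonic]
  refine tendsto_atTop_mono (fun n => log_add_one_le_harmonic n) ?_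
  exact Real.tendsto_log_atTop.comp
    ((tendsto_natCast_atTop_atTop (R := ℝ)).comp (tendsto_add_atTop_nat 1))
      |>.congr fun n => by simp

theorem truncSum_le_pow (k : List ℕ+) (N : ℕ) : truncSum k N ≤ harmonicNumber N ^ k.length := by
  induction k with
  | nil => simp [truncSum]
  | cons a k ih =>
    calc truncSum (a :: k) N ≤ ∑ n ∈ Finset.range N, (n : ℝ)⁻¹ * truncSum k N := by
          refine Finset.sum_le_sum fun n hn =>
            mul_le_mul ?_ ?_ (truncSum_nonneg _ _) (by positivity)
          · rcases Nat.eq_zero_or_pos n with rfl | hn0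
            · simp
            · have h1 : (1 : ℝ) ≤ n := by exact_mod_cast hn0
              exact inv_anti₀ (by positivity) (by
                simpa using pow_le_pow_right₀ h1 a.pos)
          · exact truncSum_mono k (Finset.mem_range.1 hn).le
      _ = harmonicNumber N * truncSum k N := by rw [← Finset.sum_mul, harmonicNumber_eq_sum]
      _ ≤ harmonicNumber N ^ (k.length + 1) := by
          rw [pow_succ']
          exact mul_le_mul_of_nonneg_left ih (harmonicNumber_nonneg N)

theorem isLittleO_harmonicNumber_pow (J : ℕ) {s : ℝ} (hs : 0 < s) :
    (fun N : ℕ => harmonicNumber (N + 1) ^ J) =o[atTop] fun N : ℕ => (N : ℝ) ^ s := by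
  have h1 : (fun x : ℝ => (1 + Real.log x) ^ J) =o[atTop] fun x : ℝ => x ^ s := by
    have h2 : (fun x : ℝ => 1 + Real.log x) =o[atTop] fun x : ℝ => x ^ (s / (J + 1)) := by
      refine Asymptotics.IsLittleO.add ?_ (isLittleO_log_rpow_atTop (by positivity))
      exact (Asymptotics.isLittleO_const_left).2 (Or.inr
        (tendsto_norm_atTop_atTop.comp (tendsto_rpow_atTop (by positivity))))
    rcases Nat.eq_zero_or_pos J with rfl | hJ
    · simpa using (Asymptotics.isLittleO_const_left (c := (1 : ℝ))).2 (Or.inr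
        (tendsto_norm_atTop_atTop.comp (tendsto_rpow_atTop hs)))
    · refine (h2.pow hJ).trans_isBigO ?_
      refine Asymptotics.IsBigO.of_bound 1 ?_
      filter_upwards [eventually_ge_atTop 1] with x hx
      have hx0 : 0 ≤ x := by linarith
      rw [one_mul, ← Real.rpow_natCast, ← Real.rpow_mul hx0, Real.norm_of_nonneg (by positivity),
        Real.norm_of_nonneg (by positivity)]
      refine Real.rpow_le_rpow_of_exponent_le hx ?_
      rw [div_mul_eq_mul_div, div_le_iff₀ (by positivity)]
      nlinarith
  refine Asymptotics.IsBigO.trans_isLittleO ?_ (h1.comp_tendsto tendsto_natCast_atTop_atTop)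
  refine Asymptotics.IsBigO.of_bound 1 (Eventually.of_forall fun N => ?_)
  have h3 := harmonicNumber_nonneg (N + 1)
  have h4 := harmonic_le_one_add_log N
  rw [← harmonicNumber_eq_harmonic] at h4
  simp only [Function.comp_apply, norm_pow, one_mul]
  refine pow_le_pow_left₀ (norm_nonneg _) ?_ _
  rw [Real.norm_of_nonneg h3]
  exact h4.trans (le_abs_self _)

theorem tendsto_harmonicNumber_pow_div (J : ℕ) :
    Tendsto (fun N : ℕ => harmonicNumber (N + 1) ^ J / N) atTop (nhds 0) := by
  simpa using (isLittleO_harmonicNumber_pow J one_pos).tendsto_div_nhds_zero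

theorem summable_harmonicNumber_pow_div (J : ℕ) :
    Summable fun n : ℕ => harmonicNumber (n + 1) ^ J / (n : ℝ) ^ 2 := by
  have h1 : Summable fun n : ℕ => (n : ℝ) ^ (-(3 / 2) : ℝ) :=
    Real.summable_nat_rpow.2 (by norm_num)
  refine summable_of_isBigO_nat h1 ?_
  have h2 := (isLittleO_harmonicNumber_pow J (s := 1 / 2) (by norm_num)).isBigO
  have h3 := h2.mul (Asymptotics.isBigO_refl (fun n : ℕ => ((n : ℝ) ^ 2)⁻¹) atTop)
  refine (h3.congr_left fun n => (div_eq_mul_inv _ _).symm).trans ?_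
  refine Asymptotics.IsBigO.of_bound 1 ?_
  filter_upwards [eventually_gt_atTop 0] with n hn
  have hn' : (0 : ℝ) < n := by exact_mod_cast hn
  rw [one_mul, ← Real.rpow_natCast, ← Real.rpow_neg hn'.le, ← Real.rpow_add hn']
  norm_num

/-! ### Negligible sequences -/

/-- A sequence is negligible if it is `o((log N)^{-J})` for all `J`. The harmonic
numbers take the place of the logarithm. -/
def Negligible (a : ℕ → ℝ) : Prop :=
  ∀ J : ℕ, Tendsto (fun N => a N * harmonicNumber N ^ J) atTop (nhds 0)

theorem Negligible.add {a b : ℕ → ℝ} (ha : Negligible a) (hb : Negligible b) :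
    Negligible fun N => a N + b N := fun J => by
  simpa [add_mul] using (ha J).add (hb J)

theorem Negligible.const_mul {a : ℕ → ℝ} (ha : Negligible a) (c : ℝ) :
    Negligible fun N => c * a N := fun J => by
  simpa [mul_assoc] using (ha J).const_mul c

theorem Negligible.neg {a : ℕ → ℝ} (ha : Negligible a) : Negligible fun N => -a N := fun J => by
  simpa using (ha J).neg

theorem Negligible.sub {a b : ℕ → ℝ} (ha : Negligible a) (hb : Negligible b) :
    Negligible fun N => a N - b N := by
  simpa [sub_eq_add_neg] using ha.add hb.neg

theorem negligible_zero : Negligible fun _ => 0 := fun J => by simp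

theorem Negligible.mul_harmonicNumber {a : ℕ → ℝ} (ha : Negligible a) :
    Negligible fun N => harmonicNumber N * a N := fun J => by
  refine (ha (J + 1)).congr fun N => ?_
  rw [pow_succ]; ring

theorem Negligible.mul_of_abs_le {a b : ℕ → ℝ} (ha : Negligible a) (d : ℕ)
    (h : ∀ N, |b N| ≤ harmonicNumber N ^ d) : Negligible fun N => b N * a N := fun J => by
  have h1 : Tendsto (fun N => |a N * harmonicNumber N ^ (d + J)|) atTop (nhds 0) := by
    simpa using (ha (d + J)).abs
  refine squeeze_zero_norm (fun N => ?_) h1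
  rw [Real.norm_eq_abs, abs_mul, abs_mul, abs_mul, pow_add, abs_mul]
  have := h N
  rw [abs_of_nonneg (pow_nonneg (harmonicNumber_nonneg N) d)]
  calc |b N| * |a N| * |harmonicNumber N ^ J|
      ≤ harmonicNumber N ^ d * |a N| * |harmonicNumber N ^ J| := by gcongr
    _ = _ := by ring

theorem Negligible.mul {a b : ℕ → ℝ} (ha : Negligible a) (hb : Negligible b) :
    Negligible fun N => a N * b N := fun J => by
  have h := (ha J).mul (hb 0)
  rw [zero_mul] at h
  exact h.congr fun N => by ring

theorem negligible_list_sum {α : Type*} (l : List α) (f : α → ℕ → ℝ)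
    (h : ∀ a ∈ l, Negligible (f a)) : Negligible fun N => (l.map fun a => f a N).sum := by
  induction l with
  | nil => simpa using negligible_zero
  | cons a l ih =>
    simp only [List.map_cons, List.sum_cons]
    exact (h a (by simp)).add (ih fun b hb => h b (by simp [hb]))

theorem negligible_sum {α : Type*} (s : Finset α) (f : α → ℕ → ℝ)
    (h : ∀ a ∈ s, Negligible (f a)) : Negligible fun N => ∑ a ∈ s, f a N := by
  classical
  induction s using Finset.induction_on with
  | empty => simpa using negligible_zero
  | insert a s ha ih =>
    simp only [Finset.sum_insert ha]
    exact (h a (by simp)).add (ih fun b hb => h b (by simp [hb]))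

/-- A polynomial in the harmonic numbers is negligible only if it is zero. -/
theorem eq_zero_of_negligible_eval (q : Polynomial ℝ)
    (h : Negligible fun N => q.eval (harmonicNumber N)) : q = 0 := by
  have h0 : Tendsto (fun N => q.eval (harmonicNumber N)) atTop (nhds 0) := by simpa using h 0
  by_cases hd : 0 < q.degree
  · have h1 := (q.abs_tendsto_atTop hd).comp tendsto_harmonicNumber
    exact absurd h0.abs (not_tendsto_nhds_of_tendsto_atTop h1 _)
  · have h1 := Polynomial.eq_C_of_degree_le_zero (not_lt.1 hd)
    rw [h1] at h0 ⊢
    simp only [Polynomial.eval_C] at h0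
    rw [tendsto_nhds_unique tendsto_const_nhds h0, Polynomial.C_0]

theorem summable_of_abs_le {a : ℕ → ℝ} (d : ℕ)
    (h : ∀ n, |a n| ≤ harmonicNumber (n + 1) ^ d / (n : ℝ) ^ 2) : Summable a :=
  Summable.of_norm_bounded (summable_harmonicNumber_pow_div d) h

/-- The tail of a series with terms `O((log n)^d / n²)` is negligible. -/
theorem negligible_tail {a : ℕ → ℝ} (d : ℕ)
    (h : ∀ n, |a n| ≤ harmonicNumber (n + 1) ^ d / (n : ℝ) ^ 2) :
    Negligible fun N => ∑ n ∈ Finset.range N, a n - ∑' n, a n := fun J => by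
  have hs := summable_of_abs_le d h
  have hs' := summable_harmonicNumber_pow_div (d + J)
  have h0 := tendsto_sum_nat_add fun n : ℕ => harmonicNumber (n + 1) ^ (d + J) / (n : ℝ) ^ 2
  refine squeeze_zero_norm (fun N => ?_) h0
  have h1 : ∑ n ∈ Finset.range N, a n - ∑' n, a n = -∑' n, a (n + N) := by
    rw [← hs.sum_add_tsum_nat_add N]; ring
  simp only
  rw [h1, neg_mul, norm_neg, ← tsum_mul_right]
  refine tsum_of_norm_bounded ((summable_nat_add_iff N).2 hs').hasSum fun n => ?_
  rw [norm_mul, Real.norm_eq_abs, norm_pow, Real.norm_of_nonneg (harmonicNumber_nonneg N), pow_add,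
    mul_div_right_comm]
  have h2 : harmonicNumber N ≤ harmonicNumber (n + N + 1) := truncSum_mono [1] (by omega)
  have h3 := harmonicNumber_nonneg N
  have h4 := h (n + N)
  have h5 := harmonicNumber_nonneg (n + N + 1)
  gcongr

/-! ### Multiple zeta values as limits of truncated sums -/

/-- A strictly increasing tuple is given by its last entry and a tuple with smaller entries. -/
def strictMonoSnocEquiv (r : ℕ) (D : ℕ+ → Prop) :
    {n : Fin (r + 1) → ℕ+ // StrictMono n ∧ D (n (Fin.last r))} ≃
      Σ m : {m : ℕ+ // D m}, {n : Fin r → ℕ+ // StrictMono n ∧ ∀ j, (n j : ℕ) < (m : ℕ+)} where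
  toFun n := ⟨⟨n.1 (Fin.last r), n.2.2⟩, ⟨fun j => n.1 j.castSucc,
    fun _ _ h => n.2.1 (Fin.castSucc_lt_castSucc_iff.2 h), fun j => n.2.1 (Fin.castSucc_lt_last j)⟩⟩
  invFun p := ⟨Fin.snoc (α := fun _ => ℕ+) p.2.1 p.1.1, by
    constructor
    · intro i j
      induction i using Fin.lastCases with
      | last => intro h; exact absurd h (not_lt.2 (Fin.le_last j))
      | cast i =>
        induction j using Fin.lastCases with
        | last => intro _; simpa using p.2.2.2 i
        | cast j => intro h; simpa using p.2.2.1 (Fin.castSucc_lt_castSucc_iff.1 h)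
    · simpa using p.1.2⟩
  left_inv n := by
    apply Subtype.ext
    funext j
    induction j using Fin.lastCases <;> simp
  right_inv p := by
    obtain ⟨⟨m, hm⟩, n, hn⟩ := p
    have aux : ∀ p q : (Σ m : {m : ℕ+ // D m},
        {n : Fin r → ℕ+ // StrictMono n ∧ ∀ j, (n j : ℕ) < (m : ℕ+)}),
        p.1 = q.1 → p.2.1 = q.2.1 → p = q := by
      rintro ⟨p, p', hp⟩ ⟨q, q', hq⟩ h h'
      simp only at h h'
      subst h h'
      rfl
    exact aux _ _ (Subtype.ext (by simp)) (funext fun j => by simp)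

/-- A term of a multiple zeta value, as an extended non-negative number. -/
def mzvTerm {r : ℕ} (e : Fin r → ℕ+) (n : Fin r → ℕ+) : ENNReal :=
  ∏ j, ENNReal.ofReal (((n j : ℕ) : ℝ) ^ (e j : ℕ))⁻¹

theorem tsum_strictMono_snoc {r : ℕ} (e : Fin (r + 1) → ℕ+) (D : ℕ+ → Prop) :
    ∑' n : {n : Fin (r + 1) → ℕ+ // StrictMono n ∧ D (n (Fin.last r))}, mzvTerm e n.1 =
      ∑' m : {m : ℕ+ // D m}, ENNReal.ofReal (((m.1 : ℕ) : ℝ) ^ (e (Fin.last r) : ℕ))⁻¹ *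
        ∑' n : {n : Fin r → ℕ+ // StrictMono n ∧ ∀ j, (n j : ℕ) < (m : ℕ+)},
          mzvTerm (fun j => e j.castSucc) n.1 := by
  rw [← (strictMonoSnocEquiv r D).symm.tsum_eq, ENNReal.tsum_sigma']
  refine tsum_congr fun m => ?_
  rw [← ENNReal.tsum_mul_left]
  refine tsum_congr fun n => ?_
  simp [mzvTerm, strictMonoSnocEquiv, Fin.prod_univ_castSucc, mul_comm]

theorem ofFn_reverse_succ {α : Type*} {r : ℕ} (e : Fin (r + 1) → α) :
    (List.ofFn e).reverse = e (Fin.last r) :: (List.ofFn fun j => e j.castSucc).reverse := by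
  rw [List.ofFn_succ', List.concat_eq_append, List.reverse_append]
  rfl

theorem tsum_mzvTerm_lt {r : ℕ} (e : Fin r → ℕ+) (N : ℕ) :
    ∑' n : {n : Fin r → ℕ+ // StrictMono n ∧ ∀ j, (n j : ℕ) < N}, mzvTerm e n.1 =
      ENNReal.ofReal (truncSum (List.ofFn e).reverse N) := by
  induction r generalizing N with
  | zero =>
    have : Unique {n : Fin 0 → ℕ+ // StrictMono n ∧ ∀ j, (n j : ℕ) < N} :=
      ⟨⟨⟨Fin.elim0, fun i => i.elim0, fun i => i.elim0⟩⟩,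
        fun a => Subtype.ext (Subsingleton.elim _ _)⟩
    rw [tsum_eq_single default fun b hb => absurd (Subsingleton.elim _ _) hb]
    simp [mzvTerm, truncSum]
  | succ r ih =>
    have h : ∀ n : Fin (r + 1) → ℕ+, (StrictMono n ∧ ∀ j, (n j : ℕ) < N) ↔
        (StrictMono n ∧ (n (Fin.last r) : ℕ) < N) := fun n =>
      ⟨fun h => ⟨h.1, h.2 _⟩, fun h => ⟨h.1, fun j =>
        lt_of_le_of_lt (PNat.coe_le_coe _ _ |>.2 (h.1.monotone (Fin.le_last j))) h.2⟩⟩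
    rw [← (Equiv.subtypeEquivRight h).symm.tsum_eq]
    have := tsum_strictMono_snoc e fun m => (m : ℕ) < N
    simp only [Equiv.subtypeEquivRight_symm_apply_coe]
    rw [this]
    simp only [ih]
    rw [ofFn_reverse_succ, truncSum, ENNReal.ofReal_sum_of_nonneg fun n _ =>
      mul_nonneg (by positivity) (truncSum_nonneg _ _)]
    set f : ℕ → ENNReal := fun n => if n < N then
      ENNReal.ofReal (((n : ℝ) ^ (e (Fin.last r) : ℕ))⁻¹ *
      truncSum (List.ofFn fun j => e j.castSucc).reverse n) else 0 with hf
    have hinj : Function.Injective fun m : {m : ℕ+ // (m : ℕ) < N} => ((m.1 : ℕ+) : ℕ) :=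
      fun a b hab => Subtype.ext (PNat.eq hab)
    calc _ = ∑' m : {m : ℕ+ // (m : ℕ) < N}, f (m.1 : ℕ+) := by
          refine tsum_congr fun m => ?_
          rw [hf]
          simp only
          rw [if_pos m.2, ENNReal.ofReal_mul (by positivity)]
      _ = ∑' n, f n := hinj.tsum_eq (f := f) (by
          intro n hn
          have hnN : n < N := by
            by_contra h'
            exact hn (if_neg h')
          rcases Nat.eq_zero_or_pos n with rfl | hn0
          · exact absurd (by simp [hf]) hn
          · exact ⟨⟨⟨n, hn0⟩, hnN⟩, rfl⟩)
      _ = _ := by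
          rw [tsum_eq_sum (s := Finset.range N) fun n hn => if_neg (by simpa using hn)]
          exact Finset.sum_congr rfl fun n hn => if_pos (Finset.mem_range.1 hn)

theorem tsum_mzvTerm {r : ℕ} (e : Fin r → ℕ+) (a : ℕ+) (l : List ℕ+)
    (h : List.ofFn e = (a :: l).reverse) :
    ∑' n : {n : Fin r → ℕ+ // StrictMono n}, mzvTerm e n.1 =
      ∑' n : ℕ, ENNReal.ofReal (((n : ℝ) ^ (a : ℕ))⁻¹ * truncSum l n) := by
  cases r with
  | zero => simp at h
  | succ r =>
    have h' := congrArg List.reverse h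
    rw [ofFn_reverse_succ, List.reverse_reverse, List.cons.injEq] at h'
    have h0 : ∀ n : Fin (r + 1) → ℕ+, StrictMono n ↔ (StrictMono n ∧ True) := fun n => by simp
    rw [← (Equiv.subtypeEquivRight h0).symm.tsum_eq]
    have := tsum_strictMono_snoc e fun _ => True
    simp only [Equiv.subtypeEquivRight_symm_apply_coe]
    rw [this]
    simp only [tsum_mzvTerm_lt, h'.1, h'.2]
    have hinj : Function.Injective fun m : {m : ℕ+ // True} => ((m.1 : ℕ+) : ℕ) :=
      fun a b hab => Subtype.ext (PNat.eq hab)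
    rw [← hinj.tsum_eq (f := fun n : ℕ => ENNReal.ofReal (((n : ℝ) ^ (a : ℕ))⁻¹ * truncSum l n))]
    · exact tsum_congr fun m => (ENNReal.ofReal_mul (by positivity)).symm
    · intro n hn
      rcases Nat.eq_zero_or_pos n with rfl | hn0
      · exact absurd (by simp) hn
      · exact ⟨⟨⟨n, hn0⟩, trivial⟩, rfl⟩

theorem mzv_eq_tsum (a : ℕ+) (l : List ℕ+) :
    mzv (a :: l).reverse = ∑' n : ℕ, ((n : ℝ) ^ (a : ℕ))⁻¹ * truncSum l n := by
  have h := congrArg ENNReal.toReal (tsum_mzvTerm (a :: l).reverse.get a l (List.ofFn_get _))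
  rw [ENNReal.tsum_toReal_eq, ENNReal.tsum_toReal_eq] at h
  · refine Eq.trans ?_ (h.trans ?_)
    · refine tsum_congr fun n => ?_
      rw [mzvTerm, ENNReal.toReal_prod]
      refine Finset.prod_congr rfl fun j _ => ?_
      rw [ENNReal.toReal_ofReal (by positivity)]
    · refine tsum_congr fun n => ?_
      rw [ENNReal.toReal_ofReal (mul_nonneg (by positivity) (truncSum_nonneg _ _))]
  · exact fun n => ENNReal.ofReal_ne_top
  · exact fun n => ENNReal.prod_ne_top fun j _ => ENNReal.ofReal_ne_top

theorem mzv_nil : mzv [] = 1 := by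
  have : Unique {n : Fin ([] : Index).length → ℕ+ // StrictMono n} :=
    ⟨⟨⟨Fin.elim0, fun i => i.elim0⟩⟩, fun a => Subtype.ext (funext fun i => Fin.elim0 i)⟩
  rw [mzv, tsum_eq_single default fun b hb => absurd (Subsingleton.elim _ _) hb]
  exact Finset.prod_eq_one fun j _ => Fin.elim0 j

theorem truncSum_term_le {a : ℕ+} (ha : 2 ≤ a) (l : List ℕ+) (n : ℕ) :
    |((n : ℝ) ^ (a : ℕ))⁻¹ * truncSum l n| ≤ harmonicNumber (n + 1) ^ l.length / (n : ℝ) ^ 2 := by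
  rw [abs_of_nonneg (mul_nonneg (by positivity) (truncSum_nonneg _ _)), div_eq_mul_inv, mul_comm]
  have h1 : truncSum l n ≤ harmonicNumber (n + 1) ^ l.length :=
    (truncSum_le_pow l n).trans (pow_le_pow_left₀ (harmonicNumber_nonneg n)
      (truncSum_mono [1] (Nat.le_succ n)) _)
  refine mul_le_mul h1 ?_ (by positivity) (pow_nonneg (harmonicNumber_nonneg _) _)
  rcases Nat.eq_zero_or_pos n with rfl | hn
  · simp
  · have hn' : (1 : ℝ) ≤ n := by exact_mod_cast hn
    have ha' : 2 ≤ (a : ℕ) := ha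
    exact inv_anti₀ (by positivity) (pow_le_pow_right₀ hn' ha')

theorem hasSum_mzv {a : ℕ+} (ha : 2 ≤ a) (l : List ℕ+) :
    HasSum (fun n : ℕ => ((n : ℝ) ^ (a : ℕ))⁻¹ * truncSum l n) (mzv (a :: l).reverse) := by
  rw [mzv_eq_tsum]
  exact (summable_of_abs_le l.length (truncSum_term_le ha l)).hasSum

theorem trailingOnes_reverse_cons (a : ℕ+) (l : List ℕ+) :
    trailingOnes (a :: l).reverse = if a = 1 then trailingOnes l.reverse + 1 else 0 := by
  by_cases ha : a = 1 <;> simp [trailingOnes, ha]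

theorem two_le_of_ne_one {a : ℕ+} (ha : a ≠ 1) : 2 ≤ a := by
  have h1 := a.pos
  have h2 : (a : ℕ) ≠ 1 := fun h => ha (PNat.eq h)
  exact PNat.coe_le_coe _ _ |>.1 (by change 2 ≤ (a : ℕ); omega)

/-- For admissible indices, the truncated sums approach the multiple zeta value up to a negligible
error. -/
theorem negligible_truncSum_sub_mzv {k : Index} (hk : trailingOnes k = 0) :
    Negligible fun N => truncSum k.reverse N - mzv k := by
  obtain ⟨l, rfl⟩ : ∃ l : List ℕ+, k = l.reverse := ⟨k.reverse, by simp⟩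
  rw [List.reverse_reverse]
  cases l with
  | nil => simpa [truncSum, mzv_nil] using negligible_zero
  | cons a l =>
    have ha : a ≠ 1 := by
      rintro rfl
      rw [trailingOnes_reverse_cons] at hk
      simp at hk
    rw [mzv_eq_tsum]
    exact negligible_tail l.length (truncSum_term_le (two_le_of_ne_one ha) l)

/-! ### The harmonic regularization -/

theorem regMZV_of_trailingOnes_eq_zero (b : Bullet) {k : Index} (hk : trailingOnes k = 0) :
    regMZV b k = Polynomial.C (mzv k) := by
  rw [regMZV, dif_pos hk]

theorem trailingOnes_mul_regMZV (b : Bullet) {k : Index} (hk : trailingOnes k ≠ 0) :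
    Polynomial.C (trailingOnes k : ℝ) * regMZV b k = Polynomial.X * regMZV b k.dropLast -
      (((b.mul [1] k.dropLast).filter fun h => trailingOnes h < trailingOnes k).map
        (regMZV b)).sum := by
  conv_lhs => rw [regMZV, dif_neg hk]
  rw [← mul_assoc, ← Polynomial.C_mul, mul_inv_cancel₀ (Nat.cast_ne_zero.2 hk), Polynomial.C_1,
    one_mul]
  congr 2
  exact List.attach_map_val (f := regMZV b)

/-- `z_1 • z_k` is mapped to `T ζ^•(k; T)`. -/
theorem sum_regMZV_one_mul (b : Bullet) {k : Index} (hk : trailingOnes k ≠ 0) :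
    ((b.mul [1] k.dropLast).map (regMZV b)).sum = Polynomial.X * regMZV b k.dropLast := by
  rw [mul_one_sum b k hk, nsmul_eq_mul, ← Polynomial.C_eq_natCast, trailingOnes_mul_regMZV b hk]
  ring

theorem harmonicSum_eq (F : Index → ℝ) (u v : List ℕ+) :
    ((Bullet.harmonic.mul u.reverse v.reverse).map F).sum =
      harmonicSum (fun h => F h.reverse) u v := by
  simp [Bullet.mul, harmonicSum, Function.comp_def]

theorem list_sum_map_sub {α M : Type*} [AddCommGroup M] (l : List α) (f g : α → M) :
    (l.map fun a => f a - g a).sum = (l.map f).sum - (l.map g).sum := by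
  induction l with
  | nil => simp
  | cons a l ih => simp only [List.map_cons, List.sum_cons, ih]; abel

theorem eval_list_sum_map {α : Type*} (x : ℝ) (l : List α) (f : α → Polynomial ℝ) :
    (l.map f).sum.eval x = (l.map fun a => (f a).eval x).sum := by
  induction l with
  | nil => simp
  | cons a l ih => simp [ih]

/-- Up to a negligible error, the truncated sums are the values of `ζ^*(k; T)` at the harmonic
numbers. -/
theorem negligible_truncSum_sub_eval (k : Index) :
    Negligible fun N => truncSum k.reverse N - (regMZV .harmonic k).eval (harmonicNumber N) := by
  induction hs : trailingOnes k using Nat.strong_induction_on generalizing k with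
  | _ s ih =>
    subst hs
    by_cases hk : trailingOnes k = 0
    · rw [regMZV_of_trailingOnes_eq_zero _ hk]
      simpa using negligible_truncSum_sub_mzv hk
    have h1 := (ih _ (trailingOnes_dropLast_lt hk) k.dropLast rfl).mul_harmonicNumber
    have h2 := negligible_list_sum
      ((Bullet.harmonic.mul [1] k.dropLast).filter fun h => trailingOnes h < trailingOnes k)
      (fun h N => truncSum h.reverse N - (regMZV .harmonic h).eval (harmonicNumber N))
      fun h hh => ih _ (by simpa using (List.mem_filter.1 hh).2) h rfl
    have h3 := (h1.sub h2).const_mul (trailingOnes k : ℝ)⁻¹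
    refine cast (congrArg Negligible (funext fun N => ?_)) h3
    have h4 := mul_one_sum .harmonic k hk fun h => truncSum h.reverse N
    have h5 := harmonicSum_eq (fun h => truncSum h.reverse N) [1] k.dropLast.reverse
    simp only [List.reverse_reverse, List.reverse_singleton, ← truncSum_mul] at h5
    rw [h5, nsmul_eq_mul] at h4
    have h6 := congrArg (Polynomial.eval (harmonicNumber N)) (trailingOnes_mul_regMZV .harmonic hk)
    simp only [Polynomial.eval_mul, Polynomial.eval_C, Polynomial.eval_sub, Polynomial.eval_X,
      eval_list_sum_map] at h6
    have h7 : (trailingOnes k : ℝ) ≠ 0 := Nat.cast_ne_zero.2 hk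
    rw [inv_mul_eq_iff_eq_mul₀ h7, mul_sub (trailingOnes k : ℝ), h6, mul_sub, h4]
    rw [list_sum_map_sub]
    ring

/-- `ζ^*(·; T)` satisfies the harmonic product formula. -/
theorem regMZV_harmonic_mul (u v : List ℕ+) :
    regMZV .harmonic u.reverse * regMZV .harmonic v.reverse =
      harmonicSum (fun h => regMZV .harmonic h.reverse) u v := by
  rw [← sub_eq_zero]
  refine eq_zero_of_negligible_eval _ ?_
  have h1 := negligible_truncSum_sub_eval u.reverse
  have h2 := negligible_truncSum_sub_eval v.reverse
  simp only [List.reverse_reverse] at h1 h2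
  have habs : ∀ k N, |truncSum k N| ≤ harmonicNumber N ^ k.length := fun k N => by
    rw [abs_of_nonneg (truncSum_nonneg k N)]; exact truncSum_le_pow k N
  have h3 := negligible_list_sum (harmonicRev u v)
    (fun h N => truncSum h N - (regMZV .harmonic h.reverse).eval (harmonicNumber N))
    fun h _ => by simpa using negligible_truncSum_sub_eval h.reverse
  have h4 := ((h3.sub (h1.mul_of_abs_le v.length (habs v))).sub
    (h2.mul_of_abs_le u.length (habs u))).add (h1.mul h2)
  refine cast (congrArg Negligible (funext fun N => ?_)) h4
  have h5 := truncSum_mul u v N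
  rw [harmonicSum] at h5
  simp only [list_sum_map_sub, ← h5, Polynomial.eval_sub, Polynomial.eval_mul, harmonicSum,
    eval_list_sum_map]
  ring

/-! ### Multiple polylogarithms as formal power series -/

/-- The coefficients of the multiple polylogarithm attached to a reversed word. In terms of iterated
integrals, `x` stands for `dt / t` and `y` for `dt / (1 - t)`. For a word with head `x` this has its
proper meaning only if the series of the remaining word has no constant term, that is, for words
of `𝔥¹`. -/
def wordCoeff : List Letter → ℕ → ℝ
  | [], n => if n = 0 then 1 else 0
  | .x :: w, n => wordCoeff w n / n
  | .y :: w, n => (∑ m ∈ Finset.range n, wordCoeff w m) / n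

/-- The multiple polylogarithm of a reversed word. -/
def wordSeries (w : List Letter) : PowerSeries ℝ := PowerSeries.mk (wordCoeff w)

theorem wordCoeff_cons_zero (a : Letter) (w : List Letter) : wordCoeff (a :: w) 0 = 0 := by
  cases a <;> simp [wordCoeff]

theorem wordCoeff_nonneg (w : List Letter) (n : ℕ) : 0 ≤ wordCoeff w n := by
  induction w generalizing n with
  | nil => rw [wordCoeff]; positivity
  | cons a w ih =>
    cases a
    · exact div_nonneg (ih n) (by positivity)
    · exact div_nonneg (Finset.sum_nonneg fun m _ => ih m) (by positivity)

/-- The derivation `X d/dX`. -/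
def eulerOp (f : PowerSeries ℝ) : PowerSeries ℝ := PowerSeries.mk fun n => n * coeff n f

theorem eulerOp_add (f g : PowerSeries ℝ) : eulerOp (f + g) = eulerOp f + eulerOp g := by
  ext n; simp [eulerOp, mul_add]

theorem eulerOp_mul (f g : PowerSeries ℝ) : eulerOp (f * g) = eulerOp f * g + f * eulerOp g := by
  ext n
  simp only [eulerOp, coeff_mk, map_add, coeff_mul, Finset.mul_sum, ← Finset.sum_add_distrib]
  refine Finset.sum_congr rfl fun p hp => ?_
  have hn : p.1 + p.2 = n := by simpa using hp
  rw [← hn]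
  push_cast
  ring

theorem eq_of_eulerOp_eq {f g : PowerSeries ℝ} (h0 : coeff 0 f = coeff 0 g)
    (h : eulerOp f = eulerOp g) : f = g := by
  ext n
  rcases Nat.eq_zero_or_pos n with rfl | hn
  · exact h0
  · have := congrArg (coeff n) h
    simp only [eulerOp, coeff_mk] at this
    exact mul_left_cancel₀ (by positivity) this

/-- The differential forms `1` and `X / (1 - X)`, relative to `dX / X`, attached to `x` and `y`. -/
def letterForm : Letter → PowerSeries ℝ
  | .x => 1
  | .y => PowerSeries.mk fun n => if n = 0 then 0 else 1

theorem eulerOp_wordSeries {a : Letter} {w : List Letter} (h : IsH1Word (a :: w)) :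
    eulerOp (wordSeries (a :: w)) = letterForm a * wordSeries w := by
  ext n
  cases a with
  | x =>
    simp only [eulerOp, wordSeries, coeff_mk, letterForm, one_mul, wordCoeff]
    rcases Nat.eq_zero_or_pos n with rfl | hn
    · cases w with
      | nil => simp [IsH1Word] at h
      | cons b w => simp [wordCoeff_cons_zero]
    · field_simp
  | y =>
    simp only [eulerOp, wordSeries, coeff_mk, letterForm, coeff_mul, wordCoeff]
    rw [Finset.Nat.sum_antidiagonal_eq_sum_range_succ fun i j =>
      (if i = 0 then 0 else 1) * wordCoeff w j, Finset.sum_range_succ']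
    simp only [if_true, zero_mul, add_zero, Nat.add_eq_zero_iff, one_ne_zero, and_false, if_false,
      one_mul]
    rcases Nat.eq_zero_or_pos n with rfl | hn
    · simp
    · rw [mul_div_cancel₀ _ (by positivity), ← Finset.sum_range_reflect]
      exact Finset.sum_congr rfl fun i _ => by
        rw [Nat.sub_right_comm, Nat.sub_sub n i]

theorem shuffleSum_mul_left {R : Type*} [CommRing R] (c : R) (F : List Letter → R)
    (u v : List Letter) : shuffleSum (fun h => c * F h) u v = c * shuffleSum F u v := by
  simp [shuffleSum, List.sum_map_mul_left]

theorem map_shuffleSum {M M' G : Type*} [AddCommGroup M] [AddCommGroup M'] [FunLike G M M']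
    [AddMonoidHomClass G M M'] (g : G) (F : List Letter → M) (u v : List Letter) :
    g (shuffleSum F u v) = shuffleSum (fun h => g (F h)) u v := by
  simp [shuffleSum, map_list_sum, Function.comp_def]

/-- The shuffle product formula for multiple polylogarithms. Both sides have the same image under
`X d/dX`, by induction. -/
theorem wordSeries_mul {u v : List Letter} (hu : IsH1Word u) (hv : IsH1Word v) :
    wordSeries u * wordSeries v = shuffleSum wordSeries u v := by
  have h1 : wordSeries [] = 1 := by
    ext n; simp [wordSeries, wordCoeff, coeff_one]
  induction u generalizing v with
  | nil => simp [h1]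
  | cons a u ihu =>
    induction v with
    | nil => simp [h1]
    | cons b v ihv =>
      have hE : ∀ (F : List Letter → PowerSeries ℝ) u v,
          eulerOp (shuffleSum F u v) = shuffleSum (fun h => eulerOp (F h)) u v := fun F u v =>
        map_shuffleSum (⟨⟨eulerOp, by ext n; simp [eulerOp]⟩, eulerOp_add⟩ :
          PowerSeries ℝ →+ PowerSeries ℝ) F u v
      have hu' := isH1Word_of_cons hu
      have hv' := isH1Word_of_cons hv
      refine eq_of_eulerOp_eq ?_ ?_
      · rw [shuffleSum_cons_cons, map_add, map_shuffleSum, map_shuffleSum]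
        simp only [wordSeries, coeff_mk, wordCoeff_cons_zero, shuffleSum_zero, coeff_mul]
        simp [wordCoeff_cons_zero]
      · rw [eulerOp_mul, eulerOp_wordSeries hu, eulerOp_wordSeries hv, shuffleSum_cons_cons,
          eulerOp_add, hE, hE]
        rw [shuffleSum_congr (G := fun h => letterForm a * wordSeries h) fun w hw =>
            eulerOp_wordSeries ((isH1Word_cons (mem_shuffleRev_ne_nil hw (by simp))).2
              (isH1Word_of_mem_shuffleRev hu' hv hw)),
          shuffleSum_congr (G := fun h => letterForm b * wordSeries h) fun w hw =>
            eulerOp_wordSeries ((isH1Word_cons (mem_shuffleRev_ne_nil hw (by simp))).2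
              (isH1Word_of_mem_shuffleRev hu hv' hw)),
          shuffleSum_mul_left, shuffleSum_mul_left, ← ihu hu' hv, ← ihv hv']
        ring

/-- The partial sum `∑_{n < N}` of the coefficients of a multiple polylogarithm. -/
def wordSum (w : List Letter) (N : ℕ) : ℝ := ∑ n ∈ Finset.range N, wordCoeff w n

theorem wordSum_succ (w : List Letter) (N : ℕ) :
    wordSum w (N + 1) = wordSum w N + wordCoeff w N := Finset.sum_range_succ _ _

theorem wordCoeff_y_cons (w : List Letter) (N : ℕ) :
    wordCoeff (.y :: w) N = (N : ℝ)⁻¹ * wordSum w N := by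
  rw [wordCoeff, wordSum, div_eq_inv_mul]

theorem wordCoeff_replicate_x (j : ℕ) (w : List Letter) (n : ℕ) :
    wordCoeff (List.replicate j .x ++ w) n = ((n : ℝ) ^ j)⁻¹ * wordCoeff w n := by
  induction j with
  | zero => simp
  | succ j ih =>
    rw [List.replicate_succ, List.cons_append, wordCoeff, ih, pow_succ, mul_inv]
    ring

theorem wordCoeff_wordRev_cons (a : ℕ+) (k : List ℕ+) (n : ℕ) :
    wordCoeff (wordRev (a :: k)) n = ((n : ℝ) ^ (a : ℕ))⁻¹ * truncSum k n := by
  induction k generalizing a n with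
  | nil =>
    rw [wordRev, wordCoeff_replicate_x, wordCoeff_y_cons, ← mul_assoc, ← mul_inv, ← pow_succ,
      Nat.sub_add_cancel a.pos, truncSum]
    rcases Nat.eq_zero_or_pos n with rfl | hn
    · simp
    · congr 1
      simp [wordSum, wordRev, wordCoeff, hn]
  | cons b k ih =>
    rw [wordRev, wordCoeff_replicate_x, wordCoeff_y_cons, ← mul_assoc, ← mul_inv, ← pow_succ,
      Nat.sub_add_cancel a.pos, truncSum, wordSum]
    simp only [ih]

theorem wordSum_wordRev {k : List ℕ+} (hk : k ≠ []) (N : ℕ) :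
    wordSum (wordRev k) N = truncSum k N := by
  obtain ⟨a, k, rfl⟩ := List.exists_cons_of_ne_nil hk
  simp only [wordSum, wordCoeff_wordRev_cons, truncSum]

theorem exists_indexRev_x_cons {w : List Letter} (hw : IsH1Word (.x :: w)) :
    ∃ a l, indexRev (.x :: w) = a :: l ∧ 2 ≤ a := by
  have hw' := isH1Word_of_cons hw
  cases h : indexRev w with
  | nil =>
    have := wordRev_indexRev hw'
    rw [h, wordRev] at this
    subst this
    simp [IsH1Word] at hw
  | cons a l =>
    refine ⟨a + 1, l, by simp [indexRev, h], ?_⟩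
    have := a.pos
    exact PNat.coe_le_coe _ _ |>.1 (by rw [PNat.add_coe]; change 2 ≤ (a : ℕ) + 1; omega)

theorem abs_wordCoeff_le {w : List Letter} (hw : IsH1Word (.x :: w)) (n : ℕ) :
    |wordCoeff (.x :: w) n| ≤
      harmonicNumber (n + 1) ^ (indexRev (.x :: w)).tail.length / (n : ℝ) ^ 2 := by
  obtain ⟨a, l, h, ha⟩ := exists_indexRev_x_cons hw
  rw [h, ← wordRev_indexRev hw, h, wordCoeff_wordRev_cons]
  exact truncSum_term_le ha l n

theorem hasSum_wordCoeff {w : List Letter} (hw : IsH1Word (.x :: w)) :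
    HasSum (wordCoeff (.x :: w)) (mzv (indexRev (.x :: w)).reverse) := by
  obtain ⟨a, l, h, ha⟩ := exists_indexRev_x_cons hw
  have := hasSum_mzv ha l
  rw [h]
  convert! this using 1
  funext n
  rw [← wordRev_indexRev hw, h, wordCoeff_wordRev_cons]

theorem head_of_mem_shuffleRev {u v h : List Letter} (hh : h ∈ shuffleRev (.x :: u) (.x :: v)) :
    ∃ w, h = .x :: w := by
  simp only [shuffleRev, List.mem_append, List.mem_map] at hh
  rcases hh with ⟨w, _, rfl⟩ | ⟨w, _, rfl⟩ <;> exact ⟨w, rfl⟩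

theorem hasSum_shuffleSum {u v : List Letter} {f : List Letter → ℕ → ℝ} {g : List Letter → ℝ}
    (h : ∀ w ∈ shuffleRev u v, HasSum (f w) (g w)) :
    HasSum (fun n => shuffleSum (fun w => f w n) u v) (shuffleSum g u v) := by
  unfold shuffleSum
  revert h
  induction shuffleRev u v with
  | nil => simp [hasSum_zero]
  | cons a l ih =>
    intro h
    simp only [List.map_cons, List.sum_cons]
    exact (h a (by simp)).add (ih fun w hw => h w (by simp [hw]))

/-- The shuffle product formula for convergent multiple zeta values. -/
theorem mzv_mul_mzv {u v : List Letter} (hu : IsH1Word (.x :: u)) (hv : IsH1Word (.x :: v)) :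
    mzv (indexRev (.x :: u)).reverse * mzv (indexRev (.x :: v)).reverse =
      shuffleSum (fun w => mzv (indexRev w).reverse) (.x :: u) (.x :: v) := by
  have h1 := hasSum_wordCoeff hu
  have h2 := hasSum_wordCoeff hv
  have habs : ∀ w, (fun n => ‖wordCoeff w n‖) = wordCoeff w := fun w =>
    funext fun n => Real.norm_of_nonneg (wordCoeff_nonneg w n)
  rw [← h1.tsum_eq, ← h2.tsum_eq, tsum_mul_tsum_eq_tsum_sum_antidiagonal_of_summable_norm
    (by rw [habs]; exact h1.summable) (by rw [habs]; exact h2.summable)]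
  have h3 := hasSum_shuffleSum (u := .x :: u) (v := .x :: v) (f := wordCoeff)
    (g := fun w => mzv (indexRev w).reverse) fun w hw => by
      obtain ⟨w, rfl⟩ := head_of_mem_shuffleRev hw
      exact hasSum_wordCoeff (isH1Word_of_mem_shuffleRev hu hv hw)
  rw [← h3.tsum_eq]
  refine tsum_congr fun n => ?_
  have h4 := congrArg (coeff n) (wordSeries_mul hu hv)
  rw [coeff_mul, map_shuffleSum] at h4
  simpa [wordSeries] using h4

/-- The shuffle product with `y`, for partial sums. -/
theorem shuffleSum_y_wordSum {w : List Letter} (hw : IsH1Word w) (N : ℕ) :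
    shuffleSum (fun h => wordSum h N) [.y] w =
      ∑ i ∈ Finset.range N, (i : ℝ)⁻¹ * wordSum w (N - i) := by
  have hy : IsH1Word [Letter.y] := by simp [IsH1Word]
  have h0 : ∀ i, wordCoeff [.y] i = (i : ℝ)⁻¹ := by
    intro i
    have := wordCoeff_wordRev_cons 1 [] i
    simpa [wordRev, truncSum] using this
  have h1 : ∀ n, shuffleSum (fun h => wordCoeff h n) [.y] w =
      ∑ i ∈ Finset.range (n + 1), (i : ℝ)⁻¹ * wordCoeff w (n - i) := by
    intro n
    have := congrArg (coeff n) (wordSeries_mul hy hw)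
    rw [coeff_mul, map_shuffleSum] at this
    simp only [wordSeries, coeff_mk, h0] at this
    rw [← this, Finset.Nat.sum_antidiagonal_eq_sum_range_succ fun i j => (i : ℝ)⁻¹ * wordCoeff w j]
  have h2 : shuffleSum (fun h => wordSum h N) [.y] w =
      ∑ n ∈ Finset.range N, shuffleSum (fun h => wordCoeff h n) [.y] w := by
    induction N with
    | zero => simp [wordSum, shuffleSum_zero]
    | succ N ih => simp only [wordSum_succ, shuffleSum_add, ih, Finset.sum_range_succ]
  rw [h2]
  simp only [h1, wordSum, Finset.mul_sum]
  exact Finset.sum_range_diag_flip N fun i j => (i : ℝ)⁻¹ * wordCoeff w j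

/-- The words arising from `w` by inserting `y` behind one of its letters. -/
def insertY : List Letter → List (List Letter)
  | [] => []
  | c :: w => (shuffleRev [.y] w).map (c :: ·)

theorem shuffleSum_y {M : Type*} [AddCommGroup M] [Module ℚ M] (F : List Letter → M)
    (w : List Letter) (s : ℕ) :
    shuffleSum F [.y] (List.replicate s .y ++ w) =
      (s + 1 : ℚ) • F (List.replicate (s + 1) .y ++ w) +
        ((insertY w).map fun h => F (List.replicate s .y ++ h)).sum := by
  induction s generalizing F with
  | zero =>
    cases w with
    | nil => simp [insertY]
    | cons c w =>
      rw [List.replicate_zero, List.nil_append, shuffleSum_cons_cons]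
      simp [insertY, shuffleSum, Function.comp_def, shuffleRev]
  | succ s ih =>
    rw [List.replicate_succ, List.cons_append, shuffleSum_cons_cons, ih]
    simp only [shuffleSum_nil_left, List.replicate_succ, List.cons_append]
    push_cast
    module

/-! ### Generating series over trailing ones -/

/-- `∏_{0 < n < N} (1 + X / n)`, the generating series of the truncated sums of `(1, …, 1)`. The
factor for `n = 0` is `1`. -/
def onesSeries (N : ℕ) : PowerSeries ℝ := ∏ n ∈ Finset.range N, (1 + C (n : ℝ)⁻¹ * X)

/-- The inverse of `onesSeries`. -/
def onesSeriesInv (N : ℕ) : PowerSeries ℝ :=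
  ∏ n ∈ Finset.range N, PowerSeries.mk fun s => (-(n : ℝ)⁻¹) ^ s

theorem coeff_C_mul_X_mul_succ (c : ℝ) (f : PowerSeries ℝ) (s : ℕ) :
    coeff (s + 1) (C c * X * f) = c * coeff s f := by
  rw [mul_assoc, coeff_C_mul, coeff_succ_X_mul]

theorem coeff_C_mul_X_mul_zero (c : ℝ) (f : PowerSeries ℝ) : coeff 0 (C c * X * f) = 0 := by
  rw [mul_assoc, coeff_C_mul, coeff_zero_X_mul, mul_zero]

theorem onesSeries_mul_inv (N : ℕ) : onesSeries N * onesSeriesInv N = 1 := by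
  rw [onesSeries, onesSeriesInv, ← Finset.prod_mul_distrib]
  refine Finset.prod_eq_one fun n _ => ?_
  ext s
  rw [add_mul, one_mul, map_add]
  cases s with
  | zero => rw [coeff_C_mul_X_mul_zero]; simp
  | succ s => rw [coeff_C_mul_X_mul_succ]; simp [coeff_one, pow_succ]; ring

theorem onesSeries_succ (N : ℕ) :
    onesSeries (N + 1) = onesSeries N + C (N : ℝ)⁻¹ * X * onesSeries N := by
  rw [onesSeries, Finset.prod_range_succ]; rw [onesSeries]; ring

theorem coeff_onesSeries (s N : ℕ) :
    coeff s (onesSeries N) = truncSum (List.replicate s 1) N := by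
  induction N generalizing s with
  | zero => cases s <;> simp [onesSeries, truncSum, List.replicate_succ, coeff_one]
  | succ N ih =>
    rw [onesSeries_succ, map_add]
    cases s with
    | zero => rw [coeff_C_mul_X_mul_zero, ih]; simp [truncSum]
    | succ s =>
      rw [coeff_C_mul_X_mul_succ, ih, ih, List.replicate_succ, truncSum_succ]
      simp

/-- The generating series of the partial sums attached to `y^s w`. -/
def trailingSeries (w : List Letter) (N : ℕ) : PowerSeries ℝ :=
  PowerSeries.mk fun s => wordSum (List.replicate s .y ++ w) N

theorem trailingSeries_succ (w : List Letter) (N : ℕ) :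
    trailingSeries w (N + 1) =
      trailingSeries w N + C (wordCoeff w N) + C (N : ℝ)⁻¹ * X * trailingSeries w N := by
  ext s
  rw [map_add, map_add]
  cases s with
  | zero => rw [coeff_C_mul_X_mul_zero]; simp [trailingSeries, wordSum_succ]
  | succ s =>
    rw [coeff_C_mul_X_mul_succ]
    simp [trailingSeries, wordSum_succ, List.replicate_succ, wordCoeff_y_cons]

theorem wordRev_replicate_one (s : ℕ) : wordRev (List.replicate s 1) = List.replicate s .y := by
  induction s with
  | zero => rfl
  | succ s ih => simp [List.replicate_succ, wordRev, ih]

theorem trailingSeries_nil {N : ℕ} (hN : N ≠ 0) : trailingSeries [] N = onesSeries N := by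
  ext s
  rw [coeff_onesSeries, trailingSeries, coeff_mk, List.append_nil, ← wordRev_replicate_one]
  cases s with
  | zero =>
    obtain ⟨N, rfl⟩ := Nat.exists_eq_succ_of_ne_zero hN
    simp [wordSum, wordRev, wordCoeff, truncSum]
  | succ s => exact wordSum_wordRev (by simp) N

/-- The quotient of `trailingSeries` by `onesSeries`. -/
def quotSeries (w : List Letter) (N : ℕ) : PowerSeries ℝ :=
  ∑ m ∈ Finset.range N, C (wordCoeff w m) * onesSeriesInv (m + 1)

theorem quotSeries_mul (w : List Letter) (N : ℕ) :
    quotSeries w N * onesSeries N = trailingSeries w N := by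
  induction N with
  | zero => ext s; simp [quotSeries, trailingSeries, wordSum]
  | succ N ih =>
    have h := onesSeries_mul_inv (N + 1)
    rw [quotSeries, Finset.sum_range_succ, ← quotSeries, trailingSeries_succ, ← ih, add_mul,
      mul_assoc (C _), mul_comm (onesSeriesInv _), h, onesSeries_succ]
    ring

/-- The shuffle product formula for `y` and `y^s w`, as an identity of generating series. -/
theorem sum_trailingSeries {w : List Letter} (hw : IsH1Word w) (N : ℕ) :
    ∑ i ∈ Finset.range N, C (i : ℝ)⁻¹ * trailingSeries w (N - i) =
      derivative ℝ (trailingSeries w N) + ((insertY w).map fun h => trailingSeries h N).sum := by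
  ext s
  have hw' : IsH1Word (List.replicate s .y ++ w) := by
    induction s with
    | zero => exact hw
    | succ s ih => exact isH1Word_y_cons.2 ih
  have h := shuffleSum_y_wordSum hw' N
  rw [shuffleSum_y] at h
  have e : ∀ L : List (List Letter), coeff s ((L.map fun h => trailingSeries h N).sum) =
      (L.map fun h => wordSum (List.replicate s .y ++ h) N).sum := by
    intro L
    rw [map_list_sum, List.map_map]
    simp [trailingSeries, Function.comp_def]
  rw [map_sum, map_add, e, coeff_derivative]
  simp only [coeff_C_mul]
  simp only [trailingSeries, coeff_mk, ← h]
  rw [Rat.smul_def]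
  push_cast
  ring

theorem sum_onesSeries (N : ℕ) :
    ∑ i ∈ Finset.range N, C (i : ℝ)⁻¹ * onesSeries (N - i) = derivative ℝ (onesSeries N) := by
  rcases Nat.eq_zero_or_pos N with rfl | hN
  · simp [onesSeries]
  · have h := sum_trailingSeries isH1Word_nil N
    rw [trailingSeries_nil hN.ne'] at h
    simp only [insertY, List.map_nil, List.sum_nil, add_zero] at h
    rw [← h]
    refine Finset.sum_congr rfl fun i hi => ?_
    rw [trailingSeries_nil (by have := Finset.mem_range.1 hi; omega)]

/-- The defect in the differential equation for the limit of `quotSeries`. -/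
theorem derivative_quotSeries {w : List Letter} (hw : IsH1Word w) (N : ℕ) :
    derivative ℝ (quotSeries w N) + ((insertY w).map fun h => quotSeries h N).sum =
      -∑ i ∈ Finset.range N, ∑ m ∈ Finset.Ico (N - i) N, C ((i : ℝ)⁻¹ * wordCoeff w m) *
        (onesSeriesInv (m + 1) * onesSeries (N - i) * onesSeriesInv N) := by
  have h1 := sum_trailingSeries hw N
  have h2 := sum_onesSeries N
  have h3 := onesSeries_mul_inv N
  simp only [← quotSeries_mul] at h1
  have e : ∀ L : List (List Letter), (L.map fun h => quotSeries h N * onesSeries N).sum =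
      (L.map fun h => quotSeries h N).sum * onesSeries N := by
    intro L
    exact List.sum_map_mul_right ..
  rw [e, Derivation.leibniz, ← h2, smul_eq_mul, smul_eq_mul, Finset.mul_sum] at h1
  have h4 : ∀ i ∈ Finset.range N, quotSeries w N - quotSeries w (N - i) =
      ∑ m ∈ Finset.Ico (N - i) N, C (wordCoeff w m) * onesSeriesInv (m + 1) := fun i _ => by
    rw [Finset.sum_Ico_eq_sub _ (Nat.sub_le N i)]; rfl
  have h5 : (∑ i ∈ Finset.range N, C (i : ℝ)⁻¹ * (quotSeries w N - quotSeries w (N - i)) *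
      onesSeries (N - i)) =
        ∑ i ∈ Finset.range N, quotSeries w N * (C (i : ℝ)⁻¹ * onesSeries (N - i)) -
        ∑ i ∈ Finset.range N, C (i : ℝ)⁻¹ * (quotSeries w (N - i) * onesSeries (N - i)) := by
    rw [← Finset.sum_sub_distrib]
    exact Finset.sum_congr rfl fun i _ => by ring
  have h6 : ∑ i ∈ Finset.range N, ∑ m ∈ Finset.Ico (N - i) N, C ((i : ℝ)⁻¹ * wordCoeff w m) *
        (onesSeriesInv (m + 1) * onesSeries (N - i) * onesSeriesInv N) =
      (∑ i ∈ Finset.range N, C (i : ℝ)⁻¹ * (quotSeries w N - quotSeries w (N - i)) *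
        onesSeries (N - i)) * onesSeriesInv N := by
    rw [Finset.sum_mul]
    refine Finset.sum_congr rfl fun i hi => ?_
    rw [h4 i hi, Finset.mul_sum, Finset.sum_mul, Finset.sum_mul]
    refine Finset.sum_congr rfl fun m _ => ?_
    rw [map_mul]
    ring
  rw [h6, h5, h1]
  linear_combination (-derivative ℝ (quotSeries w N) -
    ((insertY w).map fun h => quotSeries h N).sum) * h3

/-! ### Estimates -/

/-- The coefficients of `f` are bounded by the powers of `B`. -/
def CoeffBound (B : ℝ) (f : PowerSeries ℝ) : Prop := ∀ s, |coeff s f| ≤ B ^ s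

theorem CoeffBound.mono {B B' : ℝ} {f : PowerSeries ℝ} (h : CoeffBound B f) (hB : 0 ≤ B)
    (hBB' : B ≤ B') : CoeffBound B' f := fun s => (h s).trans (pow_le_pow_left₀ hB hBB' s)

theorem CoeffBound.mul {B B' : ℝ} {f g : PowerSeries ℝ} (hf : CoeffBound B f)
    (hg : CoeffBound B' g) (hB : 0 ≤ B) (hB' : 0 ≤ B') : CoeffBound (B + B') (f * g) := fun s => by
  rw [coeff_mul, (Commute.all B B').add_pow']
  refine (Finset.abs_sum_le_sum_abs _ _).trans (Finset.sum_le_sum fun p hp => ?_)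
  have hn : p.1 + p.2 = s := by simpa using hp
  have h1 : (1 : ℝ) ≤ s.choose p.1 := by
    exact_mod_cast Nat.choose_pos (by omega)
  rw [abs_mul, nsmul_eq_mul]
  calc |coeff p.1 f| * |coeff p.2 g| ≤ B ^ p.1 * B' ^ p.2 :=
        mul_le_mul (hf _) (hg _) (abs_nonneg _) (pow_nonneg hB _)
    _ ≤ _ := le_mul_of_one_le_left (by positivity) h1

theorem coeffBound_prod (f : ℕ → PowerSeries ℝ) (hf : ∀ n : ℕ, CoeffBound (n : ℝ)⁻¹ (f n)) (N : ℕ) :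
    CoeffBound (harmonicNumber N) (∏ n ∈ Finset.range N, f n) := by
  induction N with
  | zero =>
    intro s
    cases s <;> simp [coeff_one, harmonicNumber, truncSum]
  | succ N ih =>
    rw [Finset.prod_range_succ, harmonicNumber_succ]
    exact ih.mul (hf N) (harmonicNumber_nonneg N) (by positivity)

theorem coeffBound_onesSeries (N : ℕ) : CoeffBound (harmonicNumber N) (onesSeries N) := by
  refine coeffBound_prod _ (fun n s => ?_) N
  have h := coeff_C_mul_X_mul_succ (n : ℝ)⁻¹ 1
  rw [map_add]
  rcases s with _ | _ | s
  · simp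
  · have := h 0
    rw [mul_one] at this
    rw [this]
    simp [coeff_one]
  · have := h (s + 1)
    rw [mul_one] at this
    rw [this]
    simp [coeff_one]

theorem coeffBound_onesSeriesInv (N : ℕ) : CoeffBound (harmonicNumber N) (onesSeriesInv N) := by
  refine coeffBound_prod _ (fun n s => ?_) N
  rw [coeff_mk, abs_pow, abs_neg, abs_of_nonneg (by positivity)]

theorem sum_inv_mul_sum_inv_sq_le (N : ℕ) :
    ∑ i ∈ Finset.range N, (i : ℝ)⁻¹ * ∑ m ∈ Finset.Ico (N - i) N, ((m : ℝ) ^ 2)⁻¹ ≤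
      4 * harmonicNumber (N + 1) / N := by
  have h1 : ∀ i ∈ Finset.range N, (i : ℝ)⁻¹ * ∑ m ∈ Finset.Ico (N - i) N, ((m : ℝ) ^ 2)⁻¹ ≤
      2 / N * ((i : ℝ)⁻¹ + ((N - i : ℕ) : ℝ)⁻¹) := by
    intro i hi
    have hi := Finset.mem_range.1 hi
    have h2 : ∑ m ∈ Finset.Ico (N - i) N, ((m : ℝ) ^ 2)⁻¹ ≤ 2 * ((N - i : ℕ) : ℝ)⁻¹ := by
      have h3 := sum_Ioo_inv_sq_le (α := ℝ) (N - i - 1) N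
      have h4 : Finset.Ioo (N - i - 1) N = Finset.Ico (N - i) N := by
        ext m; simp; omega
      have h5 : ((N - i - 1 : ℕ) : ℝ) + 1 = ((N - i : ℕ) : ℝ) := by
        have : N - i - 1 + 1 = N - i := by omega
        exact_mod_cast this
      rwa [h4, h5, div_eq_mul_inv] at h3
    refine (mul_le_mul_of_nonneg_left h2 (by positivity)).trans ?_
    rcases Nat.eq_zero_or_pos i with rfl | hi0
    · simp only [Nat.cast_zero, inv_zero, zero_mul]
      positivity
    · have h6 : (0 : ℝ) < i := by exact_mod_cast hi0
      have h7 : (0 : ℝ) < ((N - i : ℕ) : ℝ) := by exact_mod_cast (by omega : 0 < N - i)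
      have h8 : (N : ℝ) = i + ((N - i : ℕ) : ℝ) := by
        rw [Nat.cast_sub hi.le]; ring
      rw [h8]
      apply le_of_eq
      field_simp
      ring
  have h2 : ∑ i ∈ Finset.range N, ((N - i : ℕ) : ℝ)⁻¹ ≤ harmonicNumber (N + 1) := by
    rw [harmonicNumber_eq_sum, Finset.sum_range_succ', ← Finset.sum_range_reflect]
    simp only [Nat.cast_zero, inv_zero, add_zero]
    apply le_of_eq
    refine Finset.sum_congr rfl fun i hi => ?_
    have hi := Finset.mem_range.1 hi
    congr 2
    omega
  have h3 : ∑ i ∈ Finset.range N, (i : ℝ)⁻¹ ≤ harmonicNumber (N + 1) := by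
    rw [← harmonicNumber_eq_sum]
    exact truncSum_mono [1] (Nat.le_succ N)
  calc _ ≤ ∑ i ∈ Finset.range N, 2 / N * ((i : ℝ)⁻¹ + ((N - i : ℕ) : ℝ)⁻¹) := Finset.sum_le_sum h1
    _ = 2 / N * (∑ i ∈ Finset.range N, (i : ℝ)⁻¹ + ∑ i ∈ Finset.range N, ((N - i : ℕ) : ℝ)⁻¹) := by
        rw [← Finset.mul_sum, Finset.sum_add_distrib]
    _ ≤ 2 / N * (harmonicNumber (N + 1) + harmonicNumber (N + 1)) := by gcongr
    _ = _ := by ring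

/-- The defect in `derivative_quotSeries` tends to zero: it is `O((log N)^J / N)` for some `J`,
since `wordCoeff` is `O((log m)^d / m²)`. -/
theorem tendsto_derivative_quotSeries {w : List Letter} (hw : IsH1Word (.x :: w)) (s : ℕ) :
    Tendsto (fun N => coeff s (derivative ℝ (quotSeries (.x :: w) N) +
      ((insertY (.x :: w)).map fun h => quotSeries h N).sum)) atTop (nhds 0) := by
  set d := (indexRev (.x :: w)).tail.length with hd
  have h0 : Tendsto (fun N : ℕ => 4 * 3 ^ s * (harmonicNumber (N + 1) ^ (d + s + 1) / N)) atTop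
      (nhds 0) := by
    simpa using (tendsto_harmonicNumber_pow_div (d + s + 1)).const_mul (4 * 3 ^ s)
  refine squeeze_zero_norm (fun N => ?_) h0
  rw [derivative_quotSeries hw, map_neg, norm_neg, map_sum]
  set T := harmonicNumber (N + 1) with hT
  have hT0 : 0 ≤ T := harmonicNumber_nonneg _
  have h1 : ∀ i ∈ Finset.range N, |coeff s (∑ m ∈ Finset.Ico (N - i) N,
      C ((i : ℝ)⁻¹ * wordCoeff (.x :: w) m) *
        (onesSeriesInv (m + 1) * onesSeries (N - i) * onesSeriesInv N))| ≤
      T ^ d * (3 * T) ^ s * ((i : ℝ)⁻¹ * ∑ m ∈ Finset.Ico (N - i) N, ((m : ℝ) ^ 2)⁻¹) := by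
    intro i hi
    rw [map_sum, Finset.mul_sum, Finset.mul_sum]
    refine (Finset.abs_sum_le_sum_abs _ _).trans (Finset.sum_le_sum fun m hm => ?_)
    have hm := Finset.mem_Ico.1 hm
    have hmono : ∀ M, M ≤ N + 1 → harmonicNumber M ≤ T := fun M hM => truncSum_mono [1] hM
    have h2 := (((coeffBound_onesSeriesInv (m + 1)).mono (harmonicNumber_nonneg _)
      (hmono _ (by omega))).mul ((coeffBound_onesSeries (N - i)).mono (harmonicNumber_nonneg _)
      (hmono _ (by omega))) hT0 hT0).mul ((coeffBound_onesSeriesInv N).mono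
      (harmonicNumber_nonneg _) (hmono _ (by omega))) (by positivity) hT0 s
    have h3 : T + T + T = 3 * T := by ring
    rw [h3] at h2
    have h4 : |wordCoeff (.x :: w) m| ≤ T ^ d * ((m : ℝ) ^ 2)⁻¹ := by
      refine (abs_wordCoeff_le hw m).trans ?_
      rw [div_eq_mul_inv]
      have := hmono (m + 1) (by omega)
      have h5 := harmonicNumber_nonneg (m + 1)
      gcongr
    rw [coeff_C_mul, abs_mul, abs_mul, abs_of_nonneg (by positivity : (0 : ℝ) ≤ (i : ℝ)⁻¹)]
    calc _ ≤ (i : ℝ)⁻¹ * (T ^ d * ((m : ℝ) ^ 2)⁻¹) * (3 * T) ^ s := by gcongr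
      _ = _ := by ring
  calc ‖∑ i ∈ Finset.range N, coeff s (∑ m ∈ Finset.Ico (N - i) N,
        C ((i : ℝ)⁻¹ * wordCoeff (.x :: w) m) *
        (onesSeriesInv (m + 1) * onesSeries (N - i) * onesSeriesInv N))‖
      ≤ ∑ i ∈ Finset.range N,
        T ^ d * (3 * T) ^ s * ((i : ℝ)⁻¹ * ∑ m ∈ Finset.Ico (N - i) N, ((m : ℝ) ^ 2)⁻¹) :=
        (Finset.abs_sum_le_sum_abs _ _).trans (Finset.sum_le_sum h1)
    _ ≤ T ^ d * (3 * T) ^ s * (4 * T / N) := by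
        rw [← Finset.mul_sum]
        exact mul_le_mul_of_nonneg_left (sum_inv_mul_sum_inv_sq_le N) (by positivity)
    _ = _ := by rw [mul_pow, pow_add, pow_add]; ring

/-! ### Comparison of the two regularizations -/

/-- The coefficients of the limit of `quotSeries`. For admissible `w` they turn out to be the
shuffle regularized values at `y^s w`, see `regWord_shuffle_eq`. -/
def limitCoeff (w : List Letter) (s : ℕ) : ℝ :=
  ∑' m, wordCoeff w m * coeff s (onesSeriesInv (m + 1))

theorem abs_quotSeries_term_le {w : List Letter} (hw : IsH1Word (.x :: w)) (s n : ℕ) :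
    |wordCoeff (.x :: w) n * coeff s (onesSeriesInv (n + 1))| ≤
      harmonicNumber (n + 1) ^ ((indexRev (.x :: w)).tail.length + s) / (n : ℝ) ^ 2 := by
  rw [abs_mul, pow_add, mul_div_right_comm]
  exact mul_le_mul (abs_wordCoeff_le hw n) (coeffBound_onesSeriesInv (n + 1) s) (abs_nonneg _)
    (div_nonneg (pow_nonneg (harmonicNumber_nonneg _) _) (by positivity))

theorem negligible_quotSeries {w : List Letter} (hw : IsH1Word (.x :: w)) (s : ℕ) :
    Negligible fun N => coeff s (quotSeries (.x :: w) N) - limitCoeff (.x :: w) s := by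
  have h := negligible_tail _ (abs_quotSeries_term_le hw s)
  refine cast (congrArg Negligible (funext fun N => ?_)) h
  simp [quotSeries, limitCoeff]

theorem tendsto_quotSeries {w : List Letter} (hw : IsH1Word (.x :: w)) (s : ℕ) :
    Tendsto (fun N => coeff s (quotSeries (.x :: w) N)) atTop (nhds (limitCoeff (.x :: w) s)) := by
  have h := negligible_quotSeries hw s 0
  simpa using h.add_const (limitCoeff (.x :: w) s)

theorem mem_insertY_x {w h : List Letter} (hw : IsH1Word (.x :: w))
    (hh : h ∈ insertY (.x :: w)) : ∃ v, h = .x :: v ∧ IsH1Word (.x :: v) := by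
  simp only [insertY, List.mem_map] at hh
  obtain ⟨v, hv, rfl⟩ := hh
  exact ⟨v, rfl, (isH1Word_cons (mem_shuffleRev_ne_nil hv (by simp))).2
    (isH1Word_of_mem_shuffleRev (by simp [IsH1Word]) (isH1Word_of_cons hw) hv)⟩

/-- The limit satisfies the relations that the shuffle product with `y` imposes on the shuffle
regularized values. -/
theorem limitCoeff_succ {w : List Letter} (hw : IsH1Word (.x :: w)) (s : ℕ) :
    (s + 1) * limitCoeff (.x :: w) (s + 1) +
      ((insertY (.x :: w)).map fun h => limitCoeff h s).sum = 0 := by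
  refine tendsto_nhds_unique ?_ (tendsto_derivative_quotSeries hw s)
  simp only [map_add, coeff_derivative]
  refine Tendsto.add ?_ ?_
  · rw [mul_comm]
    exact (tendsto_quotSeries hw (s + 1)).mul_const _
  · simp only [map_list_sum, List.map_map, Function.comp_def]
    have h : ∀ v ∈ insertY (.x :: w),
        Tendsto (fun N => coeff s (quotSeries v N)) atTop (nhds (limitCoeff v s)) := by
      intro v hv
      obtain ⟨v, rfl, hv'⟩ := mem_insertY_x hw hv
      exact tendsto_quotSeries hv' s
    revert h
    induction insertY (.x :: w) with
    | nil => simp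
    | cons a l ih =>
      intro h
      simp only [List.map_cons, List.sum_cons]
      exact (h a (by simp)).add (ih fun v hv => h v (by simp [hv]))

theorem limitCoeff_zero {w : List Letter} (hw : IsH1Word (.x :: w)) :
    limitCoeff (.x :: w) 0 = mzv (indexRev (.x :: w)).reverse := by
  rw [← (hasSum_wordCoeff hw).tsum_eq, limitCoeff]
  refine tsum_congr fun m => ?_
  have : coeff 0 (onesSeriesInv (m + 1)) = 1 := by
    rw [coeff_zero_eq_constantCoeff_apply, onesSeriesInv, map_prod]
    refine Finset.prod_eq_one fun n _ => ?_
    rw [← coeff_zero_eq_constantCoeff_apply, coeff_mk, pow_zero]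
  rw [this, mul_one]

/-- The regularized value at a reversed word. -/
def regWord (b : Bullet) (w : List Letter) : ℝ := regMZV₀ b (indexRev w).reverse

theorem shuffleSum_y_regWord {w : List Letter} (hw : IsH1Word w) :
    shuffleSum (regWord .shuffle) [.y] w = 0 := by
  have h := congrArg (Polynomial.eval 0) (sum_regMZV_one_mul .shuffle
    (k := (1 :: indexRev w).reverse) (by rw [trailingOnes_reverse_cons]; simp))
  rw [eval_list_sum_map, Polynomial.eval_mul, Polynomial.eval_X, zero_mul, List.reverse_cons,
    List.dropLast_concat] at h
  rw [← h]
  simp [Bullet.mul, shuffleSum, wordRev_indexRev hw, wordRev, Function.comp_def]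
  rfl

theorem trailingOnes_indexRev_x {w : List Letter} (hw : IsH1Word (.x :: w)) :
    trailingOnes (indexRev (.x :: w)).reverse = 0 := by
  obtain ⟨a, l, h, ha⟩ := exists_indexRev_x_cons hw
  rw [h, trailingOnes_reverse_cons, if_neg]
  rintro rfl
  exact absurd ha (by decide)

theorem regWord_of_x (b : Bullet) {w : List Letter} (hw : IsH1Word (.x :: w)) :
    regWord b (.x :: w) = mzv (indexRev (.x :: w)).reverse := by
  rw [regWord, regMZV₀, regMZV_of_trailingOnes_eq_zero _ (trailingOnes_indexRev_x hw),
    Polynomial.eval_C]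

theorem isH1Word_replicate_y_append (s : ℕ) {w : List Letter} (hw : IsH1Word w) :
    IsH1Word (List.replicate s .y ++ w) := by
  induction s with
  | zero => exact hw
  | succ s ih => exact isH1Word_y_cons.2 ih

theorem regWord_shuffle_eq {w : List Letter} (hw : IsH1Word (.x :: w)) (s : ℕ) :
    regWord .shuffle (List.replicate s .y ++ .x :: w) = limitCoeff (.x :: w) s := by
  induction s generalizing w with
  | zero => rw [limitCoeff_zero hw, List.replicate_zero, List.nil_append, regWord_of_x _ hw]
  | succ s ih =>
    have h1 := shuffleSum_y_regWord (isH1Word_replicate_y_append s hw)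
    have h2 := limitCoeff_succ hw s
    rw [shuffleSum_y, Rat.smul_def] at h1
    have h3 : ((insertY (.x :: w)).map fun h => regWord .shuffle (List.replicate s .y ++ h)).sum =
        ((insertY (.x :: w)).map fun h => limitCoeff h s).sum := by
      refine congrArg List.sum (List.map_congr_left fun h hh => ?_)
      obtain ⟨v, rfl, hv⟩ := mem_insertY_x hw hh
      exact ih hv
    rw [h3, ← h2] at h1
    push_cast at h1
    exact mul_left_cancel₀ (by positivity : (s + 1 : ℝ) ≠ 0) (add_right_cancel h1)

theorem regWord_shuffle_replicate_y (s : ℕ) :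
    regWord .shuffle (List.replicate (s + 1) .y) = 0 := by
  have h1 := shuffleSum_y_regWord (isH1Word_replicate_y_append s isH1Word_nil)
  rw [shuffleSum_y, Rat.smul_def] at h1
  simp only [insertY, List.map_nil, List.sum_nil, add_zero, List.append_nil, mul_eq_zero] at h1
  refine h1.resolve_left ?_
  push_cast
  positivity

theorem regWord_nil (b : Bullet) : regWord b [] = 1 := by
  rw [regWord, regMZV₀]
  have : indexRev [] = [] := rfl
  rw [this, List.reverse_nil, regMZV_of_trailingOnes_eq_zero _ (by simp [trailingOnes]), mzv_nil]
  simp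

theorem indexRev_replicate_y_append (s : ℕ) (w : List Letter) :
    indexRev (List.replicate s .y ++ w) = List.replicate s 1 ++ indexRev w := by
  induction s with
  | zero => rfl
  | succ s ih => simp [List.replicate_succ, indexRev, ih]

/-- The comparison of the two regularizations: `ζ^*(v y^s) = ∑_i ζ^ш(v y^i) ζ^*(y^{s-i})`, if `v` is
empty or ends in `x`. -/
theorem regWord_harmonic_eq {w : List Letter} (hw : IsH1Word w) (hw' : ∀ a ∈ w.head?, a = .x)
    (s : ℕ) : regWord .harmonic (List.replicate s .y ++ w) =
      ∑ p ∈ Finset.HasAntidiagonal.antidiagonal s, regWord .shuffle (List.replicate p.1 .y ++ w) *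
        regMZV₀ .harmonic (List.replicate p.2 1) := by
  cases w with
  | nil =>
    rw [Finset.sum_eq_single (0, s)]
    · simp [regWord_nil]
      have := indexRev_replicate_y_append s []
      simp [indexRev] at this
      simp [regWord, this]
    · rintro ⟨i, j⟩ hp hne
      cases i with
      | zero =>
        have : 0 + j = s := by simpa using hp
        exact absurd (by simpa using this) hne
      | succ i => rw [List.append_nil, regWord_shuffle_replicate_y, zero_mul]
    · simp
  | cons a w =>
    obtain rfl : a = .x := hw' a (by simp)
    suffices h : regMZV .harmonic (indexRev (List.replicate s .y ++ .x :: w)).reverse =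
        ∑ p ∈ Finset.HasAntidiagonal.antidiagonal s, Polynomial.C (limitCoeff (.x :: w) p.1) *
          regMZV .harmonic (List.replicate p.2 1) by
      rw [regWord, regMZV₀, h, Polynomial.eval_finsetSum]
      refine Finset.sum_congr rfl fun p _ => ?_
      rw [regWord_shuffle_eq hw, Polynomial.eval_mul, Polynomial.eval_C, regMZV₀]
    rw [← sub_eq_zero]
    refine eq_zero_of_negligible_eval _ ?_
    have h1 := negligible_truncSum_sub_eval (indexRev (List.replicate s .y ++ .x :: w)).reverse
    have h2 := negligible_sum (Finset.HasAntidiagonal.antidiagonal s) (fun p N =>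
        truncSum (List.replicate p.2 1) N * (coeff p.1 (quotSeries (.x :: w) N) -
          limitCoeff (.x :: w) p.1)) fun p _ =>
      (negligible_quotSeries hw p.1).mul_of_abs_le p.2 fun N => by
        rw [abs_of_nonneg (truncSum_nonneg _ _)]
        simpa using truncSum_le_pow (List.replicate p.2 1) N
    have h3 := negligible_sum (Finset.HasAntidiagonal.antidiagonal s)
      (fun p N => limitCoeff (.x :: w) p.1 *
        (truncSum (List.replicate p.2 1) N -
          (regMZV .harmonic (List.replicate p.2 1)).eval (harmonicNumber N))) fun p _ => by
      have := negligible_truncSum_sub_eval (List.replicate p.2 1)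
      rw [List.reverse_replicate] at this
      exact this.const_mul _
    refine cast (congrArg Negligible (funext fun N => ?_)) ((h2.add h3).sub h1)
    have hv := isH1Word_replicate_y_append s hw
    have h4 : truncSum (indexRev (List.replicate s .y ++ .x :: w)) N =
        ∑ p ∈ Finset.HasAntidiagonal.antidiagonal s, coeff p.1 (quotSeries (.x :: w) N) *
          truncSum (List.replicate p.2 1) N := by
      have h5 := congrArg (coeff s) (quotSeries_mul (.x :: w) N)
      rw [coeff_mul, trailingSeries, coeff_mk, ← wordRev_indexRev hv, wordSum_wordRev] at h5
      · simp only [coeff_onesSeries] at h5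
        exact h5.symm
      · obtain ⟨a, l, h, _⟩ := exists_indexRev_x_cons hw
        rw [indexRev_replicate_y_append, h]
        simp
    rw [List.reverse_reverse, h4, Polynomial.eval_sub, Polynomial.eval_finsetSum]
    simp only [Polynomial.eval_mul, Polynomial.eval_C]
    rw [← Finset.sum_add_distrib]
    have : ∀ a b c : ℝ, a - (b - c) = c - (b - a) := by intros; ring
    rw [this]
    congr 1
    rw [← Finset.sum_sub_distrib]
    exact Finset.sum_congr rfl fun p _ => by ring

/-! ### The shuffle product of shuffle regularized values -/

theorem exists_eq_replicate_y_append {w : List Letter} (hw : IsH1Word w) :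
    ∃ (s : ℕ) (v : List Letter), IsH1Word v ∧ (∀ a ∈ v.head?, a = .x) ∧
      w = List.replicate s .y ++ v := by
  induction w with
  | nil => exact ⟨0, [], isH1Word_nil, by simp, rfl⟩
  | cons c w ih =>
    cases c with
    | x => exact ⟨0, .x :: w, hw, by simp, rfl⟩
    | y =>
      obtain ⟨s, v, hv, hv', rfl⟩ := ih (isH1Word_of_cons hw)
      exact ⟨s + 1, v, hv, hv', rfl⟩

/-- If `ζ^ш` is multiplicative on products of `v` with admissible words, then also on products of
`v` with arbitrary words of `𝔥¹`, because `ζ^ш` vanishes on the ideal generated by `y`. -/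
theorem regWord_mul_of_forall {v : List Letter} (hv : IsH1Word v)
    (h : ∀ u, IsH1Word u → (∀ a ∈ u.head?, a = Letter.x) →
      regWord .shuffle u * regWord .shuffle v = shuffleSum (regWord .shuffle) u v)
    {u : List Letter} (hu : IsH1Word u) :
    regWord .shuffle u * regWord .shuffle v = shuffleSum (regWord .shuffle) u v := by
  obtain ⟨s, u, hu₁, hu', rfl⟩ := exists_eq_replicate_y_append hu
  clear hu
  induction s generalizing u with
  | zero => exact h u hu₁ hu'
  | succ s ih =>
    have h1 := shuffleSum_assoc (regWord .shuffle) [.y] (List.replicate s .y ++ u) v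
    have hyu := isH1Word_replicate_y_append s hu₁
    rw [shuffleSum_y, shuffleSum_congr (u := List.replicate s Letter.y ++ u) (v := v)
      (F := fun w => shuffleSum (regWord .shuffle) [Letter.y] w) (G := fun _ => 0)
      (fun w hw => shuffleSum_y_regWord (isH1Word_of_mem_shuffleRev hyu hv hw)),
      shuffleSum_zero] at h1
    have h2 := shuffleSum_y_regWord hyu
    rw [shuffleSum_y] at h2
    have h3 : (insertY u).map
        (fun h => shuffleSum (regWord .shuffle) (List.replicate s .y ++ h) v) =
        (insertY u).map fun h => regWord .shuffle (List.replicate s .y ++ h) *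
          regWord .shuffle v := by
      refine List.map_congr_left fun w hw => ?_
      cases u with
      | nil => simp [insertY] at hw
      | cons a u =>
        obtain rfl : a = .x := hu' a (by simp)
        obtain ⟨w, rfl, hw'⟩ := mem_insertY_x hu₁ hw
        exact (ih _ hw' (by simp)).symm
    rw [h3, List.sum_map_mul_right] at h1
    have h4 := congrArg (· * regWord .shuffle v) h2
    simp only [Rat.smul_def, add_mul, zero_mul] at h1 h4
    rw [← h4, mul_assoc] at h1
    refine mul_left_cancel₀ (?_ : (((s + 1 : ℚ) : ℝ)) ≠ 0) (add_right_cancel h1).symm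
    push_cast
    positivity

/-- `ζ^ш` is multiplicative for the shuffle product. -/
theorem regWord_shuffle_mul {u v : List Letter} (hu : IsH1Word u) (hv : IsH1Word v) :
    regWord .shuffle u * regWord .shuffle v = shuffleSum (regWord .shuffle) u v := by
  refine regWord_mul_of_forall hv (fun u hu hu' => ?_) hu
  rw [mul_comm, shuffleSum_comm]
  refine regWord_mul_of_forall hu (fun v hv hv' => ?_) hv
  cases u with
  | nil => rw [regWord_nil, mul_one, shuffleSum_nil_right]
  | cons a u =>
    obtain rfl : a = .x := hu' a (by simp)
    cases v with
    | nil => rw [regWord_nil, one_mul, shuffleSum_nil_left]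
    | cons b v =>
      obtain rfl : b = .x := hv' b (by simp)
      rw [regWord_of_x _ hu, regWord_of_x _ hv, mzv_mul_mzv hv hu]
      refine shuffleSum_congr fun w hw => ?_
      obtain ⟨w', rfl⟩ := head_of_mem_shuffleRev hw
      rw [regWord_of_x _ (isH1Word_of_mem_shuffleRev hv hu hw)]

/-! ### Convolution of functions on indices -/

section Convolution

variable {A : Type*} [CommRing A]

/-- The convolution of two functions on lists with respect to deconcatenation: the sum of
`f q * g p` over all ways to write a list as `q ++ p`. -/
def conv (f g : List ℕ+ → A) : List ℕ+ → A
  | [] => f [] * g []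
  | a :: u => f [] * g (a :: u) + conv (fun q => f (a :: q)) g u

theorem conv_add_left (f f' g : List ℕ+ → A) (u : List ℕ+) :
    conv (fun q => f q + f' q) g u = conv f g u + conv f' g u := by
  induction u generalizing f f' with
  | nil => simp [conv, add_mul]
  | cons a u ih => simp only [conv, ih]; ring

theorem conv_add_right (f g g' : List ℕ+ → A) (u : List ℕ+) :
    conv f (fun p => g p + g' p) u = conv f g u + conv f g' u := by
  induction u generalizing f with
  | nil => simp [conv, mul_add]
  | cons a u ih => simp only [conv, ih]; ring

theorem conv_mul_left (c : A) (f g : List ℕ+ → A) (u : List ℕ+) :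
    conv (fun q => c * f q) g u = c * conv f g u := by
  induction u generalizing f with
  | nil => simp [conv, mul_assoc]
  | cons a u ih => simp only [conv, ih]; ring

theorem conv_mul_right (c : A) (f g : List ℕ+ → A) (u : List ℕ+) :
    conv f (fun p => c * g p) u = c * conv f g u := by
  induction u generalizing f with
  | nil => simp [conv]; ring
  | cons a u ih => simp only [conv, ih]; ring

theorem conv_zero_left (g : List ℕ+ → A) (u : List ℕ+) : conv (fun _ => 0) g u = 0 := by
  induction u with
  | nil => simp [conv]
  | cons a u ih => simp [conv, ih]

theorem conv_mem {S : Type*} [SetLike S A] [AddSubmonoidClass S A] {s : S} {f g : List ℕ+ → A}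
    {u : List ℕ+} (h : ∀ q p, q ++ p = u → f q * g p ∈ s) : conv f g u ∈ s := by
  induction u generalizing f with
  | nil => exact h [] [] rfl
  | cons a u ih => exact add_mem (h [] (a :: u) rfl) (ih fun q p hu => h (a :: q) p (by simp [hu]))

theorem conv_congr {f f' g g' : List ℕ+ → A} {u : List ℕ+}
    (h : ∀ q p, q ++ p = u → f q * g p = f' q * g' p) : conv f g u = conv f' g' u := by
  induction u generalizing f f' with
  | nil => exact h [] [] rfl
  | cons a u ih =>
    rw [conv, conv, h [] (a :: u) rfl, ih fun q p hu => h (a :: q) p (by simp [hu])]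

theorem conv_assoc (f g h : List ℕ+ → A) (u : List ℕ+) :
    conv (conv f g) h u = conv f (conv g h) u := by
  induction u generalizing f g with
  | nil => simp [conv, mul_assoc]
  | cons a u ih => simp only [conv, conv_add_left, conv_mul_left, ih]; ring

theorem conv_append_singleton (f g : List ℕ+ → A) (u : List ℕ+) (a : ℕ+) :
    conv f g (u ++ [a]) = conv f (fun p => g (p ++ [a])) u + f (u ++ [a]) * g [] := by
  induction u generalizing f with
  | nil => simp [conv]
  | cons b u ih => simp only [List.cons_append, conv, ih]; ring

theorem conv_reverse (f g : List ℕ+ → A) (u : List ℕ+) :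
    conv f g u.reverse = conv (fun q => g q.reverse) (fun p => f p.reverse) u := by
  induction u generalizing g with
  | nil => simp [conv, mul_comm]
  | cons a u ih =>
    rw [List.reverse_cons, conv_append_singleton, conv, ih]
    simp only [List.reverse_cons, List.reverse_nil]
    ring

theorem conv_eq_sum (f g : List ℕ+ → A) (u : List ℕ+) :
    conv f g u = ∑ i ∈ Finset.range (u.length + 1), f (u.take i) * g (u.drop i) := by
  induction u generalizing f with
  | nil => simp [conv]
  | cons a u ih =>
    rw [List.length_cons, Finset.sum_range_succ', conv, ih]
    simp [add_comm]

/-- A function with value `1` at the empty list is cancellable for the convolution. -/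
theorem eq_zero_of_conv_eq_zero {f g : List ℕ+ → A} (hf : f [] = 1) (h : ∀ u, conv f g u = 0)
    (u : List ℕ+) : g u = 0 := by
  induction hn : u.length using Nat.strong_induction_on generalizing u with
  | _ n ih =>
    have h1 := h u
    cases u with
    | nil => simpa [conv, hf] using h1
    | cons a u =>
      rw [conv, hf, one_mul, conv_congr (f' := fun _ => 0) (g' := g), conv_zero_left,
        add_zero] at h1
      · exact h1
      · rintro q p rfl
        rw [ih p.length _ p rfl, mul_zero, zero_mul]
        rw [← hn]
        simp

theorem conv_one_left {f : List ℕ+ → A} (hf : ∀ q, f q = if q = [] then 1 else 0)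
    (g : List ℕ+ → A) (u : List ℕ+) : conv f g u = g u := by
  cases u with
  | nil => simp [conv, hf]
  | cons a u =>
    have : (fun q => f (a :: q)) = fun _ => 0 := funext fun q => by simp [hf]
    rw [conv, this, conv_zero_left, hf]
    simp

theorem conv_one_right (f : List ℕ+ → A) {g : List ℕ+ → A}
    (hg : ∀ p, g p = if p = [] then 1 else 0) (u : List ℕ+) : conv f g u = f u := by
  induction u generalizing f with
  | nil => simp [conv, hg]
  | cons a u ih => simp [conv, hg, ih]

/-- The two extreme terms of a convolution, up to the other ones. -/
theorem conv_sub_mem {S : Type*} [SetLike S A] [AddSubmonoidClass S A] {s : S} {f g : List ℕ+ → A}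
    {u : List ℕ+} (hu : u ≠ []) (h : ∀ q p, q ≠ [] → p ≠ [] → q ++ p = u → f q * g p ∈ s) :
    conv f g u - (f [] * g u + f u * g []) ∈ s := by
  obtain ⟨a, u, rfl⟩ := List.exists_cons_of_ne_nil hu
  have h1 : g = fun p => g [] * (if p = [] then 1 else 0) + if p = [] then 0 else g p := by
    funext p
    by_cases hp : p = [] <;> simp [hp]
  have h2 : conv f g (a :: u) = f [] * g (a :: u) + (g [] * f (a :: u) +
      conv (fun q => f (a :: q)) (fun p => if p = [] then 0 else g p) u) := by
    rw [conv]
    conv_lhs => rw [h1]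
    rw [conv_add_right, conv_mul_right, conv_one_right _ fun _ => rfl]
    simp
  rw [h2, mul_comm (g [])]
  have h3 : ∀ x y z : A, x + (y + z) - (x + y) = z := fun x y z => by ring
  rw [h3]
  refine conv_mem fun q p hu => ?_
  by_cases hp : p = []
  · simp [hp, zero_mem]
  · rw [if_neg hp]
    exact h (a :: q) p (by simp) hp (by simp [hu])

end Convolution

/-! ### Compatibility of the harmonic product with convolution and reversal -/

section Harmonic

theorem map_harmonicSum {M M' G : Type*} [AddCommGroup M] [AddCommGroup M'] [FunLike G M M']
    [AddMonoidHomClass G M M'] (φ : G) (F : List ℕ+ → M) (u v : List ℕ+) :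
    φ (harmonicSum F u v) = harmonicSum (fun h => φ (F h)) u v := by
  simp [harmonicSum, map_list_sum, Function.comp_def]

theorem harmonicSum_congr {M : Type*} [AddCommGroup M] {F G : List ℕ+ → M} {u v : List ℕ+}
    (h : ∀ w ∈ harmonicRev u v, F w = G w) : harmonicSum F u v = harmonicSum G u v := by
  unfold harmonicSum
  rw [List.map_congr_left h]

theorem wt_of_mem_harmonicRev {u v h : List ℕ+} (hh : h ∈ harmonicRev u v) :
    wt h = wt u + wt v := by
  induction u generalizing v h with
  | nil => simp [harmonicRev] at hh; simp [hh, wt]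
  | cons a u ihu =>
    induction v generalizing h with
    | nil => simp [harmonicRev] at hh; simp [hh, wt]
    | cons b v ihv =>
      simp only [harmonicRev, List.mem_append, List.mem_map] at hh
      rcases hh with (⟨t, ht, rfl⟩ | ⟨t, ht, rfl⟩) | ⟨t, ht, rfl⟩
      · rw [wt_cons, ihu ht, wt_cons, wt_cons]; ring
      · rw [wt_cons, ihv ht, wt_cons, wt_cons]; ring
      · rw [wt_cons, ihu ht, wt_cons, wt_cons, PNat.add_coe]; ring

theorem harmonicSum_append_singleton {M : Type*} [AddCommGroup M] (F : List ℕ+ → M) (a b : ℕ+)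
    (u v : List ℕ+) : harmonicSum F (u ++ [a]) (v ++ [b]) =
      harmonicSum (fun h => F (h ++ [a])) u (v ++ [b]) +
        harmonicSum (fun h => F (h ++ [b])) (u ++ [a]) v +
        harmonicSum (fun h => F (h ++ [a + b])) u v := by
  induction u generalizing F v with
  | nil =>
    induction v generalizing F with
    | nil =>
      simp [harmonicSum_cons_cons]
      abel
    | cons c v ihv =>
      have h := ihv fun h => F (c :: h)
      simp only [List.nil_append, List.cons_append, harmonicSum_cons_cons,
        harmonicSum_nil_left] at h ⊢
      rw [h]
      abel
  | cons d u ihu =>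
    induction v generalizing F with
    | nil =>
      have h := ihu (fun h => F (d :: h)) []
      simp only [List.nil_append, List.cons_append, harmonicSum_cons_cons,
        harmonicSum_nil_right] at h ⊢
      rw [h]
      abel
    | cons c v ihv =>
      have h1 := ihv fun h => F (c :: h)
      have h2 := ihu (fun h => F (d :: h)) (c :: v)
      have h3 := ihu (fun h => F ((d + c) :: h)) v
      simp only [List.cons_append] at h1 h2 h3
      simp only [List.cons_append, harmonicSum_cons_cons, h1, h2, h3]
      abel

/-- The harmonic product is compatible with the reversal of indices. -/
theorem harmonicSum_reverse {M : Type*} [AddCommGroup M] (F : List ℕ+ → M) (u v : List ℕ+) :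
    harmonicSum F u.reverse v.reverse = harmonicSum (fun h => F h.reverse) u v := by
  induction u generalizing F v with
  | nil => simp
  | cons a u ihu =>
    induction v generalizing F with
    | nil => simp
    | cons b v ihv =>
      have h1 := ihu (fun h => F (h ++ [a])) (b :: v)
      have h2 := ihv fun h => F (h ++ [b])
      have h3 := ihu (fun h => F (h ++ [a + b])) v
      simp only [List.reverse_cons] at h1 h2 h3
      simp only [List.reverse_cons, harmonicSum_append_singleton, harmonicSum_cons_cons, h1, h2, h3]

variable {A : Type*} [CommRing A]

/-- The harmonic product is compatible with deconcatenation. -/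
theorem harmonicSum_conv {f g : List ℕ+ → A} (hg : g [] = 1) (u v : List ℕ+)
    (h : ∀ p, p <:+ u → ∀ v, g p * g v = harmonicSum g p v) :
    harmonicSum (conv f g) u v = conv (fun q => conv (harmonicSum f q) g v) g u := by
  induction u generalizing f v with
  | nil =>
    have : harmonicSum f [] = f := funext fun v => harmonicSum_nil_left f v
    simp [conv, hg, this]
  | cons a u ihu =>
    have ihu := fun (f : List ℕ+ → A) v =>
      ihu (f := f) v fun p hp => h p (hp.trans (List.suffix_cons a u))
    induction v generalizing f with
    | nil =>
      have : ∀ f : List ℕ+ → A, (fun q => conv (harmonicSum f q) g []) = f := fun f =>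
        funext fun q => by simp [conv, hg]
      rw [this, harmonicSum_nil_right]
    | cons b v ihv =>
      have e : ∀ c, (fun t => conv f g (c :: t)) =
          fun t => f [] * g (c :: t) + conv (fun q => f (c :: q)) g t := fun c => rfl
      have hn : ∀ f : List ℕ+ → A, harmonicSum f [] = f := fun f =>
        funext fun v => harmonicSum_nil_left f v
      rw [harmonicSum_cons_cons, e, e, e, harmonicSum_add, harmonicSum_add, harmonicSum_add,
        ihu, ihv, ihu, harmonicSum_mul_left, harmonicSum_mul_left, harmonicSum_mul_left]
      have h1 := h (a :: u) List.suffix_rfl (b :: v)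
      rw [harmonicSum_cons_cons] at h1
      simp only [conv, harmonicSum_cons_cons, harmonicSum_nil_right, harmonicSum_nil_left, hn,
        conv_add_left]
      have h2 : ∀ c : A,
          conv (fun q => f (a :: q) * c) g u = c * conv (fun q => f (a :: q)) g u := by
        intro c
        rw [← conv_mul_left]
        simp only [mul_comm]
      simp only [h2]
      linear_combination (- f []) * h1

/-- The convolution of multiplicative functions is multiplicative. -/
theorem conv_mul_conv {f g : List ℕ+ → A} (hg : g [] = 1)
    (hf : ∀ u v, f u * f v = harmonicSum f u v) (h : ∀ u v, g u * g v = harmonicSum g u v)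
    (u v : List ℕ+) : conv f g u * conv f g v = harmonicSum (conv f g) u v := by
  rw [harmonicSum_conv hg u v fun p _ v => h p v]
  have : ∀ q, conv (harmonicSum f q) g v = conv f g v * f q := fun q => by
    rw [mul_comm, ← conv_mul_left]
    simp only [hf]
  simp only [this, conv_mul_left]
  ring

end Harmonic

/-! ### Symmetric multiple zeta values -/

section SignedReverse

variable {A : Type*} [CommRing A]

/-- `u ↦ (-1)^{wt(u)} f(reverse of u)`. -/
def signedReverse (f : List ℕ+ → A) (u : List ℕ+) : A := (-1) ^ wt u * f u.reverse

theorem signedReverse_mul {f : List ℕ+ → A} (hf : ∀ u v, f u * f v = harmonicSum f u v)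
    (u v : List ℕ+) :
    signedReverse f u * signedReverse f v = harmonicSum (signedReverse f) u v := by
  have h : harmonicSum (signedReverse f) u v =
      harmonicSum (fun h => (-1) ^ (wt u + wt v) * f h.reverse) u v :=
    harmonicSum_congr fun h hh => by rw [signedReverse, wt_of_mem_harmonicRev hh]
  rw [h, harmonicSum_mul_left, ← harmonicSum_reverse, ← hf, signedReverse, signedReverse]
  ring

theorem signedReverse_conv (f g : List ℕ+ → A) (u : List ℕ+) :
    signedReverse (conv f g) u = conv (signedReverse g) (signedReverse f) u := by
  rw [signedReverse, conv_reverse, ← conv_mul_left]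
  refine conv_congr ?_
  rintro q p rfl
  rw [wt_append, signedReverse, signedReverse]
  ring

end SignedReverse

/-- The regularized value `ζ^•` as a function of the reversed index. -/
def regRev (b : Bullet) (u : List ℕ+) : ℝ := regMZV₀ b u.reverse

theorem regWord_eq (b : Bullet) (w : List Letter) : regWord b w = regRev b (indexRev w) := rfl

theorem regRev_eq (b : Bullet) (u : List ℕ+) : regRev b u = regWord b (wordRev u) := by
  rw [regWord_eq, indexRev_wordRev]

theorem regRev_nil (b : Bullet) : regRev b [] = 1 := regWord_nil b

theorem regRev_harmonic_mul (u v : List ℕ+) :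
    regRev .harmonic u * regRev .harmonic v = harmonicSum (regRev .harmonic) u v := by
  have := congrArg (Polynomial.evalRingHom 0) (regMZV_harmonic_mul u v)
  rw [map_mul, map_harmonicSum] at this
  exact this

theorem regRev_harmonic_replicate_one (j : ℕ) :
    regRev .harmonic (List.replicate j 1) = regMZV₀ .harmonic (List.replicate j 1) := by
  rw [regRev, List.reverse_replicate]

theorem regRev_one (b : Bullet) : regRev b [1] = 0 := by
  have h := congrArg (Polynomial.eval 0) (sum_regMZV_one_mul b (k := [1]) (by simp [trailingOnes]))
  rw [Polynomial.eval_mul, Polynomial.eval_X, zero_mul, eval_list_sum_map] at h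
  rw [← h]
  cases b <;> simp [Bullet.mul, harmonicRev, shuffleRev, wordRev, indexRev, regRev, regMZV₀]

/-- The symmetric multiple zeta value: the constant term of `ζ^•_Ŝ`, as a function of the reversed
index. -/
def symRev (b : Bullet) (u : List ℕ+) : ℝ := conv (signedReverse (regRev b)) (regRev b) u

theorem constantCoeff_smzv (b : Bullet) (k : Index) :
    coeff 0 (smzv b k) = symRev b k.reverse := by
  have h0 : ∀ k : Index, addTuple k 0 = k := fun k => by
    have : (fun j => (⟨(k.get j : ℕ) + (0 : Fin k.length → ℕ) j,
        Nat.add_pos_left (k.get j).pos _⟩ : ℕ+)) = k.get := funext fun j => PNat.eq rfl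
    rw [addTuple, this, List.ofFn_get]
  rw [symRev, conv_reverse, conv_eq_sum, smzv, coeff_mk]
  refine Finset.sum_congr rfl fun i _ => ?_
  rw [Finset.piAntidiag_zero, Finset.sum_singleton, h0]
  simp [binom, signedReverse, regRev, wt_reverse]
  ring

/-- The `ℚ`-span of the symmetric multiple zeta values of weight `n`. -/
def symSpan (b : Bullet) (n : ℕ) : Submodule ℚ ℝ :=
  Submodule.span ℚ {x | ∃ u, wt u = n ∧ symRev b u = x}

theorem symRev_mem (b : Bullet) (u : List ℕ+) : symRev b u ∈ symSpan b (wt u) :=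
  Submodule.subset_span ⟨u, rfl, rfl⟩

theorem one_mem_symSpan (b : Bullet) : (1 : ℝ) ∈ symSpan b 0 := by
  have := symRev_mem b []
  simpa [symRev, conv, signedReverse, regRev_nil, wt] using this

theorem symRev_harmonic_mul (u v : List ℕ+) :
    symRev .harmonic u * symRev .harmonic v = harmonicSum (symRev .harmonic) u v :=
  conv_mul_conv (regRev_nil _) (signedReverse_mul regRev_harmonic_mul) regRev_harmonic_mul u v

theorem mul_mem_symSpan {i j : ℕ} {x y : ℝ} (hx : x ∈ symSpan .harmonic i)
    (hy : y ∈ symSpan .harmonic j) : x * y ∈ symSpan .harmonic (i + j) := by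
  have h : symSpan .harmonic i * symSpan .harmonic j ≤ symSpan .harmonic (i + j) := by
    rw [symSpan, symSpan, Submodule.span_mul_span, Submodule.span_le]
    rintro _ ⟨_, ⟨u, rfl, rfl⟩, _, ⟨v, rfl, rfl⟩, rfl⟩
    simp only [SetLike.mem_coe]
    rw [symRev_harmonic_mul, harmonicSum]
    refine list_sum_mem fun x hx => ?_
    obtain ⟨h, hh, rfl⟩ := List.mem_map.1 hx
    rw [← wt_of_mem_harmonicRev hh]
    exact symRev_mem _ h
  exact h (Submodule.mul_mem_mul hx hy)

theorem neg_one_pow_mul_mem {S : Submodule ℚ ℝ} {x : ℝ} (hx : x ∈ S) (n : ℕ) :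
    (-1) ^ n * x ∈ S := by
  rcases neg_one_pow_eq_or ℝ n with h | h <;> simp [h, hx]

theorem wt_indexRev {w : List Letter} (hw : IsH1Word w) : wt (indexRev w) = w.length := by
  rw [← length_wordRev, wordRev_indexRev hw]

theorem length_of_mem_shuffleRev {u v h : List Letter} (hh : h ∈ shuffleRev u v) :
    h.length = u.length + v.length := by
  induction u generalizing v h with
  | nil => simp [shuffleRev] at hh; simp [hh]
  | cons a u ihu =>
    induction v generalizing h with
    | nil => simp [shuffleRev] at hh; simp [hh]
    | cons b v ihv =>
      simp only [shuffleRev, List.mem_append, List.mem_map] at hh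
      rcases hh with ⟨t, ht, rfl⟩ | ⟨t, ht, rfl⟩
      · rw [List.length_cons, ihu ht, List.length_cons, List.length_cons]; omega
      · rw [List.length_cons, ihv ht, List.length_cons, List.length_cons]; omega

theorem wt_replicate_one (s : ℕ) : wt (List.replicate s 1) = s := by
  rw [← length_wordRev, wordRev_replicate_one, List.length_replicate]

theorem wt_pos {u : List ℕ+} (hu : u ≠ []) : 0 < wt u := by
  obtain ⟨a, u, rfl⟩ := List.exists_cons_of_ne_nil hu
  rw [wt_cons]
  exact Nat.add_pos_left a.pos _

/-- The comparison `regWord_harmonic_eq` in terms of indices. -/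
theorem regRev_harmonic_replicate_append (s : ℕ) {u : List ℕ+} (hu : ∀ a ∈ u.head?, a ≠ 1) :
    regRev .harmonic (List.replicate s 1 ++ u) =
      ∑ p ∈ Finset.HasAntidiagonal.antidiagonal s, regRev .shuffle (List.replicate p.1 1 ++ u) *
        regRev .harmonic (List.replicate p.2 1) := by
  simp only [regRev_harmonic_replicate_one]
  simp only [regRev_eq, wordRev_append, wordRev_replicate_one]
  refine regWord_harmonic_eq (isH1Word_wordRev u) ?_ s
  cases u with
  | nil => simp [wordRev]
  | cons a u =>
    have h1 : a ≠ 1 := hu a (by simp)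
    have h2 : (a : ℕ) - 1 = ((a : ℕ) - 2) + 1 := by
      have : 2 ≤ (a : ℕ) := two_le_of_ne_one h1
      omega
    rw [wordRev, h2, List.replicate_succ]
    simp

theorem exists_eq_replicate_one_append (u : List ℕ+) :
    ∃ (s : ℕ) (v : List ℕ+), (∀ a ∈ v.head?, a ≠ 1) ∧ u = List.replicate s 1 ++ v := by
  induction u with
  | nil => exact ⟨0, [], by simp, rfl⟩
  | cons a u ih =>
    by_cases ha : a = 1
    · obtain ⟨s, v, hv, rfl⟩ := ih
      exact ⟨s + 1, v, hv, by simp [ha, List.replicate_succ]⟩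
    · exact ⟨0, a :: u, by simpa using ha, rfl⟩

theorem regRev_shuffle_replicate_one (s : ℕ) : regRev .shuffle (List.replicate (s + 1) 1) = 0 := by
  rw [regRev_eq, wordRev_replicate_one, regWord_shuffle_replicate_y]

/-- If the regularized values of weight less than `n` are known to be spanned by symmetric values,
then the two regularizations agree in weight `n` up to such a span, except at `(1, …, 1)`. -/
theorem regRev_harmonic_sub_shuffle_mem {n : ℕ}
    (ih : ∀ u, wt u < n → regRev .harmonic u ∈ symSpan .harmonic (wt u) ∧
      regRev .shuffle u ∈ symSpan .harmonic (wt u)) {u : List ℕ+} (hu : ∃ a ∈ u, a ≠ 1)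
    (hn : wt u = n) : regRev .harmonic u - regRev .shuffle u ∈ symSpan .harmonic n := by
  obtain ⟨s, v, hv, rfl⟩ := exists_eq_replicate_one_append u
  have hv0 : v ≠ [] := by
    rintro rfl
    obtain ⟨a, ha, ha1⟩ := hu
    rw [List.append_nil] at ha
    exact ha1 (List.eq_of_mem_replicate ha)
  have hpos := wt_pos hv0
  rw [regRev_harmonic_replicate_append s hv, ← Finset.add_sum_erase _ _
    (by simp : (s, 0) ∈ Finset.HasAntidiagonal.antidiagonal s)]
  simp only [List.replicate_zero, regRev_nil, mul_one, add_sub_cancel_left]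
  refine sum_mem ?_
  rintro ⟨i, j⟩ hp
  obtain ⟨hne, hp⟩ := Finset.mem_erase.1 hp
  have hp : i + j = s := by simpa using hp
  have hj : j ≠ 0 := by
    rintro rfl
    exact hne (by simpa using hp)
  rw [wt_append, wt_replicate_one] at hn
  have h1 := (ih (List.replicate i 1 ++ v) (by rw [wt_append, wt_replicate_one]; omega)).2
  have h2 := (ih (List.replicate j 1) (by rw [wt_replicate_one]; omega)).1
  have h3 := mul_mem_symSpan h1 h2
  rw [wt_append, wt_replicate_one, wt_replicate_one] at h3
  have h4 : i + wt v + j = n := by omega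
  rwa [h4] at h3

/-- All regularized multiple zeta values are rational linear combinations of symmetric multiple zeta
values of the same weight. By induction on the weight, the class of `ζ^*` modulo the latter, set to
zero in all other weights, satisfies the assumptions of `eq_zero_of_double_shuffle`. -/
theorem regRev_mem_symSpan (u : List ℕ+) : regRev .harmonic u ∈ symSpan .harmonic (wt u) ∧
    regRev .shuffle u ∈ symSpan .harmonic (wt u) := by
  induction hn : wt u using Nat.strong_induction_on generalizing u with
  | _ n ih =>
    have ih : ∀ u, wt u < n → regRev .harmonic u ∈ symSpan .harmonic (wt u) ∧
      regRev .shuffle u ∈ symSpan .harmonic (wt u) := fun u hu => ih _ hu u rfl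
    let mk := (symSpan .harmonic n).mkQ
    have hmk : ∀ x, mk x = 0 ↔ x ∈ symSpan .harmonic n := fun x =>
      Submodule.Quotient.mk_eq_zero _
    let φ : List ℕ+ → ℝ ⧸ symSpan .harmonic n :=
      fun u => if wt u = n then mk (regRev .harmonic u) else 0
    let ψ : List ℕ+ → ℝ ⧸ symSpan .harmonic n :=
      fun u => if wt u = n then mk (regRev .shuffle u) else 0
    have hψ : ∀ k, (∃ a ∈ k, a ≠ 1) → ψ k = φ k := by
      intro k hk
      by_cases hkn : wt k = n
      · simp only [φ, ψ, if_pos hkn]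
        rw [eq_comm, ← sub_eq_zero, ← map_sub, hmk]
        exact regRev_harmonic_sub_shuffle_mem ih hk hkn
      · simp only [φ, ψ, if_neg hkn]
    have hφ : ∀ k, φ k = 0 := by
      refine eq_zero_of_double_shuffle (ψ := ψ) ?_ ?_ ?_ ?_ hψ
      · simp [φ, regRev_one]
      · intro u v hu hv
        have hu := wt_pos hu
        have hv := wt_pos hv
        by_cases huv : wt u + wt v = n
        · rw [harmonicSum_congr (G := fun h => mk (regRev .harmonic h)) fun h hh => by
            simp only [φ, wt_of_mem_harmonicRev hh, if_pos huv], ← map_harmonicSum,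
            ← regRev_harmonic_mul, hmk, ← huv]
          exact mul_mem_symSpan (ih u (by omega)).1 (ih v (by omega)).1
        · refine sum_map_eq_zero fun h hh => ?_
          simp only [φ, wt_of_mem_harmonicRev hh, if_neg huv]
      · intro k
        by_cases hk : wt k = n
        · have h1 : (-1 : ℤ) ^ wt k • φ k.reverse =
              mk ((-1) ^ wt k * regRev .harmonic k.reverse) := by
            simp only [φ, wt_reverse, if_pos hk]
            rcases Nat.even_or_odd (wt k) with h | h <;> simp [h.neg_one_pow]
          rw [h1]
          simp only [φ, if_pos hk]
          rw [← map_add, hmk]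
          cases k with
          | nil =>
            subst hk
            have h0 := one_mem_symSpan .harmonic
            simpa [regRev_nil, wt] using add_mem h0 h0
          | cons a k =>
            have h2 := symRev_mem .harmonic (a :: k)
            rw [hk, symRev] at h2
            have h3 := conv_sub_mem (s := symSpan .harmonic n) (u := a :: k) (by simp)
              (f := signedReverse (regRev .harmonic)) (g := regRev .harmonic) fun q p hq hp hu => by
                rw [← hu, wt_append] at hk
                have hq := wt_pos hq
                have hp := wt_pos hp
                rw [← hk]
                refine mul_mem_symSpan ?_ (ih p (by omega)).1
                rw [signedReverse]
                have := (ih q.reverse (by rw [wt_reverse]; omega)).1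
                rw [wt_reverse] at this
                exact neg_one_pow_mul_mem this _
            have h4 := sub_mem h2 h3
            rw [sub_sub_cancel] at h4
            simpa [signedReverse, regRev_nil, wt] using h4
        · have hk' : wt k.reverse ≠ n := by rwa [wt_reverse]
          simp only [φ, if_neg hk, if_neg hk', smul_zero, add_zero]
      · intro u v hu hv hu' hv'
        have hu0 := List.length_pos_iff.2 hu
        have hv0 := List.length_pos_iff.2 hv
        have e : ∀ h ∈ shuffleRev u v, wt (indexRev h) = u.length + v.length := fun h hh => by
          rw [wt_indexRev (isH1Word_of_mem_shuffleRev hu' hv' hh), length_of_mem_shuffleRev hh]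
        by_cases huv : u.length + v.length = n
        · rw [shuffleSum_congr (G := fun h => mk (regWord .shuffle h)) fun h hh => by
            simp only [ψ, e h hh, if_pos huv]; rfl, ← map_shuffleSum,
            ← regWord_shuffle_mul hu' hv', hmk, ← huv, ← wt_indexRev hu', ← wt_indexRev hv']
          exact mul_mem_symSpan (ih _ (by rw [wt_indexRev hu']; omega)).2
            (ih _ (by rw [wt_indexRev hv']; omega)).2
        · refine sum_map_eq_zero fun h hh => ?_
          simp only [ψ, e h hh, if_neg huv]
    have h1 := hφ u
    simp only [φ, if_pos hn] at h1
    refine ⟨(hmk _).1 h1, ?_⟩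
    by_cases hu : ∃ a ∈ u, a ≠ 1
    · have h2 := (hψ u hu).trans (hφ u)
      simp only [ψ, if_pos hn] at h2
      exact (hmk _).1 h2
    · push Not at hu
      have hu := List.eq_replicate_of_mem hu
      cases h : u.length with
      | zero =>
        rw [h] at hu
        subst hu
        subst hn
        simpa [regRev_nil, wt] using one_mem_symSpan .harmonic
      | succ s =>
        rw [hu, h, regRev_shuffle_replicate_one]
        exact zero_mem _

/-! ### Comparison of the two kinds of symmetric multiple zeta values -/

section OnesSupport

variable {A : Type*} [CommRing A]

theorem conv_replicate_one_append {f g : List ℕ+ → A} (hf : ∀ q, (∃ a ∈ q, a ≠ 1) → f q = 0)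
    (s : ℕ) {u : List ℕ+} (hu : ∀ a ∈ u.head?, a ≠ 1) :
    conv f g (List.replicate s 1 ++ u) = ∑ p ∈ Finset.HasAntidiagonal.antidiagonal s,
      f (List.replicate p.1 1) * g (List.replicate p.2 1 ++ u) := by
  induction s generalizing f with
  | zero =>
    cases u with
    | nil => simp [conv]
    | cons a u =>
      have : (fun q => f (a :: q)) = fun _ => 0 :=
        funext fun q => hf _ ⟨a, by simp, hu a (by simp)⟩
      simp [conv, this, conv_zero_left]
  | succ s ih =>
    rw [Finset.Nat.sum_antidiagonal_succ, List.replicate_succ, List.cons_append, conv,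
      ih fun q ⟨a, ha, ha'⟩ => hf _ ⟨a, by simp [ha], ha'⟩]
    simp [List.replicate_succ]

/-- If `f` is supported on the indices `(1, …, 1)`, then the harmonic product with `z_a`, `a ≠ 1`,
commutes with the convolution by `f`. -/
theorem harmonicSum_singleton_conv {f g : List ℕ+ → A} (hf : ∀ q, (∃ a ∈ q, a ≠ 1) → f q = 0)
    {a : ℕ+} (ha : a ≠ 1) (u : List ℕ+) :
    harmonicSum (conv f g) [a] u = conv f (harmonicSum g [a]) u := by
  have h0 : ∀ c, c ≠ 1 → ∀ v, conv f g (c :: v) = f [] * g (c :: v) := fun c hc v => by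
    have : (fun q => f (c :: q)) = fun _ => 0 := funext fun q => hf _ ⟨c, by simp, hc⟩
    rw [conv, this, conv_zero_left, add_zero]
  induction u generalizing f with
  | nil => rw [harmonicSum_nil_right, h0 a ha, conv, harmonicSum_nil_right]
  | cons b u ih =>
    have hf' : ∀ q, (∃ a ∈ q, a ≠ 1) → f (b :: q) = 0 :=
      fun q ⟨c, hc, hc'⟩ => hf _ ⟨c, by simp [hc], hc'⟩
    have hab : a + b ≠ 1 := by
      intro h
      have h1 := congrArg PNat.val h
      have h2 := a.pos
      have h3 := b.pos
      simp at h1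
      omega
    have e : (fun t => conv f g (b :: t)) =
          fun t => f [] * g (b :: t) + conv (fun q => f (b :: q)) g t := rfl
    have h1 := ih hf' fun c hc v => by
      have : (fun q => f (b :: c :: q)) = fun _ => 0 := funext fun q => hf _ ⟨c, by simp, hc⟩
      rw [conv, this, conv_zero_left, add_zero]
    rw [harmonicSum_cons_cons, harmonicSum_nil_left, harmonicSum_nil_left, h0 a ha, h0 _ hab, e,
      harmonicSum_add, harmonicSum_mul_left, h1, conv, harmonicSum_cons_cons]
    simp only [harmonicSum_nil_left]
    ring

end OnesSupport

/-- The restriction of `ζ^*` to the indices `(1, …, 1)`. -/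
def onesPart (q : List ℕ+) : ℝ := open Classical in
  if ∃ a ∈ q, a ≠ 1 then 0 else regRev .harmonic q

theorem onesPart_eq_zero {q : List ℕ+} (hq : ∃ a ∈ q, a ≠ 1) : onesPart q = 0 := if_pos hq

theorem onesPart_eq {q : List ℕ+} (hq : ¬∃ a ∈ q, a ≠ 1) : onesPart q = regRev .harmonic q :=
  if_neg hq

theorem onesPart_nil : onesPart [] = 1 := by rw [onesPart_eq (by simp), regRev_nil]

/-- The comparison of the two regularizations as a convolution. -/
theorem regRev_harmonic_eq_conv : regRev .harmonic = conv onesPart (regRev .shuffle) := by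
  funext u
  obtain ⟨s, v, hv, rfl⟩ := exists_eq_replicate_one_append u
  rw [regRev_harmonic_replicate_append s hv,
    conv_replicate_one_append (fun q => onesPart_eq_zero) s hv, ← Finset.Nat.sum_antidiagonal_swap]
  refine Finset.sum_congr rfl fun p _ => ?_
  rw [onesPart_eq]
  · exact mul_comm _ _
  · rintro ⟨a, ha, ha'⟩
    exact ha' (List.eq_of_mem_replicate ha)

theorem regRev_singleton (b : Bullet) {a : ℕ+} (ha : a ≠ 1) : regRev b [a] = mzv [a] := by
  rw [regRev, regMZV₀, List.reverse_singleton, regMZV_of_trailingOnes_eq_zero _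
    (by simp [trailingOnes, ha]), Polynomial.eval_C]

/-- `ζ^ш` satisfies the harmonic product formula for products with `z_a`, `a ≥ 2`, because these
commute with the convolution that turns `ζ^ш` into `ζ^*`. -/
theorem regRev_shuffle_singleton_mul {a : ℕ+} (ha : a ≠ 1) (u : List ℕ+) :
    regRev .shuffle [a] * regRev .shuffle u = harmonicSum (regRev .shuffle) [a] u := by
  rw [← sub_eq_zero]
  refine eq_zero_of_conv_eq_zero (g := fun u => regRev .shuffle [a] * regRev .shuffle u -
    harmonicSum (regRev .shuffle) [a] u) onesPart_nil (fun u => ?_) u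
  have h1 := regRev_harmonic_mul [a] u
  rw [regRev_harmonic_eq_conv, harmonicSum_singleton_conv (fun q => onesPart_eq_zero) ha,
    ← regRev_harmonic_eq_conv, regRev_singleton _ ha, ← regRev_singleton .shuffle ha,
    regRev_harmonic_eq_conv] at h1
  have h2 : (fun u => regRev .shuffle [a] * regRev .shuffle u -
      harmonicSum (regRev .shuffle) [a] u) = fun u => regRev .shuffle [a] * regRev .shuffle u +
      (-1) * harmonicSum (regRev .shuffle) [a] u := by
    funext u; ring
  rw [h2, conv_add_right, conv_mul_right, conv_mul_right, h1]
  ring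

/-- Although `ζ^ш_S` is not multiplicative for the harmonic product, it is so for products with
`z_a`, `a ≥ 2`. -/
theorem harmonicSum_singleton_symRev {a : ℕ+} (ha : a ≠ 1) (u : List ℕ+) :
    harmonicSum (symRev .shuffle) [a] u = (1 + (-1) ^ (a : ℕ)) * mzv [a] * symRev .shuffle u := by
  have hs : ∀ p, p <:+ [a] → ∀ v, regRev .shuffle p * regRev .shuffle v =
      harmonicSum (regRev .shuffle) p v := by
    intro p hp v
    rcases List.suffix_cons_iff.1 hp with rfl | hp
    · exact regRev_shuffle_singleton_mul ha v
    · rw [List.suffix_nil.1 hp, regRev_nil, one_mul, harmonicSum_nil_left]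
  have h1 : ∀ q, harmonicSum (signedReverse (regRev .shuffle)) [a] q =
      (-1) ^ (a : ℕ) * mzv [a] * signedReverse (regRev .shuffle) q := by
    intro q
    have e : harmonicSum (signedReverse (regRev .shuffle)) [a] q =
        harmonicSum (fun h => (-1) ^ ((a : ℕ) + wt q) * regRev .shuffle h.reverse) [a] q :=
      harmonicSum_congr fun h hh => by
        rw [signedReverse, wt_of_mem_harmonicRev hh]
        simp [wt]
    rw [e, harmonicSum_mul_left, ← harmonicSum_reverse, List.reverse_singleton,
      ← regRev_shuffle_singleton_mul ha, regRev_singleton _ ha, signedReverse]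
    ring
  have h2 : harmonicSum (signedReverse (regRev .shuffle)) [] = signedReverse (regRev .shuffle) :=
    funext fun v => harmonicSum_nil_left _ v
  have h3 : harmonicSum (signedReverse (regRev .shuffle)) [a] =
      fun q => (-1) ^ (a : ℕ) * mzv [a] * signedReverse (regRev .shuffle) q := funext h1
  have h4 : harmonicSum (symRev .shuffle) [a] u =
      harmonicSum (conv (signedReverse (regRev .shuffle)) (regRev .shuffle)) [a] u := rfl
  rw [h4, harmonicSum_conv (regRev_nil _) [a] u hs, conv, conv, h2, h3, conv_mul_left,
    regRev_singleton _ ha, regRev_nil, symRev]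
  ring

theorem symRev_singleton (b : Bullet) {a : ℕ+} (ha : a ≠ 1) :
    symRev b [a] = (1 + (-1) ^ (a : ℕ)) * mzv [a] := by
  simp [symRev, conv, signedReverse, regRev_nil, wt, regRev_singleton _ ha]
  ring

theorem symRev_one (b : Bullet) : symRev b [1] = 0 := by
  simp [symRev, conv, signedReverse, regRev_nil, wt, regRev_one]

/-- Euler's evaluation of the even zeta values, in the form `ζ(2j) ∈ ℚ ζ(2)^j`. -/
theorem exists_mzv_even_eq {a : ℕ+} {j : ℕ} (hj : j ≠ 0) (ha : (a : ℕ) = 2 * j) :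
    ∃ q : ℚ, mzv [a] = q * mzv [2] ^ j := by
  have h : ∀ {a : ℕ+} {j : ℕ}, j ≠ 0 → (a : ℕ) = 2 * j → mzv [a] =
      (-1) ^ (j + 1) * 2 ^ (2 * j - 1) * Real.pi ^ (2 * j) * bernoulli (2 * j) /
        (2 * j).factorial := by
    intro a j hj ha
    have ha2 : 2 ≤ a := PNat.coe_le_coe _ _ |>.1 (by change 2 ≤ (a : ℕ); omega)
    have h1 := hasSum_mzv ha2 []
    have h2 := hasSum_zeta_nat hj
    refine HasSum.unique ?_ h2
    simpa [truncSum, ha] using h1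
  refine ⟨(-1) ^ (j + 1) * 2 ^ (2 * j - 1) * bernoulli (2 * j) / (2 * j).factorial * 6 ^ j, ?_⟩
  rw [h hj ha, h (a := 2) (j := 1) one_ne_zero rfl]
  have : (-1 : ℝ) ^ (1 + 1) * 2 ^ (2 * 1 - 1) * Real.pi ^ (2 * 1) * (bernoulli (2 * 1) : ℚ) /
      ((2 * 1).factorial : ℕ) = Real.pi ^ 2 / 6 := by
    norm_num [bernoulli_two, Nat.factorial]
    ring
  rw [this, div_pow, ← pow_mul]
  push_cast
  field_simp

/-- The multiples of `ζ(2)` of weight `n`, as a subspace of `symSpan .harmonic n`. -/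
def zetaTwoSpan : ℕ → Submodule ℚ ℝ
  | n + 2 => (symSpan .harmonic n).map (LinearMap.mulLeft ℚ (mzv [2]))
  | _ => ⊥

theorem mul_mem_zetaTwoSpan {i j : ℕ} {x y : ℝ} (hx : x ∈ zetaTwoSpan i)
    (hy : y ∈ symSpan .harmonic j) : x * y ∈ zetaTwoSpan (i + j) := by
  match i with
  | 0 | 1 =>
    rw [(Submodule.mem_bot ℚ).1 hx, zero_mul]
    exact zero_mem _
  | i + 2 =>
    obtain ⟨x, hx', rfl⟩ := Submodule.mem_map.1 hx
    have e : i + 2 + j = i + j + 2 := by ring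
    rw [e]
    exact Submodule.mem_map.2 ⟨x * y, mul_mem_symSpan hx' hy, by simp [mul_assoc]⟩

theorem mzv_two_pow_mem (j : ℕ) : mzv [2] ^ j ∈ symSpan .harmonic (2 * j) := by
  induction j with
  | zero => simpa using one_mem_symSpan .harmonic
  | succ j ih =>
    have h := (regRev_mem_symSpan [2]).1
    rw [regRev_singleton _ (by decide)] at h
    simpa [wt, pow_succ, mul_add] using mul_mem_symSpan ih h

theorem symRev_singleton_mem (a : ℕ+) : symRev .harmonic [a] ∈ zetaTwoSpan a := by
  by_cases ha : a = 1
  · rw [ha, symRev_one]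
    exact zero_mem _
  rw [symRev_singleton _ ha]
  rcases Nat.even_or_odd (a : ℕ) with h | h
  · obtain ⟨j, hj⟩ := even_iff_exists_two_mul.1 h
    obtain ⟨j, rfl⟩ : ∃ i, j = i + 1 := Nat.exists_eq_succ_of_ne_zero (by
      rintro rfl
      exact a.ne_zero hj)
    obtain ⟨q, hq⟩ := exists_mzv_even_eq (Nat.succ_ne_zero j) hj
    rw [hq, h.neg_one_pow, hj, mul_add, Nat.succ_eq_add_one, pow_succ]
    refine Submodule.mem_map.2 ⟨(2 * q : ℚ) • mzv [2] ^ j,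
      Submodule.smul_mem _ _ (mzv_two_pow_mem j), ?_⟩
    rw [LinearMap.mulLeft_apply, Rat.smul_def]
    push_cast
    ring
  · rw [h.neg_one_pow]
    simp

/-- The sum of the values of `F` at the lists arising from `(1, …, 1)` (of length `m`) by the
insertion of `a`. -/
def insertOnesSum (F : List ℕ+ → ℝ) (a : ℕ+) : ℕ → ℝ
  | 0 => F [a]
  | m + 1 => F (a :: List.replicate (m + 1) 1) + insertOnesSum (fun h => F (1 :: h)) a m

theorem harmonicSum_replicate_one (F : List ℕ+ → ℝ) (a : ℕ+) (m : ℕ) :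
    harmonicSum F [a] (List.replicate (m + 1) 1) =
      insertOnesSum F a (m + 1) + insertOnesSum F (a + 1) m := by
  induction m generalizing F with
  | zero => simp [harmonicSum_cons_cons, insertOnesSum]
  | succ m ih =>
    rw [List.replicate_succ, harmonicSum_cons_cons, ih]
    simp only [insertOnesSum, harmonicSum_nil_left, List.replicate_succ]
    ring

theorem insertOnesSum_one (F : List ℕ+ → ℝ) (m : ℕ) :
    insertOnesSum F 1 m = (m + 1) * F (List.replicate (m + 1) 1) := by
  induction m generalizing F with
  | zero => simp [insertOnesSum]
  | succ m ih =>
    rw [insertOnesSum, ih]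
    simp only [List.replicate_succ]
    push_cast
    ring

/-- Newton's identities express the symmetric values at `(1, …, 1)` by those in depth `1`. -/
theorem symRev_replicate_one_mem (m : ℕ) :
    symRev .harmonic (List.replicate (m + 1) 1) ∈ zetaTwoSpan (m + 1) := by
  have h : ∀ a : ℕ+, insertOnesSum (symRev .harmonic) a m ∈ zetaTwoSpan (a + m) := by
    induction m with
    | zero => exact fun a => symRev_singleton_mem a
    | succ m ih =>
      intro a
      have h1 := harmonicSum_replicate_one (symRev .harmonic) a m
      rw [← symRev_harmonic_mul, ← sub_eq_iff_eq_add] at h1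
      rw [← h1]
      refine sub_mem ?_ ?_
      · have := symRev_mem .harmonic (List.replicate (m + 1) 1)
        rw [wt_replicate_one] at this
        exact mul_mem_zetaTwoSpan (symRev_singleton_mem a) this
      · have := ih (a + 1)
        rwa [PNat.add_coe, PNat.one_coe, add_assoc, add_comm 1 m] at this
  have h1 := Submodule.smul_mem _ ((m + 1 : ℚ)⁻¹) (h 1)
  rw [insertOnesSum_one, Rat.smul_def, ← mul_assoc] at h1
  push_cast at h1
  rwa [inv_mul_cancel₀ (by positivity), one_mul, add_comm 1 m] at h1

/-- The two kinds of symmetric multiple zeta values agree modulo `ζ(2)`. -/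
theorem symRev_sub_mem (u : List ℕ+) :
    symRev .harmonic u - symRev .shuffle u ∈ zetaTwoSpan (wt u) := by
  set c := conv (signedReverse onesPart) onesPart with hc
  set ε : List ℕ+ → ℝ := fun q => if q = [] then 1 else 0 with hε
  have h1 : symRev .harmonic u =
      conv (signedReverse (regRev .shuffle)) (conv c (regRev .shuffle)) u := by
    have e : signedReverse (regRev .harmonic) =
        conv (signedReverse (regRev .shuffle)) (signedReverse onesPart) := by
      funext q
      rw [regRev_harmonic_eq_conv, signedReverse_conv]
    rw [symRev, e, conv_assoc, hc]
    refine congrFun (congrArg _ ?_) u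
    funext p
    rw [conv_assoc, ← regRev_harmonic_eq_conv]
  have h2 : conv c (regRev .shuffle) = fun p => regRev .shuffle p +
      conv (fun q => c q - ε q) (regRev .shuffle) p := by
    funext p
    have : c = fun q => ε q + (c q - ε q) := by funext q; ring
    conv_lhs => rw [this]
    rw [conv_add_left, conv_one_left fun _ => rfl]
  have hc' : ∀ q, c q - ε q ∈ zetaTwoSpan (wt q) := by
    intro q
    by_cases hq : ∃ a ∈ q, a ≠ 1
    · have hq0 : q ≠ [] := by rintro rfl; simp at hq
      have : c q = 0 := by
        have h0 : conv (fun _ => (0 : ℝ)) onesPart q = 0 := conv_zero_left _ _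
        rw [hc, ← h0]
        refine conv_congr ?_
        rintro p r rfl
        obtain ⟨a, ha, ha1⟩ := hq
        rcases List.mem_append.1 ha with ha | ha
        · rw [signedReverse, onesPart_eq_zero ⟨a, by simpa using ha, ha1⟩]
          simp
        · rw [onesPart_eq_zero ⟨a, ha, ha1⟩]
          simp
      rw [this, hε]
      simp [hq0]
    · have h3 : c q = symRev .harmonic q := by
        rw [hc, symRev]
        refine conv_congr ?_
        rintro p r rfl
        rw [signedReverse, signedReverse, onesPart_eq, onesPart_eq]
        · exact fun ⟨a, ha, ha1⟩ => hq ⟨a, by simp [ha], ha1⟩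
        · exact fun ⟨a, ha, ha1⟩ => hq ⟨a, by simpa using Or.inl (List.mem_reverse.1 ha), ha1⟩
      push Not at hq
      have hq := List.eq_replicate_of_mem hq
      cases h : q.length with
      | zero =>
        obtain rfl := List.eq_nil_of_length_eq_zero h
        rw [h3, hε]
        simp [symRev, conv, signedReverse, regRev_nil, wt]
      | succ m =>
        rw [h] at hq
        have := symRev_replicate_one_mem m
        rw [h3, hε, hq, wt_replicate_one]
        simpa using this
  have h3 : symRev .harmonic u - symRev .shuffle u = conv (signedReverse (regRev .shuffle))
      (conv (fun q => c q - ε q) (regRev .shuffle)) u := by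
    rw [h1, h2, conv_add_right, symRev]
    ring
  rw [h3]
  refine conv_mem ?_
  rintro q p rfl
  rw [mul_comm, wt_append, add_comm]
  refine mul_mem_zetaTwoSpan (conv_mem ?_) ?_
  · rintro q' p' rfl
    rw [wt_append]
    exact mul_mem_zetaTwoSpan (hc' q') (regRev_mem_symSpan p').2
  · rw [signedReverse, ← wt_reverse q]
    exact neg_one_pow_mul_mem (regRev_mem_symSpan _).2 _

/-- By induction on the weight, the multiples of `ζ(2)` by which `ζ^*_S` and `ζ^ш_S` differ are
spanned by the values of `ζ^ш_S`. -/
theorem symSpan_harmonic_le_shuffle (n : ℕ) : symSpan .harmonic n ≤ symSpan .shuffle n := by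
  induction n using Nat.strong_induction_on with
  | _ n ih =>
    refine Submodule.span_le.2 ?_
    rintro _ ⟨u, rfl, rfl⟩
    have h := symRev_sub_mem u
    suffices hle : zetaTwoSpan (wt u) ≤ symSpan .shuffle (wt u) by
      simpa using add_mem (hle h) (symRev_mem .shuffle u)
    generalize wt u = n at ih
    match n with
    | 0 | 1 => exact bot_le
    | n + 2 =>
      refine Submodule.map_le_iff_le_comap.2 ((ih n (by omega)).trans (Submodule.span_le.2 ?_))
      rintro _ ⟨v, rfl, rfl⟩
      have h1 := harmonicSum_singleton_symRev (a := 2) (by decide) v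
      have h2 : harmonicSum (symRev .shuffle) [2] v ∈ symSpan .shuffle (wt v + 2) := by
        refine list_sum_mem fun x hx => ?_
        obtain ⟨h, hh, rfl⟩ := List.mem_map.1 hx
        have := wt_of_mem_harmonicRev hh
        rw [show wt v + 2 = wt h by rw [this, wt_cons]; simp [wt]; ring]
        exact symRev_mem _ h
      have h3 := Submodule.smul_mem _ (2⁻¹ : ℚ) h2
      rw [h1, Rat.smul_def] at h3
      have h4 : (((2⁻¹ : ℚ) : ℝ)) * ((1 + (-1) ^ ((2 : ℕ+) : ℕ)) * mzv [2] * symRev .shuffle v) =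
          mzv [2] * symRev .shuffle v := by
        have : ((2 : ℕ+) : ℕ) = 2 := rfl
        rw [this]
        push_cast
        ring
      rw [h4] at h3
      exact h3

/-! ### The algebra of multiple zeta values -/

theorem admissible_of_trailingOnes_eq_zero {k : Index} (h : trailingOnes k = 0) : Admissible k := by
  intro a ha
  obtain ⟨l, rfl⟩ := List.getLast?_eq_some_iff.1 ha
  refine two_le_of_ne_one ?_
  rintro rfl
  simp [trailingOnes] at h

theorem Admissible.trailingOnes_eq_zero {k : Index} (h : Admissible k) : trailingOnes k = 0 := by
  induction k using List.reverseRecOn with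
  | nil => simp [trailingOnes]
  | append_singleton l a _ =>
    have ha : 2 ≤ a := h a (by simp)
    have ha1 : a ≠ 1 := by
      rintro rfl
      exact absurd ha (by decide)
    simp [trailingOnes, ha1]

theorem regMZV₀_mem (b : Bullet) (k : Index) : regMZV₀ b k ∈ mzvAlgebra := by
  induction hs : trailingOnes k using Nat.strong_induction_on generalizing k with
  | _ s ih =>
    by_cases hk : trailingOnes k = 0
    · rw [regMZV₀, regMZV_of_trailingOnes_eq_zero _ hk, Polynomial.eval_C]
      exact Algebra.subset_adjoin ⟨k, admissible_of_trailingOnes_eq_zero hk, rfl⟩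
    · have h := congrArg (Polynomial.eval 0) (trailingOnes_mul_regMZV b hk)
      rw [Polynomial.eval_mul, Polynomial.eval_C, Polynomial.eval_sub, Polynomial.eval_mul,
        Polynomial.eval_X, zero_mul, zero_sub, eval_list_sum_map] at h
      have h1 : (trailingOnes k : ℝ) * regMZV₀ b k ∈ mzvAlgebra := by
        rw [regMZV₀, h]
        refine neg_mem (list_sum_mem fun x hx => ?_)
        obtain ⟨l, hl, rfl⟩ := List.mem_map.1 hx
        exact ih _ (hs ▸ by simpa using (List.mem_filter.1 hl).2) l rfl
      have h2 := Subalgebra.smul_mem _ h1 ((trailingOnes k : ℚ)⁻¹)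
      rw [Rat.smul_def, ← mul_assoc] at h2
      push_cast at h2
      rwa [inv_mul_cancel₀ (Nat.cast_ne_zero.2 hk), one_mul] at h2

theorem smzv_mem (b : Bullet) (k : Index) : smzv b k ∈ mzvPowerSeries := by
  intro n
  rw [smzv, coeff_mk]
  refine sum_mem fun i _ => mul_mem (mul_mem (pow_mem (neg_mem (one_mem _)) _) (regMZV₀_mem b _))
    (sum_mem fun l _ => mul_mem (natCast_mem _ _) (regMZV₀_mem b _))

theorem symSpan_le_range (b : Bullet) (n : ℕ) :
    symSpan b n ≤ LinearMap.range ((coeff (R := ℝ) 0).restrictScalars ℚ ∘ₗ smzvMap b) := by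
  refine Submodule.span_le.2 ?_
  rintro _ ⟨u, _, rfl⟩
  refine ⟨Finsupp.single u.reverse 1, ?_⟩
  rw [LinearMap.comp_apply, smzvMap, Finsupp.linearCombination_single, one_smul,
    LinearMap.restrictScalars_apply, constantCoeff_smzv, List.reverse_reverse]

/-- Every element of `𝒵` is the constant term of some `Z^•_Ŝ(w)`. -/
theorem exists_coeff_smzvMap_eq (b : Bullet) {x : ℝ} (hx : x ∈ mzvAlgebra) :
    ∃ w, coeff 0 (smzvMap b w) = x := by
  have h : x ∈ ⨆ n, symSpan .harmonic n := by
    induction hx using Algebra.adjoin_induction with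
    | mem x hx =>
      obtain ⟨k, hk, rfl⟩ := hx
      have h1 := (regRev_mem_symSpan k.reverse).1
      rw [regRev, regMZV₀, List.reverse_reverse,
        regMZV_of_trailingOnes_eq_zero _ hk.trailingOnes_eq_zero, Polynomial.eval_C] at h1
      exact Submodule.mem_iSup_of_mem _ h1
    | algebraMap q =>
      rw [Algebra.algebraMap_eq_smul_one]
      exact Submodule.smul_mem _ _ (Submodule.mem_iSup_of_mem 0 (one_mem_symSpan _))
    | add x y _ _ hx hy => exact add_mem hx hy
    | mul x y _ _ hx hy =>
      refine Submodule.iSup_induction _ (motive := fun x => x * y ∈ ⨆ n, symSpan .harmonic n) hx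
        (fun i x hx => ?_) (by simp) fun x x' hx hx' => by rw [add_mul]; exact add_mem hx hx'
      exact Submodule.iSup_induction _ (motive := fun y => x * y ∈ ⨆ n, symSpan .harmonic n) hy
        (fun j y hy => Submodule.mem_iSup_of_mem _ (mul_mem_symSpan hx hy)) (by simp)
        fun y y' hy hy' => by rw [mul_add]; exact add_mem hy hy'
  have h1 : (⨆ n, symSpan .harmonic n) ≤
      LinearMap.range ((coeff (R := ℝ) 0).restrictScalars ℚ ∘ₗ smzvMap b) := by
    refine iSup_le fun n => le_trans ?_ (symSpan_le_range b n)
    cases b with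
    | harmonic => exact le_rfl
    | shuffle => exact symSpan_harmonic_le_shuffle n
  exact h1 h

/-! ### Convergence in the `t`-adic topology -/

theorem mem_span_X_pow {n : ℕ} {f : PowerSeries ℝ} :
    f ∈ Ideal.span {(X : PowerSeries ℝ)} ^ n ↔ ∀ m < n, coeff m f = 0 := by
  rw [Ideal.span_singleton_pow, Ideal.mem_span_singleton, X_pow_dvd_iff]

theorem hasBasis_nhds_tAdic (f : PowerSeries ℝ) :
    (@nhds _ tAdicTopology f).HasBasis (fun _ : ℕ => True)
      fun n => {g | ∀ m < n, coeff m g = coeff m f} := by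
  have h := (Ideal.span {(X : PowerSeries ℝ)}).hasBasis_nhds_adic f
  refine h.congr (fun _ => Iff.rfl) fun n _ => ?_
  ext g
  simp only [Set.mem_image, SetLike.mem_coe, mem_span_X_pow, Set.mem_ofPred_eq]
  constructor
  · rintro ⟨y, hy, rfl⟩ m hm
    rw [map_add, hy m hm, add_zero]
  · intro hg
    exact ⟨g - f, fun m hm => by rw [map_sub, hg m hm, sub_self], by ring⟩

theorem tendsto_tAdic_iff {α : Type*} {l : Filter α} {g : α → PowerSeries ℝ} {f : PowerSeries ℝ} :
    Tendsto g l (@nhds _ tAdicTopology f) ↔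
      ∀ n, ∀ᶠ a in l, ∀ m < n, coeff m (g a) = coeff m f := by
  rw [(hasBasis_nhds_tAdic f).tendsto_right_iff]
  simp

theorem mem_closure_tAdic_iff {s : Set (PowerSeries ℝ)} {f : PowerSeries ℝ} :
    f ∈ @closure _ tAdicTopology s ↔ ∀ n, ∃ g ∈ s, ∀ m < n, coeff m g = coeff m f := by
  rw [@mem_closure_iff_nhds_basis _ tAdicTopology _ _ _ _ _ (hasBasis_nhds_tAdic f)]
  simp

theorem rat_smul_mem_mzvPowerSeries {f : PowerSeries ℝ} (hf : f ∈ mzvPowerSeries) (a : ℚ) :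
    a • f ∈ mzvPowerSeries := fun n => by
  have : coeff n (a • f) = a • coeff n f := by
    rw [← LinearMap.restrictScalars_apply ℚ (coeff n) (a • f), map_smul]
    rfl
  rw [this]
  exact Subalgebra.smul_mem _ (hf n) a

theorem mul_X_pow_mem_mzvPowerSeries {f : PowerSeries ℝ} (hf : f ∈ mzvPowerSeries) (m : ℕ) :
    f * X ^ m ∈ mzvPowerSeries := fun n => by
  rw [coeff_mul_X_pow']
  split_ifs
  · exact hf _
  · exact zero_mem _

theorem smzvSpace_subset (b : Bullet) : smzvSpace b ⊆ mzvPowerSeries := by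
  rintro f ⟨a, k, e, -, hf⟩ n
  obtain ⟨N, hN⟩ := (tendsto_tAdic_iff.1 hf (n + 1)).exists
  rw [← hN n n.lt_succ_self, map_sum]
  exact sum_mem fun i _ =>
    rat_smul_mem_mzvPowerSeries (mul_X_pow_mem_mzvPowerSeries (smzv_mem b _) _) _ n

theorem smzvMap_mem (b : Bullet) (w : H1) : smzvMap b w ∈ mzvPowerSeries := fun n => by
  rw [smzvMap, Finsupp.linearCombination_apply, Finsupp.sum, map_sum]
  exact sum_mem fun k _ => rat_smul_mem_mzvPowerSeries (smzv_mem b k) _ n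

/-- A power series over `𝒵` is expanded by splitting off one `Z^•_Ŝ(w)` after the other, each chosen
with the required constant term. -/
theorem subset_smzvSpace' (b : Bullet) : mzvPowerSeries ⊆ smzvSpace' b := by
  intro f hf
  choose W hW using fun g : mzvPowerSeries => exists_coeff_smzvMap_eq b (g.2 0)
  let next : mzvPowerSeries → mzvPowerSeries := fun g =>
    ⟨PowerSeries.mk fun n => coeff (n + 1) (g.1 - smzvMap b (W g)), fun n => by
      rw [coeff_mk, map_sub]
      exact sub_mem (g.2 _) (smzvMap_mem b _ _)⟩
  have hnext : ∀ g, g.1 = smzvMap b (W g) + X * (next g).1 := by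
    intro g
    ext n
    cases n with
    | zero => simp [← hW g]
    | succ n => rw [map_add, coeff_succ_X_mul, coeff_mk, map_sub]; ring
  let r : ℕ → mzvPowerSeries := fun n => next^[n] ⟨f, hf⟩
  have hr : ∀ n, f = ∑ j ∈ Finset.range n, smzvMap b (W (r j)) * X ^ j + X ^ n * (r n).1 := by
    intro n
    induction n with
    | zero => simp [r]
    | succ n ih =>
      have h1 : r (n + 1) = next (r n) := Function.iterate_succ_apply' next n _
      rw [Finset.sum_range_succ, h1]
      conv_lhs => rw [ih, hnext (r n)]
      ring
  refine ⟨fun n => W (r n), tendsto_tAdic_iff.2 fun n => ?_⟩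
  filter_upwards [eventually_ge_atTop n] with N hN m hm
  conv_rhs => rw [hr N]
  rw [map_add, coeff_X_pow_mul', if_neg (by omega), add_zero]

theorem coeff_eq_of_isTAdicSum {u : ℕ → PowerSeries ℝ} {f : PowerSeries ℝ}
    (hf : IsTAdicSum (fun n => u n * X ^ n) f) {n m : ℕ} (hm : m < n) :
    coeff m f = ∑ i ∈ Finset.range n, coeff m (u i * X ^ i) := by
  obtain ⟨N, hN, hnN⟩ := ((tendsto_tAdic_iff.1 hf n).and (eventually_ge_atTop n)).exists
  rw [← hN m hm, map_sum]
  refine (Finset.sum_subset (Finset.range_subset_range.2 hnN) fun i _ hi => ?_).symm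
  have := Finset.mem_range.not.1 hi
  rw [coeff_mul_X_pow', if_neg (by omega)]

/-- The `Z^•_Ŝ(w_n)` are expanded into one series, indexed by the countable set `ℕ × Index`. Terms
that do not occur have the coefficient `0`; they are given large exponents to make the exponents
tend to infinity. -/
theorem smzvSpace'_subset (b : Bullet) : smzvSpace' b ⊆ smzvSpace b := by
  classical
  rintro f ⟨w, hf⟩
  obtain ⟨E⟩ : Nonempty (ℕ ≃ ℕ × Index) := ⟨(Denumerable.eqv (ℕ × Index)).symm⟩
  let e : ℕ × Index → ℕ := fun p =>
    if p.2 ∈ (w p.1).support then p.1 else p.1 + Encodable.encode p.2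
  have he : Tendsto e cofinite atTop := by
    refine tendsto_atTop.2 fun B => ?_
    have hfin : (⋃ n ∈ Finset.range B, (fun k => (n, k)) ''
        (((w n).support : Set Index) ∪ Encodable.encode ⁻¹' (Set.Iio B))).Finite := by
      refine Set.Finite.biUnion (Finset.finite_toSet _) fun n _ => Set.Finite.image _ ?_
      exact (Finset.finite_toSet _).union
        ((Set.finite_Iio B).preimage Encodable.encode_injective.injOn)
    refine hfin.subset ?_
    rintro ⟨n, k⟩ hp
    have hp : e (n, k) < B := not_le.1 hp
    simp only [Set.mem_iUnion]
    by_cases hk : k ∈ (w n).support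
    · simp only [e, if_pos hk] at hp
      exact ⟨n, Finset.mem_range.2 hp, k, Or.inl hk, rfl⟩
    · simp only [e, if_neg hk] at hp
      exact ⟨n, Finset.mem_range.2 (by omega), k, Or.inr (by simp; omega), rfl⟩
  refine ⟨fun i => w (E i).1 (E i).2, fun i => (E i).2, fun i => e (E i), ?_, ?_⟩
  · rw [← Nat.cofinite_eq_atTop]
    rw [← Nat.cofinite_eq_atTop] at he
    exact he.comp E.injective.tendsto_cofinite
  refine tendsto_tAdic_iff.2 fun n => ?_
  let K : Finset Index := (Finset.range n).biUnion fun i => (w i).support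
  let G : Finset ℕ := (Finset.range n ×ˢ K).map E.symm.toEmbedding
  filter_upwards [tendsto_finset_range.eventually_ge_atTop G] with N hN m hm
  set c : ℕ × Index → ℝ := fun p => coeff m (w p.1 p.2 • (smzv b p.2 * X ^ p.1)) with hc
  have h1 : ∀ p : ℕ × Index, coeff m (w p.1 p.2 • (smzv b p.2 * X ^ e p)) = c p := by
    intro p
    by_cases hp : p.2 ∈ (w p.1).support
    · simp only [hc, e, if_pos hp]
    · simp only [hc, Finsupp.notMem_support_iff.1 hp, zero_smul, map_zero]
  have h2 : ∀ p, p ∉ Finset.range n ×ˢ K → c p = 0 := by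
    rintro ⟨i, k⟩ hp
    by_cases hi : i < n
    · have hk : k ∉ (w i).support := fun hk => hp (Finset.mem_product.2
        ⟨Finset.mem_range.2 hi, Finset.mem_biUnion.2 ⟨i, Finset.mem_range.2 hi, hk⟩⟩)
      simp only [hc, Finsupp.notMem_support_iff.1 hk, zero_smul, map_zero]
    · have : w i k • (smzv b k * (X : PowerSeries ℝ) ^ i) = (w i k • smzv b k) * X ^ i :=
        (smul_mul_assoc _ _ _).symm
      simp only [hc]
      rw [this, coeff_mul_X_pow', if_neg (by omega)]
  calc coeff m (∑ i ∈ Finset.range N, w (E i).1 (E i).2 • (smzv b (E i).2 * X ^ e (E i)))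
      = ∑ i ∈ Finset.range N, c (E i) := by
        rw [map_sum]
        exact Finset.sum_congr rfl fun i _ => h1 (E i)
    _ = ∑ i ∈ G, c (E i) := by
        refine (Finset.sum_subset hN fun i _ hi => h2 _ fun h => hi ?_).symm
        exact Finset.mem_map.2 ⟨E i, h, by simp⟩
    _ = ∑ i ∈ Finset.range n, ∑ k ∈ K, c (i, k) := by
        rw [Finset.sum_map, ← Finset.sum_product']
        simp
    _ = coeff m f := by
        rw [coeff_eq_of_isTAdicSum hf hm]
        refine Finset.sum_congr rfl fun i hi => ?_
        rw [smzvMap, Finsupp.linearCombination_apply, Finsupp.sum_of_support_subset (s := K) _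
          (Finset.subset_biUnion_of_mem (fun i => (w i).support) hi) _ (by simp), Finset.sum_mul,
          map_sum]
        simp only [hc, smul_mul_assoc]

theorem smzvSpan_subset (b : Bullet) : (smzvSpan b : Set (PowerSeries ℝ)) ⊆ mzvPowerSeries := by
  intro f hf
  induction hf using Submodule.span_induction with
  | mem f hf =>
    obtain ⟨k, n, rfl⟩ := hf
    exact mul_X_pow_mem_mzvPowerSeries (smzv_mem b k) n
  | zero => exact fun n => by simp [zero_mem]
  | add f g _ _ hf hg => exact fun n => by rw [map_add]; exact add_mem (hf n) (hg n)
  | smul a f _ hf => exact rat_smul_mem_mzvPowerSeries hf a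

theorem smzvMap_mul_X_pow_mem_smzvSpan (b : Bullet) (w : H1) (n : ℕ) :
    smzvMap b w * X ^ n ∈ smzvSpan b := by
  rw [smzvMap, Finsupp.linearCombination_apply, Finsupp.sum, Finset.sum_mul]
  refine sum_mem fun k _ => ?_
  rw [smul_mul_assoc]
  exact Submodule.smul_mem _ _ (Submodule.subset_span ⟨k, n, rfl⟩)

theorem closure_smzvSpan (b : Bullet) :
    @closure _ tAdicTopology (smzvSpan b : Set (PowerSeries ℝ)) = mzvPowerSeries := by
  refine Set.Subset.antisymm (fun f hf n => ?_) fun f hf => ?_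
  · obtain ⟨g, hg, hfg⟩ := mem_closure_tAdic_iff.1 hf (n + 1)
    rw [← hfg n n.lt_succ_self]
    exact smzvSpan_subset b hg n
  · obtain ⟨w, hw⟩ := subset_smzvSpace' b hf
    refine mem_closure_tAdic_iff.2 fun n => ?_
    obtain ⟨N, hN⟩ := (tendsto_tAdic_iff.1 hw n).exists
    exact ⟨_, sum_mem fun i _ => smzvMap_mul_X_pow_mem_smzvSpan b (w i) i, hN⟩

end

end TAdicSMZV

theorem proposition4p4 (b : TAdicSMZV.Bullet) :
    TAdicSMZV.smzvSpace b = TAdicSMZV.smzvSpace' b ∧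
      TAdicSMZV.smzvSpace b = TAdicSMZV.mzvPowerSeries ∧
      @closure _ TAdicSMZV.tAdicTopology (TAdicSMZV.smzvSpan b : Set (PowerSeries ℝ)) =
        TAdicSMZV.mzvPowerSeries :=
  have h : TAdicSMZV.mzvPowerSeries ⊆ TAdicSMZV.smzvSpace b :=
    (TAdicSMZV.subset_smzvSpace' b).trans (TAdicSMZV.smzvSpace'_subset b)
  ⟨((TAdicSMZV.smzvSpace_subset b).trans (TAdicSMZV.subset_smzvSpace' b)).antisymm
    (TAdicSMZV.smzvSpace'_subset b), (TAdicSMZV.smzvSpace_subset b).antisymm h,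
    TAdicSMZV.closure_smzvSpan b⟩
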